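/- **Setting.** Let $I=[0,1]$ and let $\lambda_n,\delta_n>0$ be sequences with $\lambda_n\to0$, $\delta_n\to 0$. Put $N_n=\lfloor 1/\lambda_n\rfloor$. For each $n$ let $k_n\ge 1$ be an integer and let $Q_{k_n}=\{q^n_1,\dots,q^n_{k_n}\}\subset\mathbb S^2$ be a set of $k_n$ distinct points. Let $M_{k_n}=\bigcup_{l=1}^{k_n}\big(\mathbb S^2\cap (q^n_l)^\perp\big)$ be the union of the corresponding great circles. Assume that the sets $Q_{k_n}$ converge in the Kuratowski sense to a closed set $\overline Q$, i.e. every cluster point of a sequence $x_n\in Q_{k_n}$ belongs to $\overline Q$, and every point of $\overline Q$ is the limit of a sequence $x_n\in Q_{k_n}$. Let $C_n(I;M_{k_n})$ be the set of spin configurations $u=(u^0,\dots,u^{N_n})$ with $u^i\in M_{k_n}$ and $(u^1,u^0)=(u^{N_n},u^{N_n-1})$. Its elements have the energy $$H^{sl}_n(u)=\frac12\sum_{i=0}^{N_n-2}\lambda_n\big|u^i-2(1-\delta_n)u^{i+1}+u^{i+2}\big|^2 .$$ The chirality $T_n(u)\in L^1(I;\mathbb R^3)$ is the piecewise constant function equal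 to $z^i$ on $\lambda_n(i+[0,1))\cap I$, where $z^i=\frac{u^i\times u^{i+1}}{\sqrt{2\delta_n}}$ for $0\le i\le N_n-1$ and $z^{N_n}:=z^{N_n-1}$. For $z\in L^1(I;\mathbb R^3)$ set $$H^{sl,k_n}_n(z)=\inf\{H^{sl}_n(u):\ u\in C_n(I;M_{k_n}),\ T_n(u)=z\},\qquad \inf\emptyset=+\infty .$$ (The finitely many $n$ with $\lambda_n>1/2$ play no role.) For $K\subset\mathbb R^3$, let $BV_{\rm pc}(I,K)$ be the set of functions $z\in SBV((0,1);\mathbb R^3)$ with $z\in K$ a.e. for which there is a countable Caccioppoli partition $\{E_\alpha\}$ of $(0,1)$ (pairwise disjoint measurable sets covering $(0,1)$ up to a null set, with $\sum_\alpha P(E_\alpha;(0,1))<\infty$) such that $z$ is a.e. constant on each $E_\alpha$. Let $S(z)\subset(0,1)$ be the jump set of $z$, i.e. the set of points where $z$ has two distinct one-sided approximate limits. **Theorem.** Assume that $\lambda_n/\sqrt{\delta_n}\to0$ and $k_n\delta_n^{1/4}\to0$. Then the functionals $\dfrac{H_n^{sl,k_n}}{\sqrt2\,\lambda_n\delta_n^{3/2}}$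 $\Gamma$-converge with respect to the strong $L^1(I;\mathbb R^3)$-topology to the functional $$z\ \mapsto\ \begin{cases}\dfrac83\,\#S(z) & \text{if } z\in BV_{\rm pc}\big(I,\ \overline Q\cup(-\overline Q)\big),\\[2mm] +\infty&\text{otherwise.}\end{cases}$$ In particular, if the sets $Q_{k_n}$ are symmetric ($Q_{k_n}=-Q_{k_n}$), the limit is finite exactly on $BV_{\rm pc}(I,\overline Q)$. -/

import Mathlib

open Set Filter Topology MeasureTheory
open scoped ENNReal

noncomputable section

namespace HelicalXY

/-- Euclidean space `ℝ³`. -/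
abbrev E3 : Type := EuclideanSpace ℝ (Fin 3)

/-- The vector product of `ℝ³`. -/
def cross (a b : E3) : E3 := WithLp.toLp 2 (crossProduct a.ofLp b.ofLp)

/-- The space `L¹(I; ℝ³)`, `I = [0,1]`, with its norm. -/
abbrev L1I : Type := Lp E3 1 (volume.restrict (Icc (0 : ℝ) 1))

/-! ### Spin configurations, chirality and energy -/

/-- The great circle `𝕊² ∩ q^⊥`. -/
def greatCircle (q : E3) : Set E3 := {v | ‖v‖ = 1 ∧ inner ℝ q v = 0}

/-- The union `M` of the great circles associated with the points of `Q`. -/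
def circleUnion (Q : Set E3) : Set E3 := ⋃ q ∈ Q, greatCircle q

/-- The largest index of the lattice `{i ∈ ℤ : l * i ∈ [0,1]} = {0, …, [1/l]}`. -/
def lastIdx (l : ℝ) : ℕ := ⌊1 / l⌋₊

/-- Admissible configurations on the lattice `{0, …, [1/l]}` with values in `M` and with the boundary
condition `(u¹, u⁰) = (u^N, u^{N-1})`, `N = [1/l]`.
The values `u i` with `i > N` play no role in what follows. -/
def IsConfig (l : ℝ) (M : Set E3) (u : ℕ → E3) : Prop :=
  (∀ i ≤ lastIdx l, u i ∈ M) ∧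
    inner ℝ (u 1) (u 0) = inner ℝ (u (lastIdx l)) (u (lastIdx l - 1))

/-- The renormalized energy `(1/2) ∑ l |uⁱ - 2(1-d)uⁱ⁺¹ + uⁱ⁺²|²`, summed over all `i ≥ 0` such that
`i + 2 ≤ [1/l]`. -/
def sliceEnergy (l d : ℝ) (u : ℕ → E3) : ℝ :=
  1 / 2 * ∑ i ∈ Finset.range (lastIdx l - 1),
    l * ‖u i - (2 * (1 - d)) • u (i + 1) + u (i + 2)‖ ^ 2

/-- The order parameter `zⁱ = (uⁱ × uⁱ⁺¹) / √(2d)` for `i < N = [1/l]`, with `z^N := z^{N-1}`. -/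
def chirality (l d : ℝ) (u : ℕ → E3) (i : ℕ) : E3 :=
  (1 / √(2 * d)) • cross (u (min i (lastIdx l - 1))) (u (min i (lastIdx l - 1) + 1))

/-- The map `T`: the piecewise constant interpolation of the order parameter, equal to `zⁱ` on
`l (i + [0,1))`. -/
def chiralityFun (l d : ℝ) (u : ℕ → E3) (x : ℝ) : E3 := chirality l d u ⌊x / l⌋₊

/-- The constrained energy of `z ∈ L¹(I; ℝ³)`: the infimum of the energies of the configurations `u` with
values in the circles given by `Q` such that `T u = z`; it is `+∞` if there is no such `u`. -/
def constrainedEnergy (l d : ℝ) (Q : Set E3) (z : L1I) : ℝ≥0∞ :=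
  ⨅ (u : ℕ → E3) (_ : IsConfig l (circleUnion Q) u)
    (_ : (z : ℝ → E3) =ᵐ[volume.restrict (Icc (0 : ℝ) 1)] chiralityFun l d u),
    ENNReal.ofReal (sliceEnergy l d u)

/-- The rescaled constrained energy, divided by `√2 l d^{3/2}`. -/
def rescaledEnergy (l d : ℝ) (Q : Set E3) (z : L1I) : ℝ≥0∞ :=
  constrainedEnergy l d Q z / ENNReal.ofReal (√2 * l * d ^ (3 / 2 : ℝ))

/-! ### Kuratowski convergence and `Γ`-convergence -/

/-- Convergence in the sense of Kuratowski of a sequence of sets to a closed set. -/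
def KuratowskiTendsto {X : Type*} [TopologicalSpace X] (S : ℕ → Set X) (L : Set X) : Prop :=
  IsClosed L ∧
  (∀ x : ℕ → X, (∀ n, x n ∈ S n) → ∀ a, MapClusterPt a atTop x → a ∈ L) ∧
  (∀ a ∈ L, ∃ x : ℕ → X, (∀ n, x n ∈ S n) ∧ Tendsto x atTop (𝓝 a))

/-- `Γ`-convergence of functionals on a metric space (sequential definition). -/
def GammaTendsto {X : Type*} [MetricSpace X] (F : ℕ → X → ℝ≥0∞) (G : X → ℝ≥0∞) : Prop :=
  ∀ z : X,
    (∀ w : ℕ → X, Tendsto w atTop (𝓝 z) → G z ≤ liminf (fun n => F n (w n)) atTop) ∧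
    (∃ w : ℕ → X, Tendsto w atTop (𝓝 z) ∧ limsup (fun n => F n (w n)) atTop ≤ G z)

/-! ### Piecewise constant functions of bounded variation on the unit interval -/

/-- Scalar test functions of class `C¹` with compact support in `(0,1)`. -/
def IsTestFun (φ : ℝ → ℝ) : Prop :=
  ContDiff ℝ 1 φ ∧ HasCompactSupport φ ∧ tsupport φ ⊆ Ioo 0 1

/-- The (approximate) jump set of `z` in `(0,1)`: the points with distinct one-sided approximate limits. -/
def jumpSet (z : ℝ → E3) : Set ℝ :=
  {x | x ∈ Ioo (0 : ℝ) 1 ∧ ∃ a b : E3, a ≠ b ∧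
    Tendsto (fun r : ℝ => ⨍ y in Ioo (x - r) x, ‖z y - a‖) (𝓝[>] 0) (𝓝 0) ∧
    Tendsto (fun r : ℝ => ⨍ y in Ioo x (x + r), ‖z y - b‖) (𝓝[>] 0) (𝓝 0)}

/-- Special functions of bounded variation on `(0,1)`: the function is integrable and its distributional
derivative is `g dx + (σ - τ)`, with `g` integrable and with `σ - τ` a finite vector measure (given by
finite positive measures `σ j`, `τ j` for each component `j`) which is concentrated on the jump set. -/
def IsSBV (z : ℝ → E3) : Prop :=
  IntegrableOn z (Ioo 0 1) ∧
  ∃ (g : ℝ → E3) (σ τ : Fin 3 → Measure ℝ),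
    IntegrableOn g (Ioo 0 1) ∧
    (∀ j, IsFiniteMeasure (σ j) ∧ IsFiniteMeasure (τ j)) ∧
    (∀ j, σ j (jumpSet z)ᶜ = 0 ∧ τ j (jumpSet z)ᶜ = 0) ∧
    ∀ (j : Fin 3) (φ : ℝ → ℝ), IsTestFun φ →
      ∫ x in Ioo (0 : ℝ) 1, z x j * deriv φ x =
        -((∫ x in Ioo (0 : ℝ) 1, g x j * φ x) + ((∫ x, φ x ∂(σ j)) - ∫ x, φ x ∂(τ j)))

/-- The perimeter of `A` relative to `(0,1)`, that is, the total variation of the distributional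
derivative of its indicator function. -/
def perimeter (A : Set ℝ) : ℝ≥0∞ :=
  ⨆ (φ : ℝ → ℝ) (_ : IsTestFun φ ∧ ∀ x, |φ x| ≤ 1),
    ENNReal.ofReal (∫ x in A ∩ Ioo 0 1, deriv φ x)

/-- Countable Caccioppoli partitions of `(0,1)` (members are allowed to be empty). -/
def IsCaccioppoliPartition (A : ℕ → Set ℝ) : Prop :=
  (∀ m, MeasurableSet (A m) ∧ A m ⊆ Ioo 0 1) ∧
  Pairwise (fun m m' => Disjoint (A m) (A m')) ∧
  volume (Ioo (0 : ℝ) 1 \ ⋃ m, A m) = 0 ∧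
  ∑' m, perimeter (A m) < ∞

/-- `BV_pc(I, K)`: `SBV` functions which are constant on each element of a Caccioppoli
partition and take values in `K` (almost everywhere). -/
def IsBVpc (K : Set E3) (z : ℝ → E3) : Prop :=
  IsSBV z ∧
  (∃ A : ℕ → Set ℝ, IsCaccioppoliPartition A ∧
    ∀ m, ∃ c : E3, ∀ᵐ x ∂volume.restrict (A m), z x = c) ∧
  ∀ᵐ x ∂volume.restrict (Ioo (0 : ℝ) 1), z x ∈ K

open Classical in
/-- The limit functional: `(8/3) #S(z)` on `BV_pc(I, K)`, and `+∞` elsewhere. -/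
def limitEnergy (K : Set E3) (z : L1I) : ℝ≥0∞ :=
  if IsBVpc K z then ENNReal.ofReal (8 / 3) * ((jumpSet z).encard : ℝ≥0∞) else ∞

end HelicalXY

end

/-!
With `h = √(2δ)` the rescaled energy of a chain `u` of unit vectors is `∑ eterm h u i`. The second
difference `uⁱ - 2(1-δ)uⁱ⁺¹ + uⁱ⁺²` splits orthogonally into its component along `uⁱ⁺¹` and the
tangential one, which is the increment of the vector products. Hence, in terms of the chirality
`χⁱ = (uⁱ × uⁱ⁺¹)/h` and of its length, called the speed below, a summand of the energy is a
discrete Modica–Mortola density, essentially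
`h (1 - (|χⁱ|² + |χⁱ⁺¹|²)/2)² + |χⁱ⁺¹ - χⁱ|²/h` (`eterm_eq`). The potential vanishes on the whole
unit sphere, so that it is the restriction to `k` great circles which makes the set of wells
discrete and produces jumps.

*Lower bound.* Since `λ/h → 0`, the limit `z` of chains of bounded energy has speed one a.e.
(`BoundedSeq.ae_norm_eq_one`). The circles enforce rigidity: among `k + 1` consecutive spins, two lie
on the same great circle `q^⊥`, and a nearly straight arc which begins and ends on that circle runs
along it, so that the direction of `χ` is close to `±q` (`IsChain.exists_axis_near`). While the speed
stays above `η`, the direction of `χ` thus walks among the `2k` points `±q`; after erasing loops, the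
Cauchy–Schwarz inequality bounds its displacement by a multiple of `k √h`, which tends to zero
(`IsChain.norm_axis_sub_le`). Consequently, different values of `z` are separated by a site where the
speed is below `η`, and passing from one to almost zero and back costs at least about
`2 · 2 ∫₀¹ (1 - r²) dr = 8/3` (`IsChain.transCost_le_of_axis`). This bounds the number of disjoint
intervals at whose end points `z` differs, hence `z` is a step function with the right number of
jumps (`exists_isStep_of_card_le`), and its values are limits of points `±q`.

*Upper bound.* A function in `BV_pc` with finitely many jumps is a step function
(`IsBVpc.exists_isStep`): on an interval without jumps its derivative is a function, which vanishes
a.e. because only countably many values are taken. For a step function, spins rotate on the great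
circles orthogonal to axes `±q` which converge to its values. The speed follows the optimal profile
`w' = 1 - w²` in the form of an explicit Euler scheme (`eulerProfile`, `valleys`) and vanishes at the
jumps, where the chain changes from one circle to the next at a common point of the two. To arrive
there, the speed on each piece is multiplied by an amplitude close to one, found by the intermediate
value theorem (`exists_amplitude`); as `λ/h → 0`, a piece consists of many turns, and the
correction is of order `λ/h` and costs nothing in the limit (`exists_recovery_chain`).
-/

noncomputable section

namespace HelicalXY

/-! ### Vector algebra -/

theorem inner_eq_sum (a b : E3) : inner ℝ a b = a 0 * b 0 + a 1 * b 1 + a 2 * b 2 := by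
  simp [PiLp.inner_apply, Fin.sum_univ_three]; ring

theorem cross_zero_coord (a b : E3) : cross a b 0 = a 1 * b 2 - a 2 * b 1 := by
  simp [cross, crossProduct]

theorem cross_one_coord (a b : E3) : cross a b 1 = a 2 * b 0 - a 0 * b 2 := by
  simp [cross, crossProduct]

theorem cross_two_coord (a b : E3) : cross a b 2 = a 0 * b 1 - a 1 * b 0 := by
  simp [cross, crossProduct]

theorem E3.ext_coord {a b : E3} (h0 : a 0 = b 0) (h1 : a 1 = b 1) (h2 : a 2 = b 2) : a = b := by
  ext i; fin_cases i <;> assumption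

theorem cross_cross (a b c : E3) :
    cross a (cross b c) = (inner ℝ a c) • b - (inner ℝ a b) • c := by
  apply E3.ext_coord <;>
    simp [cross_zero_coord, cross_one_coord, cross_two_coord, inner_eq_sum] <;> ring

theorem cross_anticomm (a b : E3) : cross a b = -cross b a := by
  apply E3.ext_coord <;> simp [cross_zero_coord, cross_one_coord, cross_two_coord, mul_comm]

theorem cross_self (a : E3) : cross a a = 0 := by
  apply E3.ext_coord <;> simp [cross_zero_coord, cross_one_coord, cross_two_coord, mul_comm]

theorem cross_add (a b c : E3) : cross a (b + c) = cross a b + cross a c := by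
  apply E3.ext_coord <;> simp [cross_zero_coord, cross_one_coord, cross_two_coord] <;> ring

theorem add_cross (a b c : E3) : cross (a + b) c = cross a c + cross b c := by
  apply E3.ext_coord <;> simp [cross_zero_coord, cross_one_coord, cross_two_coord] <;> ring

theorem cross_sub (a b c : E3) : cross a (b - c) = cross a b - cross a c := by
  apply E3.ext_coord <;> simp [cross_zero_coord, cross_one_coord, cross_two_coord] <;> ring

theorem sub_cross (a b c : E3) : cross (a - b) c = cross a c - cross b c := by
  apply E3.ext_coord <;> simp [cross_zero_coord, cross_one_coord, cross_two_coord] <;> ring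

theorem cross_smul (r : ℝ) (a b : E3) : cross a (r • b) = r • cross a b := by
  apply E3.ext_coord <;> simp [cross_zero_coord, cross_one_coord, cross_two_coord] <;> ring

theorem smul_cross (r : ℝ) (a b : E3) : cross (r • a) b = r • cross a b := by
  apply E3.ext_coord <;> simp [cross_zero_coord, cross_one_coord, cross_two_coord] <;> ring

theorem inner_left_cross (a b : E3) : inner ℝ a (cross a b) = 0 := by
  simp only [inner_eq_sum, cross_zero_coord, cross_one_coord, cross_two_coord]; ring

theorem inner_right_cross (a b : E3) : inner ℝ b (cross a b) = 0 := by
  simp only [inner_eq_sum, cross_zero_coord, cross_one_coord, cross_two_coord]; ring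

/-- The Binet–Cauchy identity. -/
theorem inner_cross_cross (a b c d : E3) :
    inner ℝ (cross a b) (cross c d) =
      inner ℝ a c * inner ℝ b d - inner ℝ a d * inner ℝ b c := by
  simp only [inner_eq_sum, cross_zero_coord, cross_one_coord, cross_two_coord]; ring

theorem norm_cross_sq (a b : E3) :
    ‖cross a b‖ ^ 2 = ‖a‖ ^ 2 * ‖b‖ ^ 2 - (inner ℝ a b) ^ 2 := by
  rw [← real_inner_self_eq_norm_sq, inner_cross_cross, real_inner_self_eq_norm_sq,
    real_inner_self_eq_norm_sq, real_inner_comm a b]; ring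

theorem norm_cross_le (a b : E3) : ‖cross a b‖ ≤ ‖a‖ * ‖b‖ := by
  refine abs_le_of_sq_le_sq' ?_ (by positivity) |>.2
  rw [norm_cross_sq, mul_pow]; nlinarith [sq_nonneg (inner ℝ a b : ℝ)]

theorem norm_cross_of_inner_eq_zero {a b : E3} (h : inner ℝ a b = 0) :
    ‖cross a b‖ = ‖a‖ * ‖b‖ := by
  have := norm_cross_sq a b
  rw [h] at this
  rw [← sq_eq_sq₀ (by positivity) (by positivity), this]; ring

/-- Parseval's identity in the orthogonal frame `(u, Z × u, Z)`, where `u` is a unit vector and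
`Z ⊥ u`. -/
theorem inner_mul_norm_sq_frame {u Z : E3} (hu : ‖u‖ = 1) (hZ : inner ℝ Z u = 0) (q v : E3) :
    inner ℝ q v * ‖Z‖ ^ 2 = ‖Z‖ ^ 2 * (inner ℝ q u * inner ℝ u v)
      + inner ℝ q (cross Z u) * inner ℝ v (cross Z u) + inner ℝ q Z * inner ℝ v Z := by
  have h1 : (u 0 * u 0 + u 1 * u 1 + u 2 * u 2 : ℝ) = 1 := by
    rw [← inner_eq_sum, real_inner_self_eq_norm_sq, hu]; norm_num
  -- expand the product of two triple products as a Gram determinant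
  have gram : inner ℝ q (cross Z u) * inner ℝ v (cross Z u) =
      inner ℝ q v * (inner ℝ Z Z * inner ℝ u u - inner ℝ Z u * inner ℝ Z u)
      - inner ℝ q Z * (inner ℝ v Z * inner ℝ u u - inner ℝ Z u * inner ℝ v u)
      + inner ℝ q u * (inner ℝ v Z * inner ℝ Z u - inner ℝ Z Z * inner ℝ v u) := by
    simp only [inner_eq_sum, cross_zero_coord, cross_one_coord, cross_two_coord]; ring
  rw [gram, hZ, real_inner_self_eq_norm_sq, real_inner_self_eq_norm_sq, hu, real_inner_comm u v]
  ring

/-- Two unit vectors enclosing the inner product `c` satisfy `‖b - a‖² = 2 (1 - c)`. -/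
theorem norm_sub_sq_unit {a b : E3} (ha : ‖a‖ = 1) (hb : ‖b‖ = 1) :
    ‖b - a‖ ^ 2 = 2 * (1 - inner ℝ a b) := by
  rw [norm_sub_sq_real, ha, hb, real_inner_comm]; ring

/-- The second difference splits orthogonally into its part along the middle spin and its
tangential part, which is the increment of the vector products. -/
theorem norm_second_difference_sq {a b c : E3} (hb : ‖b‖ = 1) (m : ℝ) :
    ‖a - m • b + c‖ ^ 2 =
      (inner ℝ a b + inner ℝ b c - m) ^ 2 + ‖cross b c - cross a b‖ ^ 2 := by
  have h1 : (b 0 * b 0 + b 1 * b 1 + b 2 * b 2 : ℝ) = 1 := by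
    rw [← inner_eq_sum, real_inner_self_eq_norm_sq, hb]; norm_num
  have e1 : cross b c - cross a b = cross b (a - m • b + c) := by
    rw [cross_add, cross_sub, cross_smul, cross_self, cross_anticomm a b]; simp [add_comm]
  have e2 : inner ℝ a b + inner ℝ b c - m = inner ℝ b (a - m • b + c) := by
    rw [inner_add_right, inner_sub_right, real_inner_smul_right, real_inner_self_eq_norm_sq, hb,
      real_inner_comm]; ring
  rw [e1, e2, norm_cross_sq, hb]; ring

/-! ### Consecutive spins on great circles -/

/-- The normalized vector product `(u i × u (i+1)) / h` of consecutive spins. -/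
def chi (h : ℝ) (u : ℕ → E3) (i : ℕ) : E3 := (1 / h) • cross (u i) (u (i + 1))

theorem smul_chi {h : ℝ} (hh : 0 < h) (u : ℕ → E3) (i : ℕ) :
    h • chi h u i = cross (u i) (u (i + 1)) := by
  rw [chi, smul_smul, mul_one_div_cancel hh.ne', one_smul]

theorem inner_chi_left (h : ℝ) (u : ℕ → E3) (i : ℕ) : inner ℝ (chi h u i) (u i) = 0 := by
  rw [chi, real_inner_smul_left, real_inner_comm, inner_left_cross, mul_zero]

theorem inner_chi_right (h : ℝ) (u : ℕ → E3) (i : ℕ) : inner ℝ (chi h u i) (u (i + 1)) = 0 := by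
  rw [chi, real_inner_smul_left, real_inner_comm, inner_right_cross, mul_zero]

theorem succ_sub_eq {h : ℝ} (hh : 0 < h) {u : ℕ → E3} {i : ℕ} (hu : ‖u i‖ = 1) :
    u (i + 1) - u i = h • cross (chi h u i) (u i) - (1 - inner ℝ (u i) (u (i + 1))) • u i := by
  rw [← smul_cross, smul_chi hh, cross_anticomm, cross_cross, real_inner_self_eq_norm_sq, hu]
  module

theorem norm_chi_sq {h : ℝ} (hh : 0 < h) {u : ℕ → E3} {i : ℕ} (hu : ‖u i‖ = 1)
    (hu' : ‖u (i + 1)‖ = 1) :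
    (h * ‖chi h u i‖) ^ 2 =
      (1 - inner ℝ (u i) (u (i + 1))) * (2 - (1 - inner ℝ (u i) (u (i + 1)))) := by
  have : h * ‖chi h u i‖ = ‖cross (u i) (u (i + 1))‖ := by
    rw [← smul_chi hh, norm_smul, Real.norm_of_nonneg hh.le]
  rw [this, norm_cross_sq, hu, hu']; ring

theorem sub_eq_sum_Ico {u : ℕ → E3} {a b : ℕ} (hab : a ≤ b) :
    u b - u a = ∑ i ∈ Finset.Ico a b, (u (i + 1) - u i) :=
  (Finset.sum_Ico_sub u hab).symm

/-- A step whose rotation axis and base point are close to `Z` and `v` makes progress in the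
direction `Z × v`. -/
theorem half_mul_norm_step_le {h D : ℝ} (hh : 0 < h) {u : ℕ → E3} {i : ℕ} {v Z : E3}
    (h1 : ‖u i‖ = 1) (h2 : ‖u (i + 1)‖ = 1) (hv : ‖v‖ = 1) (hZv : inner ℝ Z v = 0)
    (hpos : 0 < ‖Z‖) (hD : D ≤ ‖Z‖ / 8) (hz : ‖chi h u i - Z‖ ≤ D)
    (hp : 1 - inner ℝ (u i) (u (i + 1)) ≤ (1 / 8 : ℝ)) (hclose : ‖u i - v‖ ≤ 1 / 8) :
    1 / 2 * ‖Z‖ * ‖u (i + 1) - u i‖ ≤ inner ℝ (u (i + 1) - u i) (cross Z v) := by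
  have hen : ‖cross Z v‖ = ‖Z‖ := by rw [norm_cross_of_inner_eq_zero hZv, hv, mul_one]
  have hd2 := norm_sub_sq_unit h1 h2
  have hzn := norm_chi_sq hh h1 h2
  have hstep := succ_sub_eq hh h1 (u := u)
  have hd0 : 0 ≤ ‖u (i + 1) - u i‖ := norm_nonneg _
  have hr0 : 0 ≤ ‖chi h u i‖ := norm_nonneg _
  have hr : ‖chi h u i‖ ≤ 9 / 8 * ‖Z‖ := by
    have := norm_sub_norm_le (chi h u i) Z
    linarith
  have main : 3 / 4 * ‖Z‖ ^ 2 ≤ inner ℝ (cross (chi h u i) (u i)) (cross Z v) := by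
    have dec : cross (chi h u i) (u i) =
        cross Z v + cross (chi h u i - Z) (u i) + cross Z (u i - v) := by
      rw [sub_cross, cross_sub]; abel
    rw [dec, inner_add_left, inner_add_left, real_inner_self_eq_norm_sq, hen]
    have b1 : |inner ℝ (cross (chi h u i - Z) (u i)) (cross Z v)| ≤ D * ‖Z‖ := by
      refine (abs_real_inner_le_norm _ _).trans ?_
      rw [hen]
      gcongr
      refine (norm_cross_le _ _).trans ?_
      rw [h1, mul_one]; exact hz
    have b2 : |inner ℝ (cross Z (u i - v)) (cross Z v)| ≤ ‖Z‖ * (1 / 8) * ‖Z‖ := by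
      refine (abs_real_inner_le_norm _ _).trans ?_
      rw [hen]
      gcongr
      refine (norm_cross_le _ _).trans ?_
      gcongr
    have := abs_le.1 b1
    have := abs_le.1 b2
    have : D * ‖Z‖ ≤ ‖Z‖ / 8 * ‖Z‖ := by gcongr
    linarith
  have b3 : inner ℝ (u i) (cross Z v) ≤ 1 / 8 * ‖Z‖ := by
    have e : inner ℝ (u i) (cross Z v) = inner ℝ (u i - v) (cross Z v) := by
      rw [inner_sub_left, inner_right_cross, sub_zero]
    rw [e]
    refine (real_inner_le_norm _ _).trans ?_
    rw [hen]
    gcongr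
  have e : inner ℝ (u (i + 1) - u i) (cross Z v) =
      h * inner ℝ (cross (chi h u i) (u i)) (cross Z v)
        - (1 - inner ℝ (u i) (u (i + 1))) * inner ℝ (u i) (cross Z v) := by
    rw [hstep, inner_sub_left, real_inner_smul_left, real_inner_smul_left]
  rw [e]
  generalize inner ℝ (cross (chi h u i) (u i)) (cross Z v) = A at *
  generalize inner ℝ (u i) (cross Z v) = B at *
  generalize inner ℝ (u i) (u (i + 1)) = c at *
  generalize ‖u (i + 1) - u i‖ = d at *
  generalize ‖chi h u i‖ = r at *
  generalize ‖Z‖ = ρ at *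
  have hd12 : d ≤ 1 / 2 := by nlinarith
  -- `d² (1 - p/2) = h² r²` with `p = 1 - c`
  have hdle : d ≤ 6 / 5 * h * ρ := by
    have hle : h * r ≤ h * (9 / 8 * ρ) := by gcongr
    have h4 : 15 / 16 * d ^ 2 ≤ (h * r) ^ 2 := by rw [hzn, hd2]; nlinarith
    have : d ^ 2 ≤ (6 / 5 * h * ρ) ^ 2 := by
      have h3 : (h * r) ^ 2 ≤ (h * (9 / 8 * ρ)) ^ 2 := by
        have : 0 ≤ h * r := mul_nonneg hh.le hr0
        gcongr
      nlinarith [sq_nonneg (h * ρ)]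
    exact abs_le_of_sq_le_sq' this (by positivity) |>.2
  have hp0 : 0 ≤ 1 - c := by nlinarith
  have b4 : (1 - c) * B ≤ (1 - c) * (1 / 8 * ρ) := by gcongr
  have b5 : 1 - c ≤ d / 4 := by nlinarith
  have b6 : (1 - c) * (1 / 8 * ρ) ≤ d / 4 * (1 / 8 * ρ) := by gcongr
  have b7 : d * ρ ≤ 6 / 5 * h * ρ * ρ := by gcongr
  have b8 : 6 / 5 * h * ρ * ρ = 6 / 5 * (h * ρ ^ 2) := by ring
  have b9 : h * (3 / 4 * ρ ^ 2) ≤ h * A := by gcongr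
  have b10 : 0 ≤ d * ρ := by positivity
  linarith

theorem abs_inner_step_le {h D : ℝ} {u : ℕ → E3} {i : ℕ} {Z : E3} (hz : ‖chi h u i - Z‖ ≤ D) :
    |inner ℝ (u (i + 1) - u i) Z| ≤ D * ‖u (i + 1) - u i‖ := by
  have e : inner ℝ (u (i + 1) - u i) Z = inner ℝ (u (i + 1) - u i) (Z - chi h u i) := by
    have : inner ℝ (u (i + 1) - u i) (chi h u i) = 0 := by
      rw [inner_sub_left, real_inner_comm, inner_chi_right, real_inner_comm, inner_chi_left,
        sub_zero]
    rw [inner_sub_right, this, sub_zero]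
  rw [e]
  refine (abs_real_inner_le_norm _ _).trans ?_
  rw [mul_comm]
  gcongr
  rw [norm_sub_rev]; exact hz

/-- If a chain of unit vectors starts and ends on the great circle `q^⊥`, and its rotation axes
`chi h u i` vary by at most `D`, then the first axis points in the direction of `±q`, up to an
error of order `D`. Indeed the chain is nearly straight, so that `q` is orthogonal to its initial
point and, up to the error, to its initial velocity; the conclusion states the latter. -/
theorem norm_cross_chi_le {h D : ℝ} (hh : 0 < h) {u : ℕ → E3} {a b : ℕ} (hab : a < b) {q : E3}
    (hq : ‖q‖ = 1) (hu : ∀ i ∈ Finset.Icc a b, ‖u i‖ = 1)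
    (hpos : 0 < ‖chi h u a‖) (hD : D ≤ ‖chi h u a‖ / 8)
    (hZ : ∀ i ∈ Finset.Ico a b, ‖chi h u i - chi h u a‖ ≤ D)
    (hp : ∀ i ∈ Finset.Ico a b, 1 - inner ℝ (u i) (u (i + 1)) ≤ (1 / 8 : ℝ))
    (hclose : ∀ i ∈ Finset.Icc a b, ‖u i - u a‖ ≤ 1 / 8)
    (hqa : inner ℝ q (u a) = 0) (hqb : inner ℝ q (u b) = 0) :
    |inner ℝ q (cross (chi h u a) (u a))| ≤ 2 * D := by
  set Z := chi h u a with hZdef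
  set ρ := ‖Z‖ with hρ
  set e := cross Z (u a) with he
  have hua : ‖u a‖ = 1 := hu a (by simp; omega)
  have hZa : inner ℝ Z (u a) = 0 := inner_chi_left h u a
  have hen : ‖e‖ = ρ := by rw [he, norm_cross_of_inner_eq_zero hZa, hua, mul_one]
  have hD0 : 0 ≤ D := (norm_nonneg _).trans (hZ a (by simp; omega))
  -- each step is nearly parallel to `e` and nearly orthogonal to `Z`
  have step : ∀ i ∈ Finset.Ico a b,
      1 / 2 * ρ * ‖u (i + 1) - u i‖ ≤ inner ℝ (u (i + 1) - u i) e ∧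
      |inner ℝ (u (i + 1) - u i) Z| ≤ D * ‖u (i + 1) - u i‖ := by
    intro i hi
    have hi' := Finset.mem_Ico.1 hi
    exact ⟨half_mul_norm_step_le hh (hu i (by simp; omega)) (hu (i + 1) (by simp; omega)) hua hZa
      hpos hD (hZ i hi) (hp i hi) (hclose i (by simp; omega)), abs_inner_step_le (hZ i hi)⟩
  have hv := sub_eq_sum_Ico (u := u) hab.le
  have v2 : 1 / 2 * ρ * ∑ i ∈ Finset.Ico a b, ‖u (i + 1) - u i‖ ≤ inner ℝ (u b - u a) e := by
    rw [hv, sum_inner, Finset.mul_sum]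
    exact Finset.sum_le_sum fun i hi => (step i hi).1
  have v3 : |inner ℝ (u b - u a) Z| ≤ D * ∑ i ∈ Finset.Ico a b, ‖u (i + 1) - u i‖ := by
    rw [hv, sum_inner, Finset.mul_sum]
    exact (Finset.abs_sum_le_sum_abs _ _).trans (Finset.sum_le_sum fun i hi => (step i hi).2)
  have hSpos : 0 < ∑ i ∈ Finset.Ico a b, ‖u (i + 1) - u i‖ := by
    have hmem : a ∈ Finset.Ico a b := by simp; omega
    refine Finset.sum_pos' (fun i _ => norm_nonneg _) ⟨a, hmem, ?_⟩
    rw [norm_pos_iff]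
    intro h0
    have : u (a + 1) = u a := sub_eq_zero.1 h0
    rw [hρ, hZdef, chi, this, cross_self] at hpos
    simp at hpos
  have frame := inner_mul_norm_sq_frame hua hZa q (u b - u a)
  rw [inner_sub_right, hqa, hqb] at frame
  have key : inner ℝ q e * inner ℝ (u b - u a) e = -(inner ℝ q Z * inner ℝ (u b - u a) Z) := by
    rw [he]; linarith only [frame]
  have hqZ : |inner ℝ q Z| ≤ ρ := by
    have := abs_real_inner_le_norm q Z
    rwa [hq, one_mul] at this
  clear_value e
  generalize ∑ i ∈ Finset.Ico a b, ‖u (i + 1) - u i‖ = S at *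
  generalize inner ℝ (u b - u a) e = x at *
  generalize inner ℝ (u b - u a) Z = y at *
  generalize inner ℝ q e = s at *
  generalize inner ℝ q Z = t at *
  have hle : |s| * (1 / 2 * ρ * S) ≤ ρ * (D * S) := by
    calc |s| * (1 / 2 * ρ * S) ≤ |s| * |x| := by
          gcongr; exact v2.trans (le_abs_self _)
      _ = |t| * |y| := by rw [← abs_mul, key, abs_neg, abs_mul]
      _ ≤ _ := by gcongr
  have hfin : |s| * (ρ * S) ≤ (2 * D) * (ρ * S) := by linarith
  exact le_of_mul_le_mul_right hfin (by positivity)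

/-- In the plane `u^⊥`, a unit vector `q` whose component orthogonal to `Z` is small points, up to
the sign, in the direction of `Z`. -/
theorem exists_sign_norm_sub_le {D : ℝ} {u Z q : E3} (hu : ‖u‖ = 1) (hq : ‖q‖ = 1)
    (hZu : inner ℝ Z u = 0) (hqu : inner ℝ q u = 0) (hZ : 0 < ‖Z‖)
    (hD : |inner ℝ q (cross Z u)| ≤ 2 * D) :
    ∃ y : E3, (y = q ∨ y = -q) ∧ ‖(1 / ‖Z‖) • Z - y‖ ≤ 3 * D / ‖Z‖ := by
  set ρ := ‖Z‖ with hρ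
  have hD0 : 0 ≤ D := by have := abs_nonneg (inner ℝ q (cross Z u)); linarith
  have frame := inner_mul_norm_sq_frame hu hZu q q
  rw [real_inner_self_eq_norm_sq, hq, hqu] at frame
  have hsq : (inner ℝ q (cross Z u)) ^ 2 ≤ (2 * D) ^ 2 := sq_le_sq' (by
    linarith [(abs_le.1 hD).1]) (abs_le.1 hD).2
  have hqZ : |inner ℝ q Z| ≤ ρ := by
    have := abs_real_inner_le_norm q Z
    rwa [hq, one_mul] at this
  set s := inner ℝ q Z with hs
  have habs : ρ ^ 2 - |s| ^ 2 ≤ 4 * D ^ 2 := by rw [sq_abs]; nlinarith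
  -- reduce to `‖Z - ρ y‖ ≤ 3 D`
  have key : ∀ y : E3, ‖y‖ = 1 → inner ℝ y Z = |s| → ‖(1 / ρ) • Z - y‖ ≤ 3 * D / ρ := by
    intro y hy hys
    have e1 : (1 / ρ) • Z - y = (1 / ρ) • (Z - ρ • y) := by
      rw [smul_sub, smul_smul, one_div_mul_cancel hZ.ne', one_smul]
    have e2 : ‖Z - ρ • y‖ ^ 2 = 2 * ρ * (ρ - |s|) := by
      rw [norm_sub_sq_real, norm_smul, hy, real_inner_smul_right, real_inner_comm, hys,
        Real.norm_of_nonneg hZ.le, ← hρ]; ring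
    have e3 : ‖Z - ρ • y‖ ≤ 3 * D := by
      refine abs_le_of_sq_le_sq' ?_ (by positivity) |>.2
      rw [e2]
      have : ρ * (ρ - |s|) ≤ (ρ + |s|) * (ρ - |s|) := by
        apply mul_le_mul_of_nonneg_right _ (by linarith)
        linarith [abs_nonneg s]
      nlinarith
    rw [e1, norm_smul, Real.norm_of_nonneg (by positivity), div_mul_eq_mul_div, one_mul]
    gcongr
  rcases le_total 0 s with h0 | h0
  · exact ⟨q, Or.inl rfl, key q hq (abs_of_nonneg h0).symm⟩
  · exact ⟨-q, Or.inr rfl, key (-q) (by rw [norm_neg, hq]) (by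
      rw [inner_neg_left, abs_of_nonpos h0])⟩

theorem norm_normalize_sub_le {η : ℝ} (hη : 0 < η) {a b : E3} (ha : η ≤ ‖a‖) (hb : b ≠ 0) :
    ‖(1 / ‖a‖) • a - (1 / ‖b‖) • b‖ ≤ 2 * ‖a - b‖ / η := by
  have hap : 0 < ‖a‖ := hη.trans_le ha
  have hbp : 0 < ‖b‖ := norm_pos_iff.2 hb
  have e : (1 / ‖a‖) • a - (1 / ‖b‖) • b =
      (1 / ‖a‖) • ((a - b) + ((‖b‖ - ‖a‖) / ‖b‖) • b) := by
    rw [smul_add, smul_sub, smul_smul, sub_div, div_self hbp.ne', mul_sub, mul_one, sub_smul]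
    have : 1 / ‖a‖ * (‖a‖ / ‖b‖) = 1 / ‖b‖ := by field_simp
    rw [this]; abel
  rw [e, norm_smul, Real.norm_of_nonneg (by positivity), div_mul_eq_mul_div, one_mul]
  have : ‖(a - b) + ((‖b‖ - ‖a‖) / ‖b‖) • b‖ ≤ 2 * ‖a - b‖ := by
    refine (norm_add_le _ _).trans ?_
    rw [norm_smul, norm_div, norm_norm, div_mul_cancel₀ _ hbp.ne']
    have := abs_norm_sub_norm_le b a
    rw [norm_sub_rev] at this
    rw [Real.norm_eq_abs]; linarith
  gcongr

/-- A walk through a finite set `Y` whose steps are controlled by weights attached to the sites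
can be made simple by erasing loops, so its end points are at most twice the total weight apart. -/
theorem dist_add_le_of_walk {X : Type*} [PseudoMetricSpace X] [DecidableEq X] (R : X → ℝ)
    (hR : ∀ x, 0 ≤ R x) (Y : Finset X) (J : ℕ) (y : ℕ → X) (hy : ∀ j ≤ J, y j ∈ Y)
    (hstep : ∀ j < J, dist (y j) (y (j + 1)) ≤ R (y j) + R (y (j + 1))) :
    dist (y 0) (y J) + R (y 0) ≤ 2 * ∑ x ∈ Y, R x := by
  induction hn : Y.card generalizing Y J y with
  | zero =>
    have := hy 0 (Nat.zero_le _)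
    rw [Finset.card_eq_zero.1 hn] at this
    simp at this
  | succ n ih =>
    -- leave the starting site for the last time
    have h0 : y 0 ∈ Y := hy 0 (Nat.zero_le _)
    have hsum : ∑ x ∈ Y, R x = R (y 0) + ∑ x ∈ Y.erase (y 0), R x :=
      (Finset.add_sum_erase Y R h0).symm
    have hrest : 0 ≤ ∑ x ∈ Y.erase (y 0), R x := Finset.sum_nonneg fun x _ => hR x
    obtain ⟨l, hl, hmax⟩ : ∃ l ∈ (Finset.range (J + 1)).filter (fun j => y j = y 0),
        ∀ j ∈ (Finset.range (J + 1)).filter (fun j => y j = y 0), j ≤ l := by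
      have hne : ((Finset.range (J + 1)).filter (fun j => y j = y 0)).Nonempty :=
        ⟨0, by simp⟩
      exact ⟨_, Finset.max'_mem _ hne, fun j hj => Finset.le_max' _ j hj⟩
    simp only [Finset.mem_filter, Finset.mem_range] at hl hmax
    rcases eq_or_lt_of_le (Nat.lt_succ_iff.1 hl.1) with hlJ | hlJ
    · rw [← hlJ, hl.2, dist_self, hsum]
      linarith [hR (y 0)]
    · have hsub := ih (Y.erase (y 0)) (J - (l + 1)) (fun j => y (l + 1 + j))
        (fun j hj => by
          refine Finset.mem_erase.2 ⟨fun h => ?_, hy _ (by omega)⟩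
          have := hmax (l + 1 + j) ⟨by omega, h⟩
          omega)
        (fun j hj => hstep (l + 1 + j) (by omega))
        (by rw [Finset.card_erase_of_mem h0, hn]; rfl)
      simp only [add_zero] at hsub
      have e : l + 1 + (J - (l + 1)) = J := by omega
      rw [e] at hsub
      have h1 := hstep l hlJ
      rw [hl.2] at h1
      have h2 := dist_triangle (y 0) (y (l + 1)) (y J)
      rw [hsum]
      linarith

/-- The Cauchy–Schwarz form of `dist_add_le_of_walk`: only the number of available sites enters, not
the number of steps. The weight of a site is the `ℓ²`-norm of the radii of its visits. -/
theorem dist_le_of_walk {X : Type*} [PseudoMetricSpace X] (r : ℕ → ℝ)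
    (Y : Finset X) (J : ℕ) (y : ℕ → X) (hy : ∀ j ≤ J, y j ∈ Y)
    (hstep : ∀ j < J, dist (y j) (y (j + 1)) ≤ r j + r (j + 1)) :
    dist (y 0) (y J) ≤ 2 * √(Y.card * ∑ j ∈ Finset.range (J + 1), r j ^ 2) := by
  classical
  set R : X → ℝ := fun x => √(∑ j ∈ (Finset.range (J + 1)).filter (fun j => y j = x), r j ^ 2)
    with hRdef
  have hle : ∀ j ≤ J, r j ≤ R (y j) := by
    intro j hj
    refine Real.le_sqrt_of_sq_le ?_
    exact Finset.single_le_sum (f := fun j => r j ^ 2) (fun i _ => sq_nonneg _)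
      (by simp; omega)
  have h1 := dist_add_le_of_walk R (fun x => Real.sqrt_nonneg _) Y J y hy (fun j hj =>
    (hstep j hj).trans (add_le_add (hle j hj.le) (hle (j + 1) hj)))
  have h2 : ∑ x ∈ Y, R x ≤ √(Y.card * ∑ j ∈ Finset.range (J + 1), r j ^ 2) := by
    refine Real.le_sqrt_of_sq_le ?_
    refine (sq_sum_le_card_mul_sum_sq).trans ?_
    gcongr
    rw [← Finset.sum_fiberwise_of_maps_to (s := Finset.range (J + 1)) (t := Y) (g := y)
      (fun j hj => hy j (by simpa [Nat.lt_succ_iff] using hj))]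
    apply le_of_eq
    exact Finset.sum_congr rfl fun x _ => Real.sq_sqrt (Finset.sum_nonneg fun j _ => sq_nonneg _)
  have h3 : 0 ≤ R (y 0) := Real.sqrt_nonneg _
  linarith

/-! ### Chains of bounded energy and the rigidity of their axis -/

/-- One summand of the rescaled energy, in terms of `h = √(2δ)`. -/
def eterm (h : ℝ) (u : ℕ → E3) (i : ℕ) : ℝ :=
  ‖u i - (2 - h ^ 2) • u (i + 1) + u (i + 2)‖ ^ 2 / h ^ 3

theorem eterm_nonneg {h : ℝ} (hh : 0 < h) (u : ℕ → E3) (i : ℕ) : 0 ≤ eterm h u i := by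
  unfold eterm; positivity

/-- The energy density is the sum of a potential term and of a gradient term in `chi`. -/
theorem eterm_eq {h : ℝ} (hh : 0 < h) {u : ℕ → E3} {i : ℕ} (hu : ‖u (i + 1)‖ = 1) :
    eterm h u i = (h ^ 2 - (1 - inner ℝ (u i) (u (i + 1))) -
        (1 - inner ℝ (u (i + 1)) (u (i + 2)))) ^ 2 / h ^ 3
      + ‖chi h u (i + 1) - chi h u i‖ ^ 2 / h := by
  have e : cross (u (i + 1)) (u (i + 2)) - cross (u i) (u (i + 1)) =
      h • (chi h u (i + 1) - chi h u i) := by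
    rw [smul_sub, smul_chi hh, smul_chi hh]
  rw [eterm, norm_second_difference_sq hu, e, norm_smul, Real.norm_of_nonneg hh.le]
  field_simp
  ring

theorem norm_chi_sub_sq_le {h : ℝ} (hh : 0 < h) {u : ℕ → E3} {i : ℕ} (hu : ‖u (i + 1)‖ = 1) :
    ‖chi h u (i + 1) - chi h u i‖ ^ 2 ≤ h * eterm h u i := by
  rw [eterm_eq hh hu, mul_add, mul_div_cancel₀ _ hh.ne']
  have : 0 ≤ h * ((h ^ 2 - (1 - inner ℝ (u i) (u (i + 1))) -
        (1 - inner ℝ (u (i + 1)) (u (i + 2)))) ^ 2 / h ^ 3) := by positivity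
  linarith

theorem one_sub_inner_nonneg {a b : E3} (ha : ‖a‖ = 1) (hb : ‖b‖ = 1) :
    0 ≤ 1 - inner ℝ a b := by
  have := norm_sub_sq_unit ha hb
  nlinarith [sq_nonneg ‖b - a‖]

section Chain

/-- A chain of `N + 1` unit vectors with rescaled energy at most `C`. -/
structure IsChain (h C : ℝ) (N : ℕ) (u : ℕ → E3) : Prop where
  h_pos : 0 < h
  two_le : 2 ≤ N
  unit : ∀ i ≤ N, ‖u i‖ = 1
  energy : ∑ i ∈ Finset.range (N - 1), eterm h u i ≤ C

variable {h C : ℝ} {N : ℕ} {u : ℕ → E3}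

theorem IsChain.sum_le (H : IsChain h C N u) {s : Finset ℕ} (hs : s ⊆ Finset.range (N - 1)) :
    ∑ i ∈ s, eterm h u i ≤ C :=
  (Finset.sum_le_sum_of_subset_of_nonneg hs fun i _ _ => eterm_nonneg H.h_pos u i).trans H.energy

theorem IsChain.eterm_le (H : IsChain h C N u) {i : ℕ} (hi : i < N - 1) : eterm h u i ≤ C := by
  simpa using H.sum_le (s := {i}) (by simpa using hi)

theorem IsChain.C_nonneg (H : IsChain h C N u) : 0 ≤ C :=
  (Finset.sum_nonneg fun i _ => eterm_nonneg H.h_pos u i).trans H.energy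

theorem IsChain.add_le (H : IsChain h C N u) {i : ℕ} (hi : i < N - 1) :
    (1 - inner ℝ (u i) (u (i + 1))) + (1 - inner ℝ (u (i + 1)) (u (i + 2))) ≤
      h ^ 2 + √(C * h ^ 3) := by
  have h1 := H.eterm_le hi
  have hh := H.h_pos
  rw [eterm_eq hh (H.unit _ (by omega))] at h1
  have h2 : (h ^ 2 - (1 - inner ℝ (u i) (u (i + 1))) -
        (1 - inner ℝ (u (i + 1)) (u (i + 2)))) ^ 2 / h ^ 3 ≤ C := by
    have : 0 ≤ ‖chi h u (i + 1) - chi h u i‖ ^ 2 / h := by positivity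
    linarith
  rw [div_le_iff₀ (by positivity)] at h2
  have := abs_le.1 (Real.abs_le_sqrt h2)
  linarith

/-- Consecutive spins enclose small angles. -/
theorem IsChain.one_sub_inner_le (H : IsChain h C N u) {i : ℕ} (hi : i < N) :
    1 - inner ℝ (u i) (u (i + 1)) ≤ h ^ 2 + √(C * h ^ 3) := by
  have h2 := H.two_le
  rcases lt_or_ge i (N - 1) with h1 | h1
  · have := H.add_le h1
    have := one_sub_inner_nonneg (H.unit (i + 1) (by omega)) (H.unit (i + 2) (by omega))
    linarith
  · obtain ⟨j, rfl⟩ : ∃ j, i = j + 1 := ⟨i - 1, by omega⟩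
    have := H.add_le (i := j) (by omega)
    have := one_sub_inner_nonneg (H.unit j (by omega)) (H.unit (j + 1) (by omega))
    linarith

theorem IsChain.norm_chi_sub_le (H : IsChain h C N u) {a b : ℕ} (hab : a ≤ b) (hb : b < N) :
    ‖chi h u b - chi h u a‖ ≤ √((b - a : ℕ) * (h * ∑ i ∈ Finset.Ico a b, eterm h u i)) := by
  have e : chi h u b - chi h u a = ∑ i ∈ Finset.Ico a b, (chi h u (i + 1) - chi h u i) :=
    (Finset.sum_Ico_sub (chi h u) hab).symm
  rw [e]
  refine (norm_sum_le _ _).trans (Real.le_sqrt_of_sq_le ?_)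
  refine sq_sum_le_card_mul_sum_sq.trans ?_
  rw [Nat.card_Ico]
  refine mul_le_mul_of_nonneg_left ?_ (by positivity)
  rw [Finset.mul_sum]
  refine Finset.sum_le_sum fun i hi => ?_
  exact norm_chi_sub_sq_le H.h_pos (H.unit _ (by have := Finset.mem_Ico.1 hi; omega))

/-- Any two products of a window of length `k` differ by at most `√(k h E)`, `E` being the energy
of the window. -/
theorem IsChain.norm_chi_sub_window_le (H : IsChain h C N u) {p k a b : ℕ} (hpk : p + k < N)
    (ha : a ∈ Finset.Icc p (p + k)) (hb : b ∈ Finset.Icc p (p + k)) :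
    ‖chi h u b - chi h u a‖ ≤ √(k * (h * ∑ i ∈ Finset.Ico p (p + k), eterm h u i)) := by
  wlog hab : a ≤ b generalizing a b
  · rw [norm_sub_rev]; exact this hb ha (by omega)
  rw [Finset.mem_Icc] at ha hb
  refine (H.norm_chi_sub_le hab (by omega)).trans (Real.sqrt_le_sqrt ?_)
  have hh := H.h_pos
  have h1 : ∑ i ∈ Finset.Ico a b, eterm h u i ≤ ∑ i ∈ Finset.Ico p (p + k), eterm h u i :=
    Finset.sum_le_sum_of_subset_of_nonneg (Finset.Ico_subset_Ico ha.1 hb.2)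
      fun i _ _ => eterm_nonneg hh u i
  have h2 : 0 ≤ ∑ i ∈ Finset.Ico a b, eterm h u i :=
    Finset.sum_nonneg fun i _ => eterm_nonneg hh u i
  have h3 : ((b - a : ℕ) : ℝ) ≤ k := by exact_mod_cast (by omega)
  gcongr

/-- The smallness conditions on `h`, for given bounds `k` on the number of circles, `C` on the
energy and `η` on the speed, under which a chain cannot change its axis. -/
structure IsFine (h C η : ℝ) (k : ℕ) : Prop where
  eta_pos : 0 < η
  one_le : 1 ≤ k
  angle : h ^ 2 + √(C * h ^ 3) ≤ 1 / 8
  arc : k * √(2 * (h ^ 2 + √(C * h ^ 3))) ≤ 1 / 8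
  speed : √(k * (h * C)) ≤ η / 8

/-- The arc covered by a window of length `k` is short. -/
theorem IsChain.norm_sub_le (H : IsChain h C N u) {k a b : ℕ} (hab : a ≤ b)
    (hb : b ≤ N) (hk : b - a ≤ k) :
    ‖u b - u a‖ ≤ k * √(2 * (h ^ 2 + √(C * h ^ 3))) := by
  rw [sub_eq_sum_Ico hab]
  refine (norm_sum_le _ _).trans ?_
  have : ∀ i ∈ Finset.Ico a b, ‖u (i + 1) - u i‖ ≤ √(2 * (h ^ 2 + √(C * h ^ 3))) := by
    intro i hi
    have hi' := Finset.mem_Ico.1 hi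
    refine Real.le_sqrt_of_sq_le ?_
    rw [norm_sub_sq_unit (H.unit i (by omega)) (H.unit _ (by omega))]
    gcongr
    exact H.one_sub_inner_le (by omega)
  refine (Finset.sum_le_card_nsmul _ _ _ this).trans ?_
  rw [nsmul_eq_mul, Nat.card_Ico]
  gcongr

/-- The direction of the vector product, that is, the axis of the rotation from `u i` to `u (i+1)`.
It is zero if the vector product vanishes. -/
def axis (h : ℝ) (u : ℕ → E3) (i : ℕ) : E3 := (1 / ‖chi h u i‖) • chi h u i

/-- Among `k + 1` consecutive spins two lie on the same great circle, which determines the axis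
of the whole window. -/
theorem IsChain.exists_axis_near (H : IsChain h C N u) {η : ℝ} {k : ℕ} (F : IsFine h C η k)
    {q : Fin k → E3} (hq : ∀ j, ‖q j‖ = 1) (hu : ∀ i ≤ N, u i ∈ circleUnion (range q))
    {p : ℕ} (hp : p + k < N) (hη : ∀ i ∈ Finset.Icc p (p + k), η ≤ ‖chi h u i‖) :
    ∃ j, ∃ y, (y = q j ∨ y = -q j) ∧ ∀ i ∈ Finset.Icc p (p + k),
      ‖axis h u i - y‖ ≤ 5 / η * √(k * (h * ∑ i ∈ Finset.Ico p (p + k), eterm h u i)) := by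
  have hcirc : ∀ i ≤ N, ∃ j, inner ℝ (q j) (u i) = 0 := by
    intro i hi
    have := hu i hi
    simp only [circleUnion, greatCircle, mem_range, iUnion_exists, iUnion_iUnion_eq',
      mem_iUnion, mem_ofPred_eq] at this
    obtain ⟨j, hj⟩ := this
    exact ⟨j, hj.2⟩
  have : Nonempty (Fin k) := ⟨⟨0, F.one_le⟩⟩
  choose! J hJ using hcirc
  obtain ⟨a, ha, b, hb, hab, hJab⟩ : ∃ a ∈ Finset.Icc p (p + k), ∃ b ∈ Finset.Icc p (p + k),
      a < b ∧ J a = J b := by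
    obtain ⟨a, ha, b, hb, hne, he⟩ := Finset.exists_ne_map_eq_of_card_lt_of_maps_to
      (s := Finset.Icc p (p + k)) (t := (Finset.univ : Finset (Fin k))) (f := J)
      (by simp; omega) (fun _ _ => Finset.mem_univ _)
    rcases lt_or_gt_of_ne hne with h | h
    · exact ⟨a, ha, b, hb, h, he⟩
    · exact ⟨b, hb, a, ha, h, he.symm⟩
  have hh := H.h_pos
  have hηp := F.eta_pos
  set D := √(k * (h * ∑ i ∈ Finset.Ico p (p + k), eterm h u i)) with hD
  have hDη : D ≤ η / 8 := by
    refine (Real.sqrt_le_sqrt ?_).trans F.speed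
    have : ∑ i ∈ Finset.Ico p (p + k), eterm h u i ≤ C :=
      H.sum_le fun i hi => by simp at hi ⊢; omega
    gcongr
  have hw : ∀ i ∈ Finset.Icc p (p + k), ∀ i' ∈ Finset.Icc p (p + k),
      ‖chi h u i' - chi h u i‖ ≤ D := fun i hi i' hi' => H.norm_chi_sub_window_le hp hi hi'
  have ha' := Finset.mem_Icc.1 ha
  have hb' := Finset.mem_Icc.1 hb
  have hZa : η ≤ ‖chi h u a‖ := hη a ha
  have hqa : inner ℝ (q (J a)) (u a) = 0 := hJ a (by omega)
  have hcross := norm_cross_chi_le hh hab (hq (J a)) (D := D)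
    (fun i hi => H.unit i (by have := Finset.mem_Icc.1 hi; omega)) (hηp.trans_le hZa)
    (by linarith)
    (fun i hi => hw a ha i (by have := Finset.mem_Ico.1 hi; simp; omega))
    (fun i hi => (H.one_sub_inner_le (by have := Finset.mem_Ico.1 hi; omega)).trans F.angle)
    (fun i hi => by
      have := Finset.mem_Icc.1 hi
      exact (H.norm_sub_le (k := k) (by omega) (by omega) (by omega)).trans F.arc)
    hqa (by rw [hJab]; exact hJ b (by omega))
  obtain ⟨y, hy, hya⟩ := exists_sign_norm_sub_le (H.unit a (by omega)) (hq (J a))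
    (inner_chi_left h u a) hqa (hηp.trans_le hZa) hcross
  refine ⟨J a, y, hy, fun i hi => ?_⟩
  have h1 : ‖axis h u i - axis h u a‖ ≤ 2 * D / η := by
    refine (norm_normalize_sub_le hηp (hη i hi) ?_).trans ?_
    · rw [← norm_pos_iff]; exact hηp.trans_le hZa
    · gcongr; exact hw a ha i hi
  have h2 : 3 * D / ‖chi h u a‖ ≤ 3 * D / η := by gcongr
  calc ‖axis h u i - y‖ ≤ ‖axis h u i - axis h u a‖ + ‖axis h u a - y‖ :=
        norm_sub_le_norm_sub_add_norm_sub _ _ _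
    _ ≤ 2 * D / η + 3 * D / η := add_le_add h1 (hya.trans h2)
    _ = 5 / η * D := by ring

/-- As long as its speed is at least `η`, a chain on `k` great circles essentially keeps its axis:
the axis wanders among the `2k` points `±q j`, and by the Cauchy–Schwarz inequality the total
length of its steps is controlled by `k √h`. -/
theorem IsChain.norm_axis_sub_le (H : IsChain h C N u) {η : ℝ} {k : ℕ} (F : IsFine h C η k)
    {q : Fin k → E3} (hq : ∀ j, ‖q j‖ = 1) (hu : ∀ i ≤ N, u i ∈ circleUnion (range q))
    {a b : ℕ} (hab : a ≤ b) (hb : b < N) (hη : ∀ i ∈ Finset.Icc a b, η ≤ ‖chi h u i‖) :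
    ‖axis h u b - axis h u a‖ ≤ 30 / η * (k * √(C * h)) := by
  classical
  have hh := H.h_pos
  have hηp := F.eta_pos
  have hk := F.one_le
  have hC := H.C_nonneg
  have hsqrt : √(k * (h * C)) ≤ k * √(C * h) := by
    refine Real.sqrt_le_iff.2 ⟨by positivity, ?_⟩
    rw [mul_pow, Real.sq_sqrt (by positivity)]
    have : (k : ℝ) ≤ k ^ 2 := by
      have : (1 : ℝ) ≤ k := by exact_mod_cast hk
      nlinarith
    nlinarith [mul_nonneg hh.le hC]
  -- `J` disjoint windows, and a remainder of length less than `k`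
  obtain ⟨J, hJ1, hJ2⟩ : ∃ J, a + J * k ≤ b ∧ b < a + J * k + k := by
    refine ⟨(b - a) / k, ?_, ?_⟩
    · have := Nat.div_mul_le_self (b - a) k; omega
    · have := Nat.lt_div_mul_add (a := b - a) (b := k) (by omega); omega
  have hrem : ‖axis h u b - axis h u (a + J * k)‖ ≤ 2 / η * (k * √(C * h)) := by
    have hm : η ≤ ‖chi h u (a + J * k)‖ := hη _ (by simp; omega)
    refine (norm_normalize_sub_le hηp (hη b (by simp; omega)) ?_).trans ?_
    · rw [← norm_pos_iff]; exact hηp.trans_le hm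
    · rw [div_mul_eq_mul_div]
      gcongr
      refine ((H.norm_chi_sub_le hJ1 hb).trans (Real.sqrt_le_sqrt ?_)).trans hsqrt
      have h1 : ∑ i ∈ Finset.Ico (a + J * k) b, eterm h u i ≤ C :=
        H.sum_le fun i hi => by simp at hi ⊢; omega
      have h2 : 0 ≤ ∑ i ∈ Finset.Ico (a + J * k) b, eterm h u i :=
        Finset.sum_nonneg fun i _ => eterm_nonneg hh u i
      have h3 : ((b - (a + J * k) : ℕ) : ℝ) ≤ k := by exact_mod_cast (by omega)
      gcongr
  rcases Nat.eq_zero_or_pos J with rfl | hJpos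
  · rw [zero_mul, add_zero] at hrem
    refine hrem.trans ?_
    gcongr; norm_num
  set p : ℕ → ℕ := fun j => a + j * k with hp
  have hple : ∀ j < J, p j + k ≤ a + J * k := by
    intro j hj
    have : (j + 1) * k ≤ J * k := Nat.mul_le_mul_right _ hj
    simp only [hp]; rw [Nat.add_mul] at this; omega
  set R : ℕ → ℝ := fun j => 5 / η * √(k * (h * ∑ i ∈ Finset.Ico (p j) (p j + k), eterm h u i))
    with hR
  have hwin : ∀ j < J, ∃ y ∈ Finset.univ.image q ∪ Finset.univ.image (fun j => -q j),
      ∀ i ∈ Finset.Icc (p j) (p j + k), ‖axis h u i - y‖ ≤ R j := by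
    intro j hj
    have hj' := hple j hj
    have hpj : a ≤ p j := Nat.le_add_right _ _
    obtain ⟨l, y, hy, hyi⟩ := H.exists_axis_near F hq hu (p := p j) (by omega)
      (fun i hi => hη i (by rw [Finset.mem_Icc] at hi ⊢; constructor <;> omega))
    refine ⟨y, ?_, hyi⟩
    simp only [Finset.mem_union, Finset.mem_image, Finset.mem_univ, true_and]
    rcases hy with rfl | rfl
    · exact Or.inl ⟨l, rfl⟩
    · exact Or.inr ⟨l, rfl⟩
  choose! y hyY hyR using hwin
  set Y := Finset.univ.image q ∪ Finset.univ.image (fun j => -q j) with hY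
  have hYcard : (Y.card : ℝ) ≤ 2 * k := by
    have : Y.card ≤ k + k := (Finset.card_union_le _ _).trans (add_le_add
      (Finset.card_image_le.trans (by simp)) (Finset.card_image_le.trans (by simp)))
    have : (Y.card : ℝ) ≤ (k + k : ℕ) := by exact_mod_cast this
    push_cast at this; linarith
  have hwalk := dist_le_of_walk R Y (J - 1) y (fun j hj => hyY j (by omega)) (fun j hj => by
    have e : p (j + 1) = p j + k := by simp only [hp]; ring
    have h1 := hyR j (by omega) (p (j + 1)) (by rw [e]; simp)
    have h2 := hyR (j + 1) (by omega) (p (j + 1)) (by simp)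
    rw [dist_eq_norm]
    calc ‖y j - y (j + 1)‖ ≤ ‖y j - axis h u (p (j + 1))‖ + ‖axis h u (p (j + 1)) - y (j + 1)‖ :=
          norm_sub_le_norm_sub_add_norm_sub _ _ _
      _ ≤ _ := by rw [norm_sub_rev (y j)]; linarith)
  have hJs : J - 1 + 1 = J := by omega
  rw [hJs] at hwalk
  have hsum : ∀ J', ∑ j ∈ Finset.range J', ∑ i ∈ Finset.Ico (p j) (p j + k), eterm h u i
      = ∑ i ∈ Finset.Ico a (a + J' * k), eterm h u i := by
    intro J'
    induction J' with
    | zero => simp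
    | succ n ih =>
      rw [Finset.sum_range_succ, ih]
      have e : a + (n + 1) * k = p n + k := by simp only [hp]; ring
      rw [e]
      exact Finset.sum_Ico_consecutive _ (Nat.le_add_right _ _) (Nat.le_add_right _ _)
  have htot : ∑ i ∈ Finset.Ico a (a + J * k), eterm h u i ≤ C :=
    H.sum_le fun i hi => by simp at hi ⊢; omega
  have hRsum : ∑ j ∈ Finset.range J, R j ^ 2 ≤ (5 / η) ^ 2 * (k * (h * C)) := by
    have : ∀ j, R j ^ 2 =
        (5 / η) ^ 2 * (k * (h * ∑ i ∈ Finset.Ico (p j) (p j + k), eterm h u i)) := by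
      intro j
      have : 0 ≤ ∑ i ∈ Finset.Ico (p j) (p j + k), eterm h u i :=
        Finset.sum_nonneg fun i _ => eterm_nonneg hh u i
      simp only [hR]
      rw [mul_pow, Real.sq_sqrt (by positivity)]
    simp_rw [this]
    rw [← Finset.mul_sum, ← Finset.mul_sum, ← Finset.mul_sum, hsum]
    gcongr
  have hwalk2 : dist (y 0) (y (J - 1)) ≤ 15 / η * (k * √(C * h)) := by
    refine hwalk.trans ?_
    have : √(Y.card * ∑ j ∈ Finset.range J, R j ^ 2) ≤ 15 / 2 / η * (k * √(C * h)) := by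
      refine Real.sqrt_le_iff.2 ⟨by positivity, ?_⟩
      calc (Y.card : ℝ) * ∑ j ∈ Finset.range J, R j ^ 2
          ≤ (2 * k) * ((5 / η) ^ 2 * (k * (h * C))) := by gcongr
        _ ≤ (15 / 2 / η * (k * √(C * h))) ^ 2 := by
          rw [mul_pow, mul_pow, Real.sq_sqrt (by positivity), div_pow, div_pow]
          have : 0 ≤ (k : ℝ) ^ 2 * (C * h) / η ^ 2 := by positivity
          have e1 : 2 * (k : ℝ) * (5 ^ 2 / η ^ 2 * (k * (h * C))) =
            50 * ((k : ℝ) ^ 2 * (C * h) / η ^ 2) := by ring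
          have e2 : (15 / 2) ^ 2 / η ^ 2 * ((k : ℝ) ^ 2 * (C * h)) =
            225 / 4 * ((k : ℝ) ^ 2 * (C * h) / η ^ 2) := by ring
          rw [e1, e2]; linarith
    have e : 15 / η * (k * √(C * h)) = 2 * (15 / 2 / η * (k * √(C * h))) := by ring
    rw [e]; gcongr
  have hRle : ∀ j < J, R j ≤ 5 / η * (k * √(C * h)) := by
    intro j hj
    simp only [hR]
    gcongr
    refine (Real.sqrt_le_sqrt ?_).trans hsqrt
    have : ∑ i ∈ Finset.Ico (p j) (p j + k), eterm h u i ≤ C :=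
      H.sum_le fun i hi => by have := hple j hj; simp at hi ⊢; omega
    gcongr
  have hstart : ‖axis h u a - y 0‖ ≤ R 0 := hyR 0 hJpos a (by simp [hp])
  have hend : ‖axis h u (a + J * k) - y (J - 1)‖ ≤ R (J - 1) := by
    refine hyR (J - 1) (by omega) _ ?_
    have e : a + J * k = p (J - 1) + k := by
      obtain ⟨J', rfl⟩ : ∃ J', J = J' + 1 := ⟨J - 1, by omega⟩
      simp only [hp, Nat.add_sub_cancel]; ring
    rw [e]; simp
  have e : axis h u b - axis h u a = (axis h u b - axis h u (a + J * k)) +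
      (axis h u (a + J * k) - y (J - 1)) + (y (J - 1) - y 0) + (y 0 - axis h u a) := by abel
  rw [e]
  refine (norm_add₄_le).trans ?_
  rw [dist_eq_norm, norm_sub_rev] at hwalk2
  rw [norm_sub_rev] at hstart
  have f1 := hRle 0 hJpos
  have f2 := hRle (J - 1) (by omega)
  have e3 : 30 / η * (k * √(C * h)) = 2 / η * (k * √(C * h)) + 5 / η * (k * √(C * h))
    + 15 / η * (k * √(C * h)) + 5 / η * (k * √(C * h)) + 3 / η * (k * √(C * h)) := by ring
  have : 0 ≤ 3 / η * (k * √(C * h)) := by positivity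
  linarith

end Chain

/-! ### The cost of a transition -/

section Cost

/-- The primitive of `1 - r²`, cut off at `1 - η`. Only speeds below `1 - η` contribute to its
increments; there `1 - r²` is bounded below and absorbs the discretization errors. -/
def wellPrim (η r : ℝ) : ℝ := min r (1 - η) - (min r (1 - η)) ^ 3 / 3

theorem wellPrim_of_le {η r : ℝ} (h : r ≤ 1 - η) : wellPrim η r = r - r ^ 3 / 3 := by
  rw [wellPrim, min_eq_left h]

theorem wellPrim_of_ge {η r : ℝ} (h : 1 - η ≤ r) :
    wellPrim η r = (1 - η) - (1 - η) ^ 3 / 3 := by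
  rw [wellPrim, min_eq_right h]

theorem sub_cube_mono {a b : ℝ} (ha : 0 ≤ a) (hab : a ≤ b) (hb : b ≤ 1) :
    a - a ^ 3 / 3 ≤ b - b ^ 3 / 3 := by
  have e : (b - b ^ 3 / 3) - (a - a ^ 3 / 3) = (b - a) * (1 - (a ^ 2 + a * b + b ^ 2) / 3) := by
    ring
  have : 0 ≤ (b - a) * (1 - (a ^ 2 + a * b + b ^ 2) / 3) :=
    mul_nonneg (by linarith) (by nlinarith)
  linarith

theorem abs_wellPrim_sub_le {η a b : ℝ} (hη : 0 < η) (hη1 : η ≤ 1 / 2) (ha : 0 ≤ a) (hb : 0 ≤ b)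
    (ha1 : a ≤ 1) (hb1 : b ≤ 1) (hle : min a b ≤ 1 - η) :
    |wellPrim η b - wellPrim η a| ≤ |b - a| * (1 - (a ^ 2 + a * b + b ^ 2) / 3) := by
  wlog hab : a ≤ b generalizing a b
  · have := this hb ha hb1 ha1 (by rwa [min_comm]) (by linarith)
    rw [abs_sub_comm, abs_sub_comm b a]
    refine this.trans (le_of_eq ?_); ring
  rw [min_eq_left hab] at hle
  have e : |b - a| * (1 - (a ^ 2 + a * b + b ^ 2) / 3) = (b - b ^ 3 / 3) - (a - a ^ 3 / 3) := by
    rw [abs_of_nonneg (by linarith)]; ring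
  rw [e, wellPrim_of_le hle]
  have h1 : a - a ^ 3 / 3 ≤ wellPrim η b :=
    sub_cube_mono ha (le_min hab hle) ((min_le_right _ _).trans (by linarith))
  have h2 : wellPrim η b ≤ b - b ^ 3 / 3 :=
    sub_cube_mono (le_min hb (by linarith)) (min_le_left _ _) hb1
  rw [abs_of_nonneg (by linarith)]
  linarith

/-- Here `P = (1 - cos)/h²` and `a` is the speed; the two are related by `a² = P (2 - h² P)`, so that
`2 P` agrees with `a²` up to a factor close to one. -/
theorem two_mul_le_of_sq_eq {h τ P a : ℝ} (hτ0 : 0 ≤ τ) (hτ1 : τ ≤ 1) (hP : 0 ≤ P)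
    (hτ : h ^ 2 * P ≤ τ) (ha : a ^ 2 = P * (2 - h ^ 2 * P)) : 2 * P ≤ a ^ 2 * (1 + τ) := by
  rw [ha]
  have h1 : P * (2 - τ) ≤ P * (2 - h ^ 2 * P) := by gcongr
  have h2 : P * (2 - τ) * (1 + τ) ≤ P * (2 - h ^ 2 * P) * (1 + τ) := by gcongr
  have h3 : P * (2 - τ) * (1 + τ) = 2 * P + P * τ * (1 - τ) := by ring
  have h4 : 0 ≤ P * τ * (1 - τ) := mul_nonneg (mul_nonneg hP hτ0) (by linarith)
  linarith

/-- Below the speed `1 - η/2` the potential `1 - P - P'` dominates, up to the factor `1 - η`, the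
difference quotient `1 - (a² + ab + b²)/3` of the primitive of `1 - r²`. -/
theorem mul_one_sub_le_of_speed {η τ a b P P' : ℝ} (hη : 0 < η) (hη1 : η ≤ 1 / 2)
    (ha : 0 ≤ a) (hb : 0 ≤ b) (ha1 : a ≤ 1 - η / 2) (hb1 : b ≤ 1 - η / 2) (hτ0 : 0 ≤ τ)
    (hsmall : 2 * τ + (b - a) ^ 2 ≤ η ^ 2 / 4)
    (hP : 2 * P ≤ a ^ 2 * (1 + τ)) (hP' : 2 * P' ≤ b ^ 2 * (1 + τ)) :
    (1 - η) * (1 - (a ^ 2 + a * b + b ^ 2) / 3) ≤ 1 - P - P' := by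
  have q1 : a ^ 2 ≤ 1 - η / 2 := by nlinarith
  have q2 : b ^ 2 ≤ 1 - η / 2 := by nlinarith
  have q3 : a * b ≤ 1 - η / 2 := by nlinarith
  have s1 : (a ^ 2 + a * b + b ^ 2) / 3 ≤ 1 - η / 2 := by linarith
  have s2 : a ^ 2 + b ^ 2 ≤ 2 := by linarith
  have s3 : (a ^ 2 + b ^ 2) * τ ≤ 2 * τ := by gcongr
  have s4 : (a ^ 2 + b ^ 2) / 2 = (a ^ 2 + a * b + b ^ 2) / 3 + (b - a) ^ 2 / 6 := by ring
  have s5 : η * (η / 2) ≤ η * (1 - (a ^ 2 + a * b + b ^ 2) / 3) := by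
    gcongr; linarith
  have s6 : η * (η / 2) = η ^ 2 / 2 := by ring
  have s7 := sq_nonneg (b - a)
  have s8 := sq_nonneg η
  linarith

/-- The scalar form of the discrete Modica–Mortola inequality: `a`, `b` are consecutive speeds,
`c`, `c'` the cosines of the angles between consecutive spins, and `d` the increment of the
vector products. -/
theorem wellPrim_scalar {h C η τ a b c c' d E : ℝ} (hh : 0 < h) (hη : 0 < η) (hη1 : η ≤ 1 / 2)
    (hC : 0 ≤ C) (hτ0 : 0 ≤ τ) (hsmall : 2 * τ + h * C ≤ η ^ 2 / 4) (hnn : 0 ≤ E)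
    (e : E = (h ^ 2 - (1 - c) - (1 - c')) ^ 2 / h ^ 3 + d ^ 2 / h)
    (hp : (h * a) ^ 2 = (1 - c) * (2 - (1 - c))) (hp' : (h * b) ^ 2 = (1 - c') * (2 - (1 - c')))
    (hp0 : 0 ≤ 1 - c) (hp0' : 0 ≤ 1 - c') (hτ : 1 - c ≤ τ) (hτ' : 1 - c' ≤ τ)
    (hd : (b - a) ^ 2 ≤ d ^ 2) (hβ : (b - a) ^ 2 ≤ h * C) (ha : 0 ≤ a) (hb : 0 ≤ b) :
    2 * (1 - η) * |wellPrim η b - wellPrim η a| ≤ E := by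
  have hhC : 0 ≤ h * C := by positivity
  rcases le_or_gt (min a b) (1 - η) with hmin | hmin
  swap
  · have h1 : 1 - η ≤ a := (hmin.trans_le (min_le_left _ _)).le
    have h2 : 1 - η ≤ b := (hmin.trans_le (min_le_right _ _)).le
    rw [wellPrim_of_ge h1, wellPrim_of_ge h2]; simpa
  have habs : |b - a| ≤ η / 2 := abs_le_of_sq_le_sq (by nlinarith) (by positivity)
  have hle : a ≤ 1 - η / 2 ∧ b ≤ 1 - η / 2 := by
    have := abs_le.1 habs
    rcases min_le_iff.1 hmin with h | h <;> constructor <;> linarith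
  refine (mul_le_mul_of_nonneg_left (abs_wellPrim_sub_le hη hη1 ha hb (by linarith) (by linarith)
    hmin) (by linarith)).trans ?_
  -- express everything by `P = (1 - c) / h²`, `P' = (1 - c') / h²`
  obtain ⟨P, hP⟩ : ∃ P, P = (1 - c) / h ^ 2 := ⟨_, rfl⟩
  obtain ⟨P', hP'⟩ : ∃ P', P' = (1 - c') / h ^ 2 := ⟨_, rfl⟩
  have hPc : 1 - c = h ^ 2 * P := by rw [hP]; field_simp
  have hPc' : 1 - c' = h ^ 2 * P' := by rw [hP']; field_simp
  rw [hPc] at hp hτ hp0 e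
  rw [hPc'] at hp' hτ' hp0' e
  have hh2 : 0 < h ^ 2 := by positivity
  have hP0 : 0 ≤ P := by rw [hP]; rw [← hPc] at hp0; positivity
  have hP0' : 0 ≤ P' := by rw [hP']; rw [← hPc'] at hp0'; positivity
  have ha2 : a ^ 2 = P * (2 - h ^ 2 * P) := by
    have : h ^ 2 * a ^ 2 = h ^ 2 * (P * (2 - h ^ 2 * P)) := by rw [← mul_pow, hp]; ring
    exact mul_left_cancel₀ hh2.ne' this
  have hb2 : b ^ 2 = P' * (2 - h ^ 2 * P') := by
    have : h ^ 2 * b ^ 2 = h ^ 2 * (P' * (2 - h ^ 2 * P')) := by rw [← mul_pow, hp']; ring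
    exact mul_left_cancel₀ hh2.ne' this
  have hτ1 : τ ≤ 1 / 16 := by nlinarith
  have k1 := two_mul_le_of_sq_eq hτ0 (by linarith) hP0 hτ ha2
  have k2 := two_mul_le_of_sq_eq hτ0 (by linarith) hP0' hτ' hb2
  have hS := mul_one_sub_le_of_speed hη hη1 ha hb hle.1 hle.2 hτ0 (by linarith) k1 k2
  have e2 : E = h * (1 - P - P') ^ 2 + d ^ 2 / h := by
    rw [e]; field_simp
  have e3 : 2 * ((1 - P - P') * |b - a|) ≤ E := by
    have : (b - a) ^ 2 / h ≤ d ^ 2 / h := by gcongr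
    have h0 : 0 ≤ (h * (1 - P - P') - |b - a|) ^ 2 / h := by positivity
    have h1 : (h * (1 - P - P') - |b - a|) ^ 2 / h =
        h * (1 - P - P') ^ 2 - 2 * ((1 - P - P') * |b - a|) + (b - a) ^ 2 / h := by
      rw [sub_sq, sq_abs]; field_simp
    rw [e2]; linarith
  have e4 : ((1 - η) * (1 - (a ^ 2 + a * b + b ^ 2) / 3)) * |b - a| ≤ (1 - P - P') * |b - a| := by
    gcongr
  linarith

variable {h C : ℝ} {N : ℕ} {u : ℕ → E3}

/-- The discrete Modica–Mortola inequality. -/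
theorem IsChain.wellPrim_le_eterm (H : IsChain h C N u) {η : ℝ} (hη : 0 < η) (hη1 : η ≤ 1 / 2)
    (hsmall : 2 * (h ^ 2 + √(C * h ^ 3)) + h * C ≤ η ^ 2 / 4) {i : ℕ} (hi : i < N - 1) :
    2 * (1 - η) * |wellPrim η ‖chi h u (i + 1)‖ - wellPrim η ‖chi h u i‖| ≤ eterm h u i := by
  have hh := H.h_pos
  have hu0 := H.unit i (by omega)
  have hu1 := H.unit (i + 1) (by omega)
  have hu2 := H.unit (i + 2) (by omega)
  have hnn := eterm_nonneg hh u i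
  have hC := H.C_nonneg
  have e := eterm_eq hh hu1
  have hp := norm_chi_sq hh hu0 hu1
  have hp' := norm_chi_sq hh hu1 hu2
  have hp0 := one_sub_inner_nonneg hu0 hu1
  have hp0' := one_sub_inner_nonneg hu1 hu2
  have hτ := H.one_sub_inner_le (i := i) (by omega)
  have hτ' := H.one_sub_inner_le (i := i + 1) (by omega)
  have hd : (‖chi h u (i + 1)‖ - ‖chi h u i‖) ^ 2 ≤ ‖chi h u (i + 1) - chi h u i‖ ^ 2 := by
    rw [← sq_abs (‖chi h u (i + 1)‖ - ‖chi h u i‖)]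
    gcongr
    exact abs_norm_sub_norm_le _ _
  have hβ : (‖chi h u (i + 1)‖ - ‖chi h u i‖) ^ 2 ≤ h * C :=
    hd.trans ((norm_chi_sub_sq_le hh hu1).trans (by have := H.eterm_le hi; gcongr))
  have ha := norm_nonneg (chi h u i)
  have hb := norm_nonneg (chi h u (i + 1))
  have hτ0 : 0 ≤ h ^ 2 + √(C * h ^ 3) := by positivity
  exact wellPrim_scalar hh hη hη1 hC hτ0 hsmall hnn e hp hp' hp0 hp0' hτ hτ' hd hβ ha hb

theorem IsChain.wellPrim_le_sum (H : IsChain h C N u) {η : ℝ} (hη : 0 < η) (hη1 : η ≤ 1 / 2)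
    (hsmall : 2 * (h ^ 2 + √(C * h ^ 3)) + h * C ≤ η ^ 2 / 4) {a b : ℕ} (hab : a ≤ b)
    (hb : b < N) :
    2 * (1 - η) * |wellPrim η ‖chi h u b‖ - wellPrim η ‖chi h u a‖| ≤
      ∑ i ∈ Finset.Ico a b, eterm h u i := by
  rw [← Finset.sum_Ico_sub (fun i => wellPrim η ‖chi h u i‖) hab]
  refine (mul_le_mul_of_nonneg_left (Finset.abs_sum_le_sum_abs _ _) (by linarith)).trans ?_
  rw [Finset.mul_sum]
  refine Finset.sum_le_sum fun i hi => ?_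
  exact H.wellPrim_le_eterm hη hη1 hsmall (by have := Finset.mem_Ico.1 hi; omega)

/-- The lower bound for the cost of a transition: twice the increment of `2 (1 - η) wellPrim η`
between the speeds `η` and `1 - η`. It tends to `8/3` as `η → 0`. -/
def transCost (η : ℝ) : ℝ :=
  4 * (1 - η) * (((1 - η) - (1 - η) ^ 3 / 3) - (η - η ^ 3 / 3))

/-- A chain that passes from speed `≥ 1 - η` to speed `≤ η` and back pays at least
`transCost η`. -/
theorem IsChain.transCost_le_sum (H : IsChain h C N u) {η : ℝ} (hη : 0 < η) (hη1 : η ≤ 1 / 2)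
    (hsmall : 2 * (h ^ 2 + √(C * h ^ 3)) + h * C ≤ η ^ 2 / 4) {a b c : ℕ} (hab : a ≤ b)
    (hbc : b ≤ c) (hc : c < N) (ha' : 1 - η ≤ ‖chi h u a‖) (hb' : ‖chi h u b‖ ≤ η)
    (hc' : 1 - η ≤ ‖chi h u c‖) :
    transCost η ≤ ∑ i ∈ Finset.Ico a c, eterm h u i := by
  have h1 := H.wellPrim_le_sum hη hη1 hsmall hab (by omega)
  have h2 := H.wellPrim_le_sum hη hη1 hsmall hbc hc
  rw [← Finset.sum_Ico_consecutive _ hab hbc]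
  rw [wellPrim_of_ge ha', wellPrim_of_le (by linarith : ‖chi h u b‖ ≤ 1 - η), abs_sub_comm] at h1
  rw [wellPrim_of_ge hc', wellPrim_of_le (by linarith : ‖chi h u b‖ ≤ 1 - η)] at h2
  have h3 := sub_cube_mono (norm_nonneg _) hb' (by linarith)
  have h4 : (1 - η - (1 - η) ^ 3 / 3) - (η - η ^ 3 / 3) ≤
    |1 - η - (1 - η) ^ 3 / 3 - (‖chi h u b‖ - ‖chi h u b‖ ^ 3 / 3)| :=
      le_trans (by linarith) (le_abs_self _)
  have h5 : 2 * (1 - η) * ((1 - η - (1 - η) ^ 3 / 3) - (η - η ^ 3 / 3)) ≤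
    2 * (1 - η) * |1 - η - (1 - η) ^ 3 / 3 - (‖chi h u b‖ - ‖chi h u b‖ ^ 3 / 3)| :=
    mul_le_mul_of_nonneg_left h4 (by linarith)
  rw [transCost]
  linarith

theorem tendsto_transCost : Tendsto transCost (𝓝[>] 0) (𝓝 (8 / 3)) := by
  have : Continuous transCost := by unfold transCost; fun_prop
  have h := (this.tendsto 0).mono_left (nhdsWithin_le_nhds (s := Ioi 0))
  convert h using 2
  norm_num [transCost]

/-- A change of the axis costs at least `transCost η`. -/
theorem IsChain.transCost_le_of_axis (H : IsChain h C N u) {η : ℝ} {k : ℕ} (F : IsFine h C η k)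
    (hη1 : η ≤ 1 / 2) (hsmall : 2 * (h ^ 2 + √(C * h ^ 3)) + h * C ≤ η ^ 2 / 4)
    {q : Fin k → E3} (hq : ∀ j, ‖q j‖ = 1) (hu : ∀ i ≤ N, u i ∈ circleUnion (range q))
    {a b : ℕ} (hab : a ≤ b) (hb : b < N)
    (ha' : 1 - η ≤ ‖chi h u a‖) (hb' : 1 - η ≤ ‖chi h u b‖)
    (hax : 30 / η * (k * √(C * h)) < ‖axis h u b - axis h u a‖) :
    transCost η ≤ ∑ i ∈ Finset.Ico a b, eterm h u i := by
  by_cases hall : ∀ i ∈ Finset.Icc a b, η ≤ ‖chi h u i‖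
  · exact absurd (H.norm_axis_sub_le F hq hu hab hb hall) (not_le.2 hax)
  · push Not at hall
    obtain ⟨i, hi, hlt⟩ := hall
    rw [Finset.mem_Icc] at hi
    exact H.transCost_le_sum F.eta_pos hη1 hsmall hi.1 hi.2 hb ha' hlt.le hb'

end Cost

/-! ### Step functions -/

/-- A function which is a.e. constant on a one-sided neighbourhood has there an approximate limit,
and no other one. -/
theorem tendsto_average_iff {z : ℝ → E3} {s : ℝ → Set ℝ} {ρ : ℝ} (hρ : 0 < ρ) {c : E3}
    (hs : ∀ r ∈ Ioo 0 ρ, volume (s r) ≠ 0 ∧ volume (s r) ≠ ∞ ∧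
      ∀ᵐ y ∂volume.restrict (s r), z y = c) (a : E3) :
    Tendsto (fun r : ℝ => ⨍ y in s r, ‖z y - a‖) (𝓝[>] 0) (𝓝 0) ↔ c = a := by
  have h1 : (fun r : ℝ => ⨍ y in s r, ‖z y - a‖) =ᶠ[𝓝[>] 0] fun _ => ‖c - a‖ := by
    filter_upwards [Ioo_mem_nhdsGT hρ] with r hr
    obtain ⟨h0, h1, h2⟩ := hs r hr
    rw [average_congr (g := fun _ => ‖c - a‖) (by filter_upwards [h2] with y hy using by rw [hy])]
    have : IsFiniteMeasure (volume.restrict (s r)) := ⟨by simpa using h1.lt_top⟩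
    have : NeZero (volume.restrict (s r)) := ⟨by simpa using h0⟩
    rw [average_const]
  rw [tendsto_congr' h1, tendsto_const_nhds_iff, norm_eq_zero, sub_eq_zero]

/-- `z` is a step function on `(0,1)` with the values `c 0, …, c m`, the break points being
`t 1 < … < t m`. Neighbouring values may coincide. -/
structure IsStep (z : ℝ → E3) (m : ℕ) (t : ℕ → ℝ) (c : ℕ → E3) : Prop where
  zero : t 0 = 0
  last : t (m + 1) = 1
  lt_succ : ∀ j ≤ m, t j < t (j + 1)
  ae_eq : ∀ j ≤ m, ∀ᵐ x ∂volume.restrict (Ioo (t j) (t (j + 1))), z x = c j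

namespace IsStep

variable {z : ℝ → E3} {m : ℕ} {t : ℕ → ℝ} {c : ℕ → E3}

theorem lt (S : IsStep z m t c) {i j : ℕ} (hij : i < j) (hj : j ≤ m + 1) : t i < t j := by
  induction j, hij using Nat.le_induction with
  | base => exact S.lt_succ i (by omega)
  | succ n hn ih => exact (ih (by omega)).trans (S.lt_succ n (by omega))

theorem le (S : IsStep z m t c) {i j : ℕ} (hij : i ≤ j) (hj : j ≤ m + 1) : t i ≤ t j := by
  rcases hij.eq_or_lt with rfl | h
  · exact le_rfl
  · exact (S.lt h hj).le

theorem mem_Ioo (S : IsStep z m t c) {j : ℕ} (h1 : 1 ≤ j) (h2 : j ≤ m) : t j ∈ Ioo (0 : ℝ) 1 :=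
  ⟨S.zero ▸ S.lt (by omega) (by omega), S.last ▸ S.lt (by omega) le_rfl⟩

theorem Ioo_subset (S : IsStep z m t c) {j : ℕ} (h2 : j ≤ m) :
    Ioo (t j) (t (j + 1)) ⊆ Ioo (0 : ℝ) 1 :=
  Ioo_subset_Ioo (S.zero ▸ S.le (by omega) (by omega)) (S.last ▸ S.le (by omega) le_rfl)

theorem exists_mem (S : IsStep z m t c) {x : ℝ} (hx : x ∈ Ioo (0 : ℝ) 1) :
    (∃ j, 1 ≤ j ∧ j ≤ m ∧ x = t j) ∨ ∃ j ≤ m, x ∈ Ioo (t j) (t (j + 1)) := by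
  classical
  have hex : ∃ j, x ≤ t j := ⟨m + 1, by rw [S.last]; exact hx.2.le⟩
  have h1 := Nat.find_spec hex
  have h2 : Nat.find hex ≤ m + 1 := Nat.find_min' hex (by rw [S.last]; exact hx.2.le)
  obtain ⟨j, hj⟩ : ∃ j, Nat.find hex = j + 1 := by
    refine ⟨Nat.find hex - 1, ?_⟩
    have : Nat.find hex ≠ 0 := by
      intro h0
      rw [h0, S.zero] at h1
      exact absurd hx.1 (not_lt.2 h1)
    omega
  have h3 : t j < x := not_le.1 (Nat.find_min hex (by omega))
  rw [hj] at h1 h2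
  rcases h1.eq_or_lt with h | h
  · left
    refine ⟨j + 1, by omega, ?_, h⟩
    by_contra hc
    have : j + 1 = m + 1 := by omega
    rw [this, S.last] at h
    exact hx.2.ne h
  · exact Or.inr ⟨j, by omega, h3, h⟩

theorem left_iff (S : IsStep z m t c) {j : ℕ} (hj : j ≤ m) {x : ℝ} (h1 : t j < x)
    (h2 : x ≤ t (j + 1)) (a : E3) :
    Tendsto (fun r : ℝ => ⨍ y in Ioo (x - r) x, ‖z y - a‖) (𝓝[>] 0) (𝓝 0) ↔ c j = a := by
  refine tendsto_average_iff (ρ := x - t j) (by linarith) (fun r hr => ⟨?_, ?_, ?_⟩) a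
  · simp [hr.1]
  · simp
  · exact ae_restrict_of_ae_restrict_of_subset (Ioo_subset_Ioo (by linarith [hr.2]) h2)
      (S.ae_eq j hj)

theorem right_iff (S : IsStep z m t c) {j : ℕ} (hj : j ≤ m) {x : ℝ} (h1 : t j ≤ x)
    (h2 : x < t (j + 1)) (a : E3) :
    Tendsto (fun r : ℝ => ⨍ y in Ioo x (x + r), ‖z y - a‖) (𝓝[>] 0) (𝓝 0) ↔ c j = a := by
  refine tendsto_average_iff (ρ := t (j + 1) - x) (by linarith) (fun r hr => ⟨?_, ?_, ?_⟩) a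
  · simp [hr.1]
  · simp
  · exact ae_restrict_of_ae_restrict_of_subset (Ioo_subset_Ioo h1 (by linarith [hr.2]))
      (S.ae_eq j hj)

theorem jumpSet_eq (S : IsStep z m t c) (hne : ∀ j < m, c j ≠ c (j + 1)) :
    jumpSet z = t '' (Finset.Icc 1 m : Finset ℕ) := by
  ext x
  constructor
  · rintro ⟨hx, a, b, hab, ha, hb⟩
    rcases S.exists_mem hx with ⟨j, h1, h2, rfl⟩ | ⟨j, hj, hxj⟩
    · exact ⟨j, by simp [h1, h2], rfl⟩
    · rw [S.left_iff hj hxj.1 hxj.2.le] at ha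
      rw [S.right_iff hj hxj.1.le hxj.2] at hb
      exact absurd (ha.symm.trans hb) hab
  · rintro ⟨j, hj, rfl⟩
    simp only [Finset.coe_Icc, mem_Icc] at hj
    obtain ⟨i, rfl⟩ : ∃ i, j = i + 1 := ⟨j - 1, by omega⟩
    refine ⟨S.mem_Ioo hj.1 hj.2, c i, c (i + 1), hne i (by omega), ?_, ?_⟩
    · exact (S.left_iff (by omega) (S.lt_succ i (by omega)) le_rfl _).2 rfl
    · exact (S.right_iff hj.2 le_rfl (S.lt_succ _ hj.2) _).2 rfl

theorem encard_jumpSet (S : IsStep z m t c) (hne : ∀ j < m, c j ≠ c (j + 1)) :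
    (jumpSet z).encard = m := by
  rw [S.jumpSet_eq hne, InjOn.encard_image, Set.encard_coe_eq_coe_finsetCard]
  · simp
  · intro i hi j hj hij
    simp only [Finset.coe_Icc, mem_Icc] at hi hj
    rcases lt_trichotomy i j with h | h | h
    · exact absurd hij (S.lt h (by omega)).ne
    · exact h
    · exact absurd hij (S.lt h (by omega)).ne'

theorem isCaccioppoliPartition (S : IsStep z m t c) :
    IsCaccioppoliPartition (fun j => if j ≤ m then Ioo (t j) (t (j + 1)) else ∅) := by
  refine ⟨fun j => ?_, ?_, ?_, ?_⟩
  · by_cases hj : j ≤ m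
    · simpa [hj] using S.Ioo_subset hj
    · simp [hj]
  · intro i j hij
    by_cases hi : i ≤ m
    swap
    · simp [hi]
    by_cases hj : j ≤ m
    swap
    · simp [hj]
    simp only [hi, hj, if_true]
    rw [Set.disjoint_left]
    intro x hx hx'
    rcases lt_or_gt_of_ne hij with h | h
    · have := S.le (show i + 1 ≤ j from h) (by omega)
      linarith [hx.2, hx'.1]
    · have := S.le (show j + 1 ≤ i from h) (by omega)
      linarith [hx.1, hx'.2]
  · refine measure_mono_null (t := t '' (Finset.Icc 1 m : Finset ℕ)) ?_
      (((Finset.finite_toSet _).image t).measure_zero _)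
    rintro x ⟨hx, hx'⟩
    rcases S.exists_mem hx with ⟨j, h1, h2, rfl⟩ | ⟨j, hj, hxj⟩
    · exact ⟨j, by simp [h1, h2], rfl⟩
    · refine absurd (mem_iUnion.2 ⟨j, ?_⟩) hx'
      simpa [hj] using hxj
  · rw [tsum_eq_sum (s := Finset.range (m + 1))]
    · refine ENNReal.sum_lt_top.2 fun j hj => ?_
      have hj' : j ≤ m := by simpa [Nat.lt_succ_iff] using hj
      simp only [hj', if_true]
      refine lt_of_le_of_lt (b := ENNReal.ofReal 2) ?_ ENNReal.ofReal_lt_top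
      refine iSup₂_le fun φ hφ => ENNReal.ofReal_le_ofReal ?_
      obtain ⟨⟨h1, -, -⟩, h2⟩ := hφ
      have hlt := S.lt_succ j hj'
      rw [inter_eq_left.2 (S.Ioo_subset hj'), ← integral_Ioc_eq_integral_Ioo,
        ← intervalIntegral.integral_of_le hlt.le,
        intervalIntegral.integral_deriv_eq_sub
          (fun x _ => (h1.differentiable one_ne_zero).differentiableAt)
          ((h1.continuous_deriv le_rfl).intervalIntegrable _ _)]
      have := abs_le.1 (h2 (t j))
      have := abs_le.1 (h2 (t (j + 1)))
      linarith
    · intro j hj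
      have hj' : ¬ j ≤ m := by simpa [Nat.lt_succ_iff] using hj
      simp [hj', perimeter]

theorem integral_mul_deriv (S : IsStep z m t c) (i : Fin 3) {φ : ℝ → ℝ} (hφ : IsTestFun φ) :
    ∫ x in Ioo (0 : ℝ) 1, z x i * deriv φ x =
      -∑ j ∈ Finset.range m, (c (j + 1) i - c j i) * φ (t (j + 1)) := by
  obtain ⟨h1, -, h3⟩ := hφ
  have hd : Continuous (deriv φ) := h1.continuous_deriv le_rfl
  have hz : ∀ x, x ∉ Ioo (0 : ℝ) 1 → φ x = 0 := fun x hx =>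
    image_eq_zero_of_notMem_tsupport fun h => hx (h3 h)
  have hae : ∀ j ≤ m, ∀ᵐ x, x ∈ uIoc (t j) (t (j + 1)) → c j i * deriv φ x = z x i * deriv φ x := by
    intro j hj
    have h := S.ae_eq j hj
    rw [restrict_Ioo_eq_restrict_Ioc, ae_restrict_iff' measurableSet_Ioc] at h
    rw [uIoc_of_le (S.lt_succ j hj).le]
    filter_upwards [h] with x hx hx'
    rw [hx hx']
  have hval : ∀ j ≤ m, ∫ x in (t j)..(t (j + 1)), z x i * deriv φ x =
      c j i * (φ (t (j + 1)) - φ (t j)) := by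
    intro j hj
    rw [← intervalIntegral.integral_congr_ae (hae j hj), intervalIntegral.integral_const_mul,
      intervalIntegral.integral_deriv_eq_sub
          (fun x _ => (h1.differentiable one_ne_zero).differentiableAt)
          (hd.intervalIntegrable _ _)]
  have hint : ∀ j < m + 1, IntervalIntegrable (fun x => z x i * deriv φ x) volume (t j)
      (t (j + 1)) := by
    intro j hj
    have : IntervalIntegrable (fun x => c j i * deriv φ x) volume (t j) (t (j + 1)) :=
      (continuous_const.mul hd).intervalIntegrable _ _
    refine this.congr_ae ?_
    exact (ae_restrict_iff' measurableSet_uIoc).2 (hae j (by omega))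
  have habel : ∀ (n : ℕ), ∑ j ∈ Finset.range (n + 1), c j i * (φ (t (j + 1)) - φ (t j)) =
      c n i * φ (t (n + 1)) - c 0 i * φ (t 0)
        - ∑ j ∈ Finset.range n, (c (j + 1) i - c j i) * φ (t (j + 1)) := by
    intro n
    induction n with
    | zero => simp; ring
    | succ n ih => rw [Finset.sum_range_succ, ih, Finset.sum_range_succ]; ring
  rw [← integral_Ioc_eq_integral_Ioo, ← intervalIntegral.integral_of_le zero_le_one]
  conv_lhs => rw [← S.zero, ← S.last]
  rw [← intervalIntegral.sum_integral_adjacent_intervals hint,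
    Finset.sum_congr rfl (fun j hj => hval j (by simpa [Nat.lt_succ_iff] using hj)), habel,
    S.zero, S.last, hz 0 (by simp), hz 1 (by simp)]
  ring

theorem isSBV (S : IsStep z m t c) (hne : ∀ j < m, c j ≠ c (j + 1))
    (hz : IntegrableOn z (Ioo 0 1)) : IsSBV z := by
  -- the measures carry the positive and the negative parts of the jumps
  set μ : (ℝ → ℝ) → Fin 3 → Measure ℝ := fun F i => ∑ j ∈ Finset.range m,
    ENNReal.ofReal (F (c (j + 1) i - c j i)) • Measure.dirac (t (j + 1)) with hμ
  have hfin : ∀ F i, IsFiniteMeasure (μ F i) := by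
    intro F i
    refine ⟨?_⟩
    simp only [hμ, Measure.coe_finsetSum, Finset.sum_apply, Measure.smul_apply, smul_eq_mul]
    refine ENNReal.sum_lt_top.2 fun j _ => ?_
    simp
  have hnull : ∀ F i, μ F i (jumpSet z)ᶜ = 0 := by
    intro F i
    simp only [hμ, Measure.coe_finsetSum, Finset.sum_apply, Measure.smul_apply, smul_eq_mul]
    refine Finset.sum_eq_zero fun j hj => ?_
    have hmeas : MeasurableSet (jumpSet z) := by
      rw [S.jumpSet_eq hne]; exact ((Finset.finite_toSet _).image t).measurableSet
    rw [Measure.dirac_apply' _ hmeas.compl]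
    have : t (j + 1) ∈ jumpSet z := by
      rw [S.jumpSet_eq hne]
      exact ⟨j + 1, by simp at hj ⊢; omega, rfl⟩
    simp [this]
  have hint : ∀ F i (φ : ℝ → ℝ), ∫ x, φ x ∂(μ F i) =
      ∑ j ∈ Finset.range m, max (F (c (j + 1) i - c j i)) 0 * φ (t (j + 1)) := by
    intro F i φ
    simp only [hμ]
    rw [integral_finsetSum_measure]
    · refine Finset.sum_congr rfl fun j _ => ?_
      rw [integral_smul_measure, integral_dirac, ENNReal.toReal_ofReal', smul_eq_mul]
    · intro j _
      exact (integrable_dirac (by simp)).smul_measure ENNReal.ofReal_ne_top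
  clear_value μ
  refine ⟨hz, fun _ => 0, μ id, μ Neg.neg, by simp, fun i => ⟨hfin id i, hfin Neg.neg i⟩,
    fun i => ⟨hnull id i, hnull Neg.neg i⟩, fun i φ hφ => ?_⟩
  rw [S.integral_mul_deriv i hφ, hint id, hint Neg.neg, ← Finset.sum_sub_distrib]
  simp only [PiLp.zero_apply, zero_mul, integral_zero, zero_add]
  congr 1
  refine Finset.sum_congr rfl fun j _ => ?_
  have e : ∀ a b : ℝ, a * b = max a 0 * b - max (-a) 0 * b := fun a b => by
    rw [← sub_mul, max_zero_sub_max_neg_zero_eq_self]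
  exact e _ _

theorem isBVpc (S : IsStep z m t c) (hne : ∀ j < m, c j ≠ c (j + 1))
    (hz : IntegrableOn z (Ioo 0 1)) {K : Set E3}
    (hK : ∀ᵐ x ∂volume.restrict (Ioo (0 : ℝ) 1), z x ∈ K) : IsBVpc K z := by
  refine ⟨S.isSBV hne hz, ⟨_, S.isCaccioppoliPartition, fun j => ⟨c j, ?_⟩⟩, hK⟩
  by_cases hj : j ≤ m
  · simpa [hj] using S.ae_eq j hj
  · simp [hj]

end IsStep

/-- If `z` is a.e. constant on every interval that avoids the finite set `J`, then it is a step
function with break points in `J`. -/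
theorem exists_isStep {z : ℝ → E3} (J : Finset ℝ) (hJ : (J : Set ℝ) ⊆ Ioo 0 1)
    (hz : ∀ a b : ℝ, a < b → Ioo a b ⊆ Ioo 0 1 → Disjoint (Ioo a b) (J : Set ℝ) →
      ∃ c, ∀ᵐ x ∂volume.restrict (Ioo a b), z x = c) :
    ∃ t c, IsStep z J.card t c ∧ ∀ j, 1 ≤ j → j ≤ J.card → t j ∈ J := by
  classical
  set J' : Finset ℝ := insert 0 (insert 1 J) with hJ'
  have h1J : (1 : ℝ) ∉ J := fun h => lt_irrefl _ (hJ h).2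
  have h0J : (0 : ℝ) ∉ insert 1 J := by
    rw [Finset.mem_insert, not_or]; exact ⟨zero_ne_one, fun h => lt_irrefl _ (hJ h).1⟩
  have hcard : J'.card = J.card + 2 := by
    rw [hJ', Finset.card_insert_of_notMem h0J, Finset.card_insert_of_notMem h1J]
  set e := J'.orderEmbOfFin hcard with he
  have hJ'sub : ∀ x ∈ J', 0 ≤ x ∧ x ≤ 1 := by
    intro x hx
    simp only [hJ', Finset.mem_insert] at hx
    rcases hx with rfl | rfl | hx
    · simp
    · simp
    · exact ⟨(hJ hx).1.le, (hJ hx).2.le⟩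
  set t : ℕ → ℝ := fun j => e ⟨min j (J.card + 1), by omega⟩ with ht
  have hmem : ∀ j, t j ∈ J' := fun j => Finset.orderEmbOfFin_mem _ _ _
  have hlt : ∀ i j, i < j → j ≤ J.card + 1 → t i < t j := by
    intro i j hij hj
    refine e.strictMono ?_
    simp only [Fin.mk_lt_mk]; omega
  have hsurj : ∀ x ∈ J', ∃ i ≤ J.card + 1, t i = x := by
    intro x hx
    have : x ∈ Set.range e := by rw [he, Finset.range_orderEmbOfFin]; exact hx
    obtain ⟨i, rfl⟩ := this
    refine ⟨i, by omega, ?_⟩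
    simp only [ht]
    congr 1
    ext
    simp only; omega
  have ht0 : t 0 = 0 := by
    obtain ⟨i, hi, h⟩ := hsurj 0 (by simp [hJ'])
    rcases Nat.eq_zero_or_pos i with rfl | hpos
    · exact h
    · have := hlt 0 i hpos hi
      linarith [(hJ'sub _ (hmem 0)).1]
  have htl : t (J.card + 1) = 1 := by
    obtain ⟨i, hi, h⟩ := hsurj 1 (by simp [hJ'])
    rcases hi.eq_or_lt with rfl | hpos
    · exact h
    · have := hlt i _ hpos le_rfl
      linarith [(hJ'sub _ (hmem (J.card + 1))).2]
  have hconst : ∀ j ≤ J.card, ∃ c, ∀ᵐ x ∂volume.restrict (Ioo (t j) (t (j + 1))), z x = c := by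
    intro j hj
    refine hz _ _ (hlt j (j + 1) (by omega) (by omega))
      (Ioo_subset_Ioo (hJ'sub _ (hmem _)).1 (hJ'sub _ (hmem _)).2) ?_
    rw [Set.disjoint_left]
    intro x hx hxJ
    obtain ⟨i, hi, rfl⟩ := hsurj x (by
      simp only [hJ', Finset.mem_insert]; exact Or.inr (Or.inr hxJ))
    rcases le_or_gt i j with h | h
    · rcases h.eq_or_lt with rfl | h
      · exact lt_irrefl _ hx.1
      · exact lt_asymm hx.1 (hlt i j h (by omega))
    · rcases (show j + 1 ≤ i from h).eq_or_lt with rfl | h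
      · exact lt_irrefl _ hx.2
      · exact lt_asymm hx.2 (hlt _ _ h hi)
  choose! c hc using hconst
  refine ⟨t, c, ⟨ht0, htl, fun j hj => hlt _ _ (by omega) (by omega), hc⟩, fun j h1 h2 => ?_⟩
  have h3 := hlt 0 j (by omega) (by omega)
  have h4 := hlt j (J.card + 1) (by omega) le_rfl
  have := hmem j
  simp only [hJ', Finset.mem_insert] at this
  rcases this with h | h | h
  · linarith
  · linarith
  · exact h

/-! ### Piecewise constant functions with finitely many jumps are step functions -/

section SmoothTests

open scoped ContDiff

theorem integral_Ioo_eq_intervalIntegral {a b : ℝ} (hab : a ≤ b) (f : ℝ → ℝ) :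
    ∫ x in Ioo a b, f x = ∫ x in a..b, f x := by
  rw [intervalIntegral.integral_of_le hab, integral_Ioc_eq_integral_Ioo]

/-- A continuous function with compact support in `(a,b)` and vanishing integral has a primitive
with compact support in `(a,b)`. -/
theorem exists_primitive_compactSupport {a b : ℝ} (hab : a < b) {ψ : ℝ → ℝ} (hψ : Continuous ψ)
    (hc : HasCompactSupport ψ) (hs : tsupport ψ ⊆ Ioo a b) (h0 : ∫ x in a..b, ψ x = 0) :
    ∃ φ : ℝ → ℝ, ContDiff ℝ 1 φ ∧ HasCompactSupport φ ∧ tsupport φ ⊆ Ioo a b ∧ deriv φ = ψ := by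
  obtain ⟨α, β, hα, hβ, hsub⟩ : ∃ α β, a < α ∧ β < b ∧ tsupport ψ ⊆ Icc α β := by
    rcases (tsupport ψ).eq_empty_or_nonempty with he | hne
    · exact ⟨(a + b) / 2, (a + b) / 2, by linarith, by linarith, by rw [he]; exact empty_subset _⟩
    · have hK : IsCompact (tsupport ψ) := hc
      exact ⟨sInf (tsupport ψ), sSup (tsupport ψ), (hs (hK.sInf_mem hne)).1,
        (hs (hK.sSup_mem hne)).2, fun x hx =>
          ⟨csInf_le hK.bddBelow hx, le_csSup hK.bddAbove hx⟩⟩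
  have hz : ∀ x, x ∉ Icc α β → ψ x = 0 := fun x hx =>
    image_eq_zero_of_notMem_tsupport fun h => hx (hsub h)
  have hderiv : ∀ x, HasDerivAt (fun y => ∫ s in a..y, ψ s) (ψ x) x := fun x =>
    intervalIntegral.integral_hasDerivAt_right (hψ.intervalIntegrable _ _)
      hψ.stronglyMeasurable.stronglyMeasurableAtFilter hψ.continuousAt
  have hd : deriv (fun y => ∫ s in a..y, ψ s) = ψ := funext fun x => (hderiv x).deriv
  have hsupp : tsupport (fun y => ∫ s in a..y, ψ s) ⊆ Icc α β := by
    refine closure_minimal (fun y hy => ?_) isClosed_Icc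
    by_contra hcon
    refine hy ?_
    rw [mem_Icc, not_and_or, not_le, not_le] at hcon
    rcases hcon with h | h
    · refine intervalIntegral.integral_zero_ae (Eventually.of_forall fun s hs => hz s fun hs' => ?_)
      have : s ≤ max a y := hs.2
      have : max a y < α := max_lt hα h
      linarith [hs'.1]
    · have h1 : ∫ s in y..b, ψ s = 0 := by
        refine intervalIntegral.integral_zero_ae
          (Eventually.of_forall fun s hs => hz s fun hs' => ?_)
        have : min y b < s := hs.1
        have : β < min y b := lt_min h hβ
        linarith [hs'.2]
      have h2 := intervalIntegral.integral_add_adjacent_intervals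
        (hψ.intervalIntegrable (μ := volume) a y) (hψ.intervalIntegrable y b)
      linarith
  refine ⟨_, ?_, ?_, hsupp.trans (Icc_subset_Ioo hα hβ), hd⟩
  · rw [contDiff_one_iff_deriv]
    exact ⟨fun x => (hderiv x).differentiableAt, by rw [hd]; exact hψ⟩
  · exact isCompact_Icc.of_isClosed_subset (isClosed_tsupport _) hsupp

/-- The lemma of du Bois-Reymond: a function whose distributional derivative vanishes is
constant. -/
theorem exists_ae_eq_const_of_integral_mul_deriv_eq_zero {a b : ℝ} (hab : a < b) {f : ℝ → ℝ}
    (hf : IntegrableOn f (Ioo a b))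
    (h : ∀ φ : ℝ → ℝ, ContDiff ℝ 1 φ → HasCompactSupport φ → tsupport φ ⊆ Ioo a b →
      ∫ x in Ioo a b, f x * deriv φ x = 0) :
    ∃ d, ∀ᵐ x ∂volume.restrict (Ioo a b), f x = d := by
  -- a fixed bump function of integral one
  let B : ContDiffBump ((a + b) / 2) := ⟨(b - a) / 8, (b - a) / 4, by linarith, by linarith⟩
  set ψ₀ : ℝ → ℝ := B.normed volume with hψ₀
  have hs₀ : tsupport ψ₀ ⊆ Ioo a b := by
    rw [hψ₀, B.tsupport_normed_eq, Real.closedBall_eq_Icc]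
    refine Icc_subset_Ioo ?_ ?_ <;> simp only [B] <;> linarith
  have hc₀ : HasCompactSupport ψ₀ := B.hasCompactSupport_normed
  have hcont₀ : Continuous ψ₀ := B.continuous_normed
  have hout : ∀ {ψ : ℝ → ℝ}, tsupport ψ ⊆ Ioo a b → ∀ x ∉ Ioo a b, ψ x = 0 := fun hs x hx =>
    image_eq_zero_of_notMem_tsupport fun h => hx (hs h)
  have hI₀ : ∫ x in a..b, ψ₀ x = 1 := by
    rw [← integral_Ioo_eq_intervalIntegral hab.le,
      setIntegral_eq_integral_of_forall_compl_eq_zero (hout hs₀)]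
    exact B.integral_normed
  have hprod : ∀ {ψ : ℝ → ℝ}, Continuous ψ → HasCompactSupport ψ →
      IntegrableOn (fun x => f x * ψ x) (Ioo a b) := by
    intro ψ h1 h2
    obtain ⟨M, hM⟩ := h2.exists_bound_of_continuous h1
    exact hf.mul_bdd h1.aestronglyMeasurable (Eventually.of_forall hM)
  set d := ∫ x in Ioo a b, f x * ψ₀ x with hd
  refine ⟨d, ?_⟩
  have key := isOpen_Ioo.ae_eq_zero_of_integral_contDiff_smul_eq_zero (μ := volume)
    (U := Ioo a b) (f := fun x => f x - d)
    ((hf.sub (integrableOn_const (by simp))).locallyIntegrableOn) (fun ψ hψ hψc hψs => by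
      set I := ∫ x in a..b, ψ x with hI
      have hψcont := hψ.continuous
      obtain ⟨φ, h1, h2, h3, h4⟩ := exists_primitive_compactSupport hab
        (ψ := fun x => ψ x - I * ψ₀ x) (by fun_prop) (hψc.sub hc₀.mul_left)
        ((tsupport_sub _ _).trans (union_subset hψs
          ((closure_mono (Function.support_mul_subset_right _ _)).trans hs₀)))
        (by
          rw [intervalIntegral.integral_sub (hψcont.intervalIntegrable _ _)
            ((show Continuous fun x => I * ψ₀ x by fun_prop).intervalIntegrable _ _),
            intervalIntegral.integral_const_mul, hI₀]
          ring)
      have h5 := h φ h1 h2 h3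
      rw [h4] at h5
      have e1 : ∫ x in Ioo a b, f x * (ψ x - I * ψ₀ x) = (∫ x in Ioo a b, f x * ψ x) - I * d := by
        rw [hd, ← integral_const_mul, ← integral_sub (hprod hψcont hψc)
          ((hprod hcont₀ hc₀).const_mul _)]
        congr 1; ext x; ring
      rw [← setIntegral_eq_integral_of_forall_compl_eq_zero (s := Ioo a b)
        (fun x hx => by rw [hout hψs x hx, zero_smul])]
      have e2 : ∫ x in Ioo a b, ψ x • (f x - d) = (∫ x in Ioo a b, f x * ψ x) - d * I := by
        rw [hI, ← integral_Ioo_eq_intervalIntegral hab.le, ← integral_const_mul,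
          ← integral_sub (hprod hψcont hψc)
          ((hψcont.integrable_of_hasCompactSupport hψc).integrableOn.const_mul _)]
        congr 1; ext x; simp only [smul_eq_mul]; ring
      rw [e2]; linarith)
  rw [ae_restrict_iff' measurableSet_Ioo]
  filter_upwards [key] with x hx hxm
  linarith [hx hxm]

/-- A function which a.e. takes only countably many values has vanishing derivative a.e. -/
theorem ae_eq_zero_of_countable_values {a b : ℝ} {G g : ℝ → ℝ}
    (hG : ∀ᵐ x ∂volume.restrict (Ioo a b), HasDerivAt G (g x) x) {S : Set ℝ} (hS : S.Countable)
    (hGS : ∀ᵐ x ∂volume.restrict (Ioo a b), G x ∈ S) :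
    ∀ᵐ x ∂volume.restrict (Ioo a b), g x = 0 := by
  -- a level set has only countably many points isolated from the right; at all its other points the
  -- difference quotients vanish along the level set
  have hcount : ∀ s ∈ S, ∀ᵐ x ∂volume.restrict (Ioo a b),
      x ∉ {x ∈ G ⁻¹' {s} | 𝓝[G ⁻¹' {s} ∩ Ioi x] x = ⊥} := fun s _ =>
    ae_restrict_of_ae (countable_setOfPred_isolated_right_within.ae_notMem _)
  have := (ae_ball_iff hS).2 hcount
  filter_upwards [hG, hGS, this] with x h1 h2 h3
  have h4 : 𝓝[G ⁻¹' {G x} ∩ Ioi x] x ≠ ⊥ := fun h => h3 (G x) h2 ⟨rfl, h⟩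
  have : (𝓝[G ⁻¹' {G x} ∩ Ioi x] x).NeBot := ⟨h4⟩
  have h5 : Tendsto (slope G x) (𝓝[G ⁻¹' {G x} ∩ Ioi x] x) (𝓝 (g x)) :=
    (hasDerivAt_iff_tendsto_slope.1 h1).mono_left
      (nhdsWithin_mono _ fun y hy => (ne_of_gt hy.2 : y ≠ x))
  have h6 : Tendsto (slope G x) (𝓝[G ⁻¹' {G x} ∩ Ioi x] x) (𝓝 0) := by
    refine tendsto_const_nhds.congr' ?_
    filter_upwards [self_mem_nhdsWithin] with y hy
    have : G y = G x := hy.1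
    rw [slope_def_field, this, sub_self, zero_div]
  exact tendsto_nhds_unique h5 h6

/-- A scalar function with integrable distributional derivative which a.e. takes only countably
many values is constant. -/
theorem exists_ae_eq_const_of_countable_values {a b : ℝ} (hab : a < b) {f g : ℝ → ℝ}
    (hf : IntegrableOn f (Ioo a b)) (hg : IntegrableOn g (Ioo a b))
    (hfg : ∀ φ : ℝ → ℝ, ContDiff ℝ 1 φ → HasCompactSupport φ → tsupport φ ⊆ Ioo a b →
      ∫ x in Ioo a b, f x * deriv φ x = -∫ x in Ioo a b, g x * φ x)
    {S : Set ℝ} (hS : S.Countable) (hfS : ∀ᵐ x ∂volume.restrict (Ioo a b), f x ∈ S) :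
    ∃ d, ∀ᵐ x ∂volume.restrict (Ioo a b), f x = d := by
  set G : ℝ → ℝ := fun x => ∫ s in a..x, g s with hGdef
  have hgi : IntervalIntegrable g volume a b :=
    (intervalIntegrable_iff_integrableOn_Ioo_of_le hab.le).2 hg
  have hGac : AbsolutelyContinuousOnInterval G a b :=
    hgi.absolutelyContinuousOnInterval_intervalIntegral left_mem_uIcc
  have hGderiv : ∀ᵐ x, x ∈ Ioo a b → HasDerivAt G (g x) x := by
    filter_upwards [hgi.ae_hasDerivAt_integral] with x hx hxm
    exact hx (by rw [uIcc_of_le hab.le]; exact Ioo_subset_Icc_self hxm) a left_mem_uIcc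
  have hGint : IntegrableOn G (Ioo a b) :=
    ((intervalIntegrable_iff_integrableOn_Ioo_of_le hab.le).1
      (hGac.continuousOn.intervalIntegrable))
  -- `f - G` has vanishing distributional derivative
  obtain ⟨d, hd⟩ := exists_ae_eq_const_of_integral_mul_deriv_eq_zero hab (hf.sub hGint)
    (fun φ h1 h2 h3 => by
      have hφ0 : ∀ x, x ∉ Ioo a b → φ x = 0 := fun x hx =>
        image_eq_zero_of_notMem_tsupport fun h => hx (h3 h)
      have hdc : Continuous (deriv φ) := h1.continuous_deriv le_rfl
      obtain ⟨M, hM⟩ := h2.deriv.exists_bound_of_continuous hdc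
      have i1 : IntegrableOn (fun x => f x * deriv φ x) (Ioo a b) :=
        hf.mul_bdd hdc.aestronglyMeasurable (Eventually.of_forall hM)
      have i2 : IntegrableOn (fun x => G x * deriv φ x) (Ioo a b) :=
        hGint.mul_bdd hdc.aestronglyMeasurable (Eventually.of_forall hM)
      have e1 : ∫ x in Ioo a b, (f - G) x * deriv φ x =
          (∫ x in Ioo a b, f x * deriv φ x) - ∫ x in Ioo a b, G x * deriv φ x := by
        rw [← integral_sub i1 i2]
        congr 1; ext x; simp only [Pi.sub_apply]; ring
      have e2 := hGac.integral_mul_deriv_eq_deriv_mul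
        (h1.contDiffOn.absolutelyContinuousOnInterval (a := a) (b := b))
      rw [hφ0 a (by simp), hφ0 b (by simp), ← integral_Ioo_eq_intervalIntegral hab.le,
        ← integral_Ioo_eq_intervalIntegral hab.le] at e2
      have e3 : ∫ x in Ioo a b, deriv G x * φ x = ∫ x in Ioo a b, g x * φ x := by
        refine setIntegral_congr_ae measurableSet_Ioo ?_
        filter_upwards [hGderiv] with x hx hxm
        rw [(hx hxm).deriv]
      rw [e1, hfg φ h1 h2 h3, e2, e3]; ring)
  have hg0 : ∀ᵐ x ∂volume.restrict (Ioo a b), g x = 0 := by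
    refine ae_eq_zero_of_countable_values (G := G) ?_ (hS.image fun s => s - d) ?_
    · exact (ae_restrict_iff' measurableSet_Ioo).2 hGderiv
    · filter_upwards [hfS, hd] with x h1 h2
      simp only [Pi.sub_apply] at h2
      exact ⟨f x, h1, by simp only; linarith⟩
  refine ⟨d, ?_⟩
  filter_upwards [hd, ae_restrict_mem measurableSet_Ioo] with x hx hxm
  have : G x = 0 := by
    refine intervalIntegral.integral_zero_ae ?_
    rw [ae_restrict_iff' measurableSet_Ioo] at hg0
    filter_upwards [hg0] with s hs hsm
    rw [uIoc_of_le hxm.1.le] at hsm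
    exact hs ⟨hsm.1, hsm.2.trans_lt hxm.2⟩
  simp only [Pi.sub_apply, this, sub_zero] at hx
  exact hx

/-- A function of `BV_pc` is constant on every interval without jump points. -/
theorem IsBVpc.exists_ae_eq_const {K : Set E3} {z : ℝ → E3} (hz : IsBVpc K z) {a b : ℝ}
    (hab : a < b) (hsub : Ioo a b ⊆ Ioo 0 1) (hdisj : Disjoint (Ioo a b) (jumpSet z)) :
    ∃ c, ∀ᵐ x ∂volume.restrict (Ioo a b), z x = c := by
  obtain ⟨⟨hint, g, σ, τ, hg, hfin, hnull, hweak⟩, ⟨A, hA, hAc⟩, -⟩ := hz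
  choose c hc using hAc
  have hval : ∀ᵐ x ∂volume.restrict (Ioo a b), z x ∈ range c := by
    have h1 : ∀ᵐ x ∂volume.restrict (Ioo (0 : ℝ) 1), x ∈ ⋃ m, A m := by
      rw [ae_restrict_iff' measurableSet_Ioo, ae_iff]
      refine measure_mono_null ?_ hA.2.2.1
      intro x hx
      simp only [mem_ofPred_eq, Classical.not_imp] at hx
      exact hx
    have h2 : ∀ᵐ x, ∀ m, x ∈ A m → z x = c m := by
      rw [ae_all_iff]
      intro m
      exact (ae_restrict_iff' (hA.1 m).1).1 (hc m)
    filter_upwards [ae_restrict_of_ae_restrict_of_subset hsub h1, ae_restrict_of_ae h2]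
      with x h3 h4
    obtain ⟨m, hm⟩ := mem_iUnion.1 h3
    exact ⟨m, (h4 m hm).symm⟩
  have hcomp : ∀ i : Fin 3, ∃ d : ℝ, ∀ᵐ x ∂volume.restrict (Ioo a b), z x i = d := by
    intro i
    have hproj : ∀ {f : ℝ → E3}, IntegrableOn f (Ioo 0 1) →
        IntegrableOn (fun x => f x i) (Ioo a b) := fun hf =>
      ((EuclideanSpace.proj (𝕜 := ℝ) i).integrable_comp hf).mono_measure
        (Measure.restrict_mono hsub le_rfl)
    refine exists_ae_eq_const_of_countable_values hab (hproj hint) (hproj hg) ?_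
      ((countable_range c).image fun v => v i) ?_
    · intro φ h1 h2 h3
      have h4 := hweak i φ ⟨h1, h2, h3.trans hsub⟩
      have hφ0 : ∀ x, x ∉ Ioo a b → φ x = 0 := fun x hx =>
        image_eq_zero_of_notMem_tsupport fun h => hx (h3 h)
      have hφd : ∀ x, x ∉ Ioo a b → deriv φ x = 0 := fun x hx =>
        image_eq_zero_of_notMem_tsupport fun h => hx (h3 (tsupport_deriv_subset h))
      have hsing : ∀ μ : Measure ℝ, μ (jumpSet z)ᶜ = 0 → ∫ x, φ x ∂μ = 0 := by
        intro μ hμ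
        refine integral_eq_zero_of_ae ?_
        have : ∀ᵐ x ∂μ, x ∈ jumpSet z := hμ
        filter_upwards [this] with x hx
        exact hφ0 x fun hx' => Set.disjoint_left.1 hdisj hx' hx
      have hrestr : ∀ F : ℝ → ℝ, (∀ x, x ∉ Ioo a b → F x = 0) →
          ∫ x in Ioo (0 : ℝ) 1, F x = ∫ x in Ioo a b, F x := by
        intro F hF
        rw [setIntegral_eq_integral_of_forall_compl_eq_zero hF,
          setIntegral_eq_integral_of_forall_compl_eq_zero fun x hx => hF x fun h => hx (hsub h)]
      rw [hsing _ (hnull i).1, hsing _ (hnull i).2, sub_zero, add_zero,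
        hrestr _ (fun x hx => by rw [hφd x hx, mul_zero]),
        hrestr _ (fun x hx => by rw [hφ0 x hx, mul_zero])] at h4
      exact h4
    · filter_upwards [hval] with x hx using ⟨z x, hx, rfl⟩
  choose d hd using hcomp
  refine ⟨WithLp.toLp 2 d, ?_⟩
  filter_upwards [ae_all_iff.2 hd] with x hx
  ext i
  exact hx i

theorem IsBVpc.exists_isStep {K : Set E3} {z : ℝ → E3} (hz : IsBVpc K z)
    (hfin : (jumpSet z).Finite) : ∃ m t c, IsStep z m t c ∧ (jumpSet z).encard = m := by
  obtain ⟨t, c, hS, -⟩ := HelicalXY.exists_isStep hfin.toFinset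
    (by rw [Set.Finite.coe_toFinset]; exact fun x hx => hx.1)
    (fun a b hab hsub hdisj => hz.exists_ae_eq_const hab hsub (by simpa using hdisj))
  exact ⟨_, t, c, hS, hfin.encard_eq_coe_toFinset_card⟩

end SmoothTests

/-! ### Sequences of bounded energy -/

theorem norm_eq_one_of_mem_circleUnion {Q : Set E3} {v : E3} (hv : v ∈ circleUnion Q) :
    ‖v‖ = 1 := by
  simp only [circleUnion, greatCircle, mem_iUnion, mem_ofPred_eq] at hv
  obtain ⟨_, _, h, _⟩ := hv
  exact h

/-- A sequence of chains on great circles, with bounded rescaled energy, in the regime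
`l ≪ h → 0` and `k √h → 0`; here `h = √(2δ)`. -/
structure BoundedSeq (l h : ℕ → ℝ) (k : ℕ → ℕ) (C : ℝ) (q : (n : ℕ) → Fin (k n) → E3)
    (u : ℕ → ℕ → E3) : Prop where
  l_pos : ∀ n, 0 < l n
  h_pos : ∀ n, 0 < h n
  one_le : ∀ n, 1 ≤ k n
  tendsto_l : Tendsto l atTop (𝓝 0)
  tendsto_h : Tendsto h atTop (𝓝 0)
  tendsto_lh : Tendsto (fun n => l n / h n) atTop (𝓝 0)
  tendsto_kh : Tendsto (fun n => k n * √(h n)) atTop (𝓝 0)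
  norm_q : ∀ n j, ‖q n j‖ = 1
  mem_circle : ∀ n, ∀ i ≤ lastIdx (l n), u n i ∈ circleUnion (range (q n))
  energy : ∀ n, ∑ i ∈ Finset.range (lastIdx (l n) - 1), eterm (h n) (u n) i ≤ C

namespace BoundedSeq

variable {l h : ℕ → ℝ} {k : ℕ → ℕ} {C : ℝ} {q : (n : ℕ) → Fin (k n) → E3} {u : ℕ → ℕ → E3}

theorem C_nonneg (B : BoundedSeq l h k C q u) : 0 ≤ C :=
  (Finset.sum_nonneg fun i _ => eterm_nonneg (B.h_pos 0) (u 0) i).trans (B.energy 0)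

theorem tendsto_angle (B : BoundedSeq l h k C q u) :
    Tendsto (fun n => h n ^ 2 + √(C * h n ^ 3)) atTop (𝓝 0) := by
  have hc : Continuous fun x : ℝ => x ^ 2 + √(C * x ^ 3) := by fun_prop
  have := (hc.tendsto 0).comp B.tendsto_h
  simpa [Function.comp_def] using this

theorem tendsto_arc (B : BoundedSeq l h k C q u) :
    Tendsto (fun n => k n * √(2 * (h n ^ 2 + √(C * h n ^ 3)))) atTop (𝓝 0) := by
  have hc : Continuous fun x : ℝ => √(2 * (x + √(C * x))) := by fun_prop
  have h1 := (hc.tendsto 0).comp B.tendsto_h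
  have h2 := B.tendsto_kh.mul h1
  simp only [mul_zero, Real.sqrt_zero, add_zero] at h2
  refine h2.congr fun n => ?_
  have hp := B.h_pos n
  have e1 : √(C * h n ^ 3) = h n * √(C * h n) := by
    rw [show C * h n ^ 3 = h n ^ 2 * (C * h n) by ring, Real.sqrt_mul (by positivity),
      Real.sqrt_sq hp.le]
  have e2 : 2 * (h n ^ 2 + √(C * h n ^ 3)) = h n * (2 * (h n + √(C * h n))) := by rw [e1]; ring
  rw [e2, Real.sqrt_mul hp.le, Function.comp_apply, mul_assoc]

theorem tendsto_speed (B : BoundedSeq l h k C q u) :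
    Tendsto (fun n => √(k n * (h n * C))) atTop (𝓝 0) := by
  have hc : Continuous fun x : ℝ => √x := by fun_prop
  have h1 := (hc.tendsto 0).comp B.tendsto_h
  have h2 := (B.tendsto_kh.mul h1).mul_const C
  have h3 := (hc.tendsto _).comp h2
  simp only [Real.sqrt_zero, mul_zero, zero_mul] at h3
  refine h3.congr fun n => ?_
  have e : √(h n) * √(h n) = h n := Real.mul_self_sqrt (B.h_pos n).le
  simp only [Function.comp_apply]
  rw [mul_assoc, mul_assoc, ← mul_assoc (√(h n)), e]

theorem tendsto_drift (B : BoundedSeq l h k C q u) (c : ℝ) :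
    Tendsto (fun n => c * (k n * √(C * h n))) atTop (𝓝 0) := by
  have h2 := (B.tendsto_kh.mul_const √C).const_mul c
  simp only [zero_mul, mul_zero] at h2
  refine h2.congr fun n => ?_
  rw [Real.sqrt_mul B.C_nonneg]; ring

theorem tendsto_kl (B : BoundedSeq l h k C q u) :
    Tendsto (fun n => l n * (k n + 2)) atTop (𝓝 0) := by
  have hc : Continuous fun x : ℝ => √x := by fun_prop
  have h1 := (hc.tendsto 0).comp B.tendsto_h
  have h2 := ((B.tendsto_kh.mul h1).mul B.tendsto_lh).add (B.tendsto_l.mul_const 2)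
  simp only [Real.sqrt_zero, mul_zero, zero_mul, add_zero] at h2
  refine h2.congr fun n => ?_
  have e : √(h n) * √(h n) = h n := Real.mul_self_sqrt (B.h_pos n).le
  have hp := (B.h_pos n).ne'
  simp only [Function.comp_apply]
  rw [mul_assoc (k n : ℝ), e]
  field_simp

theorem eventually_isFine (B : BoundedSeq l h k C q u) {η : ℝ} (hη : 0 < η) :
    ∀ᶠ n in atTop, IsFine (h n) C η (k n) := by
  filter_upwards [B.tendsto_angle.eventually_le_const (show (0 : ℝ) < 1 / 8 by norm_num),
    B.tendsto_arc.eventually_le_const (show (0 : ℝ) < 1 / 8 by norm_num),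
    B.tendsto_speed.eventually_le_const (show (0 : ℝ) < η / 8 by positivity)] with n h1 h2 h3
  exact ⟨hη, B.one_le n, h1, h2, h3⟩

theorem eventually_small (B : BoundedSeq l h k C q u) {η : ℝ} (hη : 0 < η) :
    ∀ᶠ n in atTop, 2 * (h n ^ 2 + √(C * h n ^ 3)) + h n * C ≤ η ^ 2 / 4 := by
  have h1 := (B.tendsto_angle.const_mul 2).add (B.tendsto_h.mul_const C)
  simp only [mul_zero, zero_mul, add_zero] at h1
  exact h1.eventually_le_const (by positivity)

theorem eventually_lt_lastIdx (B : BoundedSeq l h k C q u) {x : ℝ} (hx : x ∈ Ioo (0 : ℝ) 1) :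
    ∀ᶠ n in atTop, ⌊x / l n⌋₊ + k n + 1 < lastIdx (l n) := by
  filter_upwards [B.tendsto_kl.eventually_le_const (sub_pos.2 hx.2)] with n hn
  have hl := B.l_pos n
  have h1 : (⌊x / l n⌋₊ : ℝ) ≤ x / l n := Nat.floor_le (div_nonneg hx.1.le hl.le)
  have h2 : 1 / l n < lastIdx (l n) + 1 := Nat.lt_floor_add_one _
  have h3 : x / l n + (k n + 2) ≤ 1 / l n := by
    rw [div_add' _ _ _ hl.ne']
    gcongr
    linarith
  have h4 : ((⌊x / l n⌋₊ + k n + 1 : ℕ) : ℝ) < lastIdx (l n) := by push_cast; linarith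
  exact_mod_cast h4

theorem isChain (B : BoundedSeq l h k C q u) {n : ℕ} (hn : 2 ≤ lastIdx (l n)) :
    IsChain (h n) C (lastIdx (l n)) (u n) :=
  ⟨B.h_pos n, hn, fun i hi => norm_eq_one_of_mem_circleUnion (B.mem_circle n i hi), B.energy n⟩

theorem eventually_isChain (B : BoundedSeq l h k C q u) :
    ∀ᶠ n in atTop, IsChain (h n) C (lastIdx (l n)) (u n) := by
  filter_upwards [B.eventually_lt_lastIdx (x := 1 / 2) (by norm_num)] with n hn
  have := B.one_le n
  exact B.isChain (by omega)

/-- A limit point of the axes of a chain is a limit of points `±q j`. -/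
theorem exists_tendsto_axis (B : BoundedSeq l h k C q u) {x : ℝ} (hx : x ∈ Ioo (0 : ℝ) 1)
    {ζ : E3} (hζ : ‖ζ‖ = 1)
    (hlim : Tendsto (fun n => chi (h n) (u n) ⌊x / l n⌋₊) atTop (𝓝 ζ)) :
    ∃ y : ℕ → E3, (∀ n, ∃ j, y n = q n j ∨ y n = -q n j) ∧ Tendsto y atTop (𝓝 ζ) := by
  have hax : Tendsto (fun n => axis (h n) (u n) ⌊x / l n⌋₊) atTop (𝓝 ζ) := by
    have h1 := (hlim.norm.inv₀ (by rw [hζ]; exact one_ne_zero)).smul hlim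
    rw [hζ, inv_one, one_smul] at h1
    simpa only [axis, one_div] using h1
  have hlarge : ∀ᶠ n in atTop, 1 / 2 ≤ ‖chi (h n) (u n) ⌊x / l n⌋₊‖ :=
    hlim.norm.eventually_const_le (by rw [hζ]; norm_num)
  have hnear : ∀ᶠ n in atTop, ∃ y, (∃ j, y = q n j ∨ y = -q n j) ∧
      ‖axis (h n) (u n) ⌊x / l n⌋₊ - y‖ ≤ 20 * √(k n * (h n * C)) := by
    filter_upwards [hlarge, B.eventually_isChain, B.eventually_lt_lastIdx hx,
      B.eventually_isFine (show (0 : ℝ) < 1 / 4 by norm_num)] with n h1 h2 h3 h4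
    set p := ⌊x / l n⌋₊ with hp
    have hC := B.C_nonneg
    have hh := B.h_pos n
    have hsum : √(k n * (h n * ∑ i ∈ Finset.Ico p (p + k n), eterm (h n) (u n) i)) ≤
        √(k n * (h n * C)) := by
      refine Real.sqrt_le_sqrt ?_
      have : ∑ i ∈ Finset.Ico p (p + k n), eterm (h n) (u n) i ≤ C :=
        h2.sum_le fun i hi => by simp at hi ⊢; omega
      gcongr
    obtain ⟨j, y, hy, hyi⟩ := h2.exists_axis_near h4 (B.norm_q n) (B.mem_circle n) (p := p)
      (by omega) (fun i hi => by
        have h5 := h2.norm_chi_sub_window_le (p := p) (k := k n) (by omega) hi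
          (show p ∈ Finset.Icc p (p + k n) by simp)
        have h6 := norm_sub_norm_le (chi (h n) (u n) p) (chi (h n) (u n) i)
        have := h4.speed
        linarith)
    refine ⟨y, ⟨j, hy⟩, (hyi p (by simp)).trans ?_⟩
    rw [show (5 : ℝ) / (1 / 4) = 20 by norm_num]
    gcongr
  -- where there is no near point, choose an arbitrary one
  have : ∀ n, ∃ y, (∃ j, y = q n j ∨ y = -q n j) ∧
      ((∃ y', (∃ j, y' = q n j ∨ y' = -q n j) ∧
        ‖axis (h n) (u n) ⌊x / l n⌋₊ - y'‖ ≤ 20 * √(k n * (h n * C))) →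
      ‖axis (h n) (u n) ⌊x / l n⌋₊ - y‖ ≤ 20 * √(k n * (h n * C))) := by
    intro n
    by_cases hex : ∃ y', (∃ j, y' = q n j ∨ y' = -q n j) ∧
        ‖axis (h n) (u n) ⌊x / l n⌋₊ - y'‖ ≤ 20 * √(k n * (h n * C))
    · obtain ⟨y, h1, h2⟩ := hex
      exact ⟨y, h1, fun _ => h2⟩
    · exact ⟨q n ⟨0, B.one_le n⟩, ⟨_, Or.inl rfl⟩, fun hc => absurd hc hex⟩
  choose y hy1 hy2 using this
  refine ⟨y, hy1, ?_⟩
  have h0 : Tendsto (fun n => axis (h n) (u n) ⌊x / l n⌋₊ - y n) atTop (𝓝 0) := by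
    refine squeeze_zero_norm' (a := fun n => 20 * √(k n * (h n * C))) ?_ ?_
    · filter_upwards [hnear] with n hn using hy2 n hn
    · simpa using B.tendsto_speed.const_mul 20
  have := hax.sub h0
  simpa using this

/-- Two points of convergence with different limits are separated by a transition. -/
theorem eventually_transCost_le (B : BoundedSeq l h k C q u) {x x' : ℝ}
    (hx' : x' ∈ Ioo (0 : ℝ) 1) (hxx : x < x') {ζ ζ' : E3}
    (hζ : ‖ζ‖ = 1) (hζ' : ‖ζ'‖ = 1) (hne : ζ ≠ ζ')
    (hlim : Tendsto (fun n => chi (h n) (u n) ⌊x / l n⌋₊) atTop (𝓝 ζ))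
    (hlim' : Tendsto (fun n => chi (h n) (u n) ⌊x' / l n⌋₊) atTop (𝓝 ζ'))
    {η : ℝ} (hη : 0 < η) (hη1 : η ≤ 1 / 2) :
    ∀ᶠ n in atTop,
      transCost η ≤ ∑ i ∈ Finset.Ico ⌊x / l n⌋₊ ⌊x' / l n⌋₊, eterm (h n) (u n) i := by
  have hax : ∀ {x : ℝ} {ζ : E3}, ‖ζ‖ = 1 →
      Tendsto (fun n => chi (h n) (u n) ⌊x / l n⌋₊) atTop (𝓝 ζ) →
      Tendsto (fun n => axis (h n) (u n) ⌊x / l n⌋₊) atTop (𝓝 ζ) := by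
    intro x ζ hζ hlim
    have h1 := (hlim.norm.inv₀ (by rw [hζ]; exact one_ne_zero)).smul hlim
    rw [hζ, inv_one, one_smul] at h1
    simpa only [axis, one_div] using h1
  have hdist := ((hax hζ' hlim').sub (hax hζ hlim)).norm
  have hgap := (B.tendsto_drift (30 / η)).eventually_lt hdist
    (norm_pos_iff.2 (sub_ne_zero.2 hne.symm))
  filter_upwards [hgap, B.eventually_isChain, B.eventually_lt_lastIdx hx', B.eventually_isFine hη,
    B.eventually_small hη,
    hlim.norm.eventually_const_le (show 1 - η < ‖ζ‖ by rw [hζ]; linarith),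
    hlim'.norm.eventually_const_le (show 1 - η < ‖ζ'‖ by rw [hζ']; linarith)]
    with n h1 h2 h3 h4 h5 h6 h7
  have hl := B.l_pos n
  exact h2.transCost_le_of_axis h4 hη1 h5 (B.norm_q n) (B.mem_circle n)
    (Nat.floor_le_floor (by gcongr)) (by omega) h6 h7 h1

/-- Disjoint intervals whose end points have different limits each cost at least `8/3`. -/
theorem card_mul_le (B : BoundedSeq l h k C q u) {ι : Type*} (s : Finset ι) (x x' : ι → ℝ)
    (ζ ζ' : ι → E3) (hx' : ∀ i ∈ s, x' i ∈ Ioo (0 : ℝ) 1)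
    (hxx : ∀ i ∈ s, x i < x' i)
    (hdisj : ∀ i ∈ s, ∀ j ∈ s, i ≠ j → x' i ≤ x j ∨ x' j ≤ x i)
    (hζ : ∀ i ∈ s, ‖ζ i‖ = 1) (hζ' : ∀ i ∈ s, ‖ζ' i‖ = 1) (hne : ∀ i ∈ s, ζ i ≠ ζ' i)
    (hlim : ∀ i ∈ s, Tendsto (fun n => chi (h n) (u n) ⌊x i / l n⌋₊) atTop (𝓝 (ζ i)))
    (hlim' : ∀ i ∈ s, Tendsto (fun n => chi (h n) (u n) ⌊x' i / l n⌋₊) atTop (𝓝 (ζ' i))) :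
    s.card * (8 / 3) ≤ C := by
  have key : ∀ η ∈ Ioc (0 : ℝ) (1 / 2), s.card * transCost η ≤ C := by
    intro η hη
    have h1 : ∀ᶠ n in atTop, ∀ i ∈ s,
        transCost η ≤ ∑ m ∈ Finset.Ico ⌊x i / l n⌋₊ ⌊x' i / l n⌋₊, eterm (h n) (u n) m :=
      (Filter.eventually_all_finset s).2 fun i hi =>
        B.eventually_transCost_le (hx' i hi) (hxx i hi) (hζ i hi) (hζ' i hi) (hne i hi)
          (hlim i hi) (hlim' i hi) hη.1 hη.2
    have h2 : ∀ᶠ n in atTop, ∀ i ∈ s, ⌊x' i / l n⌋₊ + k n + 1 < lastIdx (l n) :=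
      (Filter.eventually_all_finset s).2 fun i hi => B.eventually_lt_lastIdx (hx' i hi)
    obtain ⟨n, hn1, hn2, hn3⟩ := (h1.and (h2.and B.eventually_isChain)).exists
    have hl := B.l_pos n
    have hpd : (s : Set ι).PairwiseDisjoint fun i => Finset.Ico ⌊x i / l n⌋₊ ⌊x' i / l n⌋₊ := by
      intro i hi j hj hij
      have hfl : ∀ {a b : ℝ}, a ≤ b → ⌊a / l n⌋₊ ≤ ⌊b / l n⌋₊ := fun hab =>
        Nat.floor_le_floor (by gcongr)
      rw [Function.onFun, Finset.disjoint_left]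
      intro m hm hm'
      rw [Finset.mem_Ico] at hm hm'
      rcases hdisj i hi j hj hij with h | h
      · have := hfl h; omega
      · have := hfl h; omega
    calc s.card * transCost η = ∑ i ∈ s, transCost η := by rw [Finset.sum_const, nsmul_eq_mul]
      _ ≤ ∑ i ∈ s, ∑ m ∈ Finset.Ico ⌊x i / l n⌋₊ ⌊x' i / l n⌋₊, eterm (h n) (u n) m :=
          Finset.sum_le_sum hn1
      _ = ∑ m ∈ s.biUnion fun i => Finset.Ico ⌊x i / l n⌋₊ ⌊x' i / l n⌋₊,
            eterm (h n) (u n) m := (Finset.sum_biUnion hpd).symm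
      _ ≤ C := by
          refine hn3.sum_le fun m hm => ?_
          obtain ⟨i, hi, hmi⟩ := Finset.mem_biUnion.1 hm
          have := hn2 i hi
          rw [Finset.mem_Ico] at hmi
          rw [Finset.mem_range]; omega
  refine le_of_tendsto (tendsto_transCost.const_mul (s.card : ℝ)) ?_
  filter_upwards [Ioc_mem_nhdsGT (show (0 : ℝ) < 1 / 2 by norm_num)] with η hη using key η hη

theorem measurable_floor_comp {l : ℝ} (F : ℕ → ℝ≥0∞) : Measurable fun x : ℝ => F ⌊x / l⌋₊ :=
  (measurable_from_nat (f := F)).comp (Nat.measurable_floor.comp (measurable_id.div_const l))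

/-- The integral of a function that is constant on the cells of the lattice `l ℤ`. Only an
inequality holds, as the last cell may stick out of the unit interval. -/
theorem lintegral_floor_le {l : ℝ} (hl : 0 < l) (F : ℕ → ℝ≥0∞) (M : ℕ)
    (hF : ∀ i, M ≤ i → F i = 0) :
    ∫⁻ x in Ioo (0 : ℝ) 1, F ⌊x / l⌋₊ ≤ ENNReal.ofReal l * ∑ i ∈ Finset.range M, F i := by
  have hms : ∀ i : ℕ, MeasurableSet {x : ℝ | ⌊x / l⌋₊ = i} := fun i =>
    (Nat.measurable_floor.comp (measurable_id.div_const l)) (measurableSet_singleton i)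
  have e : ∀ x : ℝ, F ⌊x / l⌋₊ =
      ∑ i ∈ Finset.range M, {x : ℝ | ⌊x / l⌋₊ = i}.indicator (fun _ => F i) x := by
    intro x
    by_cases h : ⌊x / l⌋₊ < M
    · rw [Finset.sum_eq_single_of_mem ⌊x / l⌋₊ (Finset.mem_range.2 h)]
      · simp
      · intro j _ hj
        simp [hj.symm]
    · rw [hF _ (not_lt.1 h), Finset.sum_eq_zero]
      intro j hj
      rw [indicator_of_notMem]
      rintro rfl
      exact h (Finset.mem_range.1 hj)
  simp_rw [e]
  rw [lintegral_finsetSum _ fun i _ => measurable_const.indicator (hms i), Finset.mul_sum]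
  refine Finset.sum_le_sum fun i _ => ?_
  rw [lintegral_indicator (hms i), lintegral_const, mul_comm, Measure.restrict_apply_univ,
    Measure.restrict_apply (hms i)]
  gcongr
  have hsub : {x : ℝ | ⌊x / l⌋₊ = i} ∩ Ioo 0 1 ⊆ Icc (l * i) (l * i + l) := by
    rintro x ⟨hx, hx'⟩
    have h0 : 0 ≤ x / l := div_nonneg hx'.1.le hl.le
    rw [mem_ofPred_eq, Nat.floor_eq_iff h0, le_div_iff₀ hl, div_lt_iff₀ hl] at hx
    constructor <;> nlinarith
  refine (measure_mono hsub).trans ?_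
  rw [Real.volume_Icc]; simp

/-- The limit has speed one almost everywhere, because the potential part of the energy is
`o(1)` in `L¹`. -/
theorem ae_norm_eq_one (B : BoundedSeq l h k C q u) {z : ℝ → E3}
    (hlim : ∀ᵐ x ∂volume.restrict (Ioo (0 : ℝ) 1),
      Tendsto (fun n => chi (h n) (u n) ⌊x / l n⌋₊) atTop (𝓝 (z x))) :
    ∀ᵐ x ∂volume.restrict (Ioo (0 : ℝ) 1), ‖z x‖ = 1 := by
  set F : ℕ → ℕ → ℝ≥0∞ := fun n i =>
    if i < lastIdx (l n) - 1 then ENNReal.ofReal (eterm (h n) (u n) i / h n) else 0 with hF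
  have hC := B.C_nonneg
  have hint : ∀ n, ∫⁻ x in Ioo (0 : ℝ) 1, F n ⌊x / l n⌋₊ ≤ ENNReal.ofReal (l n / h n * C) := by
    intro n
    have hl := B.l_pos n
    have hh := B.h_pos n
    refine (lintegral_floor_le hl (F n) (lastIdx (l n) - 1) (fun i hi => by
      simp only [hF]; rw [if_neg (by omega)])).trans ?_
    have e : ∑ i ∈ Finset.range (lastIdx (l n) - 1), F n i =
        ENNReal.ofReal (∑ i ∈ Finset.range (lastIdx (l n) - 1), eterm (h n) (u n) i / h n) := by
      rw [ENNReal.ofReal_sum_of_nonneg fun i _ => div_nonneg (eterm_nonneg hh _ _) hh.le]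
      refine Finset.sum_congr rfl fun i hi => ?_
      simp only [hF]; rw [if_pos (Finset.mem_range.1 hi)]
    rw [e, ← ENNReal.ofReal_mul hl.le, ← Finset.sum_div]
    refine ENNReal.ofReal_le_ofReal ?_
    rw [mul_div_assoc', div_mul_eq_mul_div]
    have := B.energy n
    gcongr
  have hto : Tendsto (fun n => ∫⁻ x in Ioo (0 : ℝ) 1, F n ⌊x / l n⌋₊) atTop (𝓝 0) := by
    have h1 : Tendsto (fun n => ENNReal.ofReal (l n / h n * C)) atTop (𝓝 0) := by
      have := ENNReal.tendsto_ofReal (B.tendsto_lh.mul_const C)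
      simpa using this
    exact tendsto_of_tendsto_of_tendsto_of_le_of_le tendsto_const_nhds h1 (fun _ => zero_le)
      hint
  -- by Fatou's lemma, the energy per unit length has the inferior limit zero at a.e. point
  have hfatou : ∫⁻ x in Ioo (0 : ℝ) 1, liminf (fun n => F n ⌊x / l n⌋₊) atTop = 0 := by
    refine le_antisymm ?_ zero_le
    refine (lintegral_liminf_le fun n => measurable_floor_comp (F n)).trans ?_
    rw [hto.liminf_eq]
  rw [lintegral_eq_zero_iff (Measurable.liminf fun n => measurable_floor_comp (F n))] at hfatou
  filter_upwards [hfatou, hlim, ae_restrict_mem measurableSet_Ioo] with x h1 h2 hx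
  have h1' : liminf (fun n => F n ⌊x / l n⌋₊) atTop = 0 := h1
  -- the speeds at two consecutive sites have the same limit `‖z x‖`
  have hnext : Tendsto (fun n => ‖chi (h n) (u n) (⌊x / l n⌋₊ + 1)‖) atTop (𝓝 ‖z x‖) := by
    have h3 : Tendsto (fun n => chi (h n) (u n) (⌊x / l n⌋₊ + 1) - chi (h n) (u n) ⌊x / l n⌋₊)
        atTop (𝓝 0) := by
      refine squeeze_zero_norm' (a := fun n => √(h n * C)) ?_ ?_
      · filter_upwards [B.eventually_isChain, B.eventually_lt_lastIdx hx] with n h4 h5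
        refine Real.le_sqrt_of_sq_le ?_
        refine (norm_chi_sub_sq_le (B.h_pos n) (h4.unit _ (by omega))).trans ?_
        have := h4.eterm_le (i := ⌊x / l n⌋₊) (by omega)
        have := (B.h_pos n).le
        gcongr
      · have := (Real.continuous_sqrt.tendsto _).comp (B.tendsto_h.mul_const C)
        simpa [Function.comp_def] using this
    have := (h3.add h2).norm
    simpa using this
  -- `(1 - cos)/h²` has the same limit as half of the squared speed
  have hP : ∀ {a : ℕ → ℕ}, Tendsto (fun n => ‖chi (h n) (u n) (a n)‖) atTop (𝓝 ‖z x‖) →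
      (∀ᶠ n in atTop, a n < lastIdx (l n)) →
      Tendsto (fun n => (1 - inner ℝ (u n (a n)) (u n (a n + 1))) / h n ^ 2) atTop
        (𝓝 (‖z x‖ ^ 2 / 2)) := by
    intro a ha han
    have hup : Tendsto (fun n => ‖chi (h n) (u n) (a n)‖ ^ 2 *
        (1 + (h n ^ 2 + √(C * h n ^ 3))) / 2) atTop (𝓝 (‖z x‖ ^ 2 / 2)) := by
      have := ((ha.pow 2).mul (B.tendsto_angle.const_add 1)).div_const 2
      simpa using this
    refine tendsto_of_tendsto_of_tendsto_of_le_of_le' ((ha.pow 2).div_const 2) hup ?_ ?_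
    all_goals
      filter_upwards [han, B.eventually_isChain,
        B.tendsto_angle.eventually_le_const (show (0 : ℝ) < 1 by norm_num)] with n h5 h6 h7
      have hu0 := h6.unit (a n) (by omega)
      have hu1 := h6.unit (a n + 1) (by omega)
      have hh := B.h_pos n
      have e1 := norm_chi_sq hh hu0 hu1
      have e2 := one_sub_inner_nonneg hu0 hu1
      have e3 := h6.one_sub_inner_le h5
      have hτ : 0 ≤ h n ^ 2 + √(C * h n ^ 3) := by positivity
      generalize hp : 1 - inner ℝ (u n (a n)) (u n (a n + 1)) = p at *
      have hp' : p = h n ^ 2 * (p / h n ^ 2) := by field_simp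
      have e4 : ‖chi (h n) (u n) (a n)‖ ^ 2 = p / h n ^ 2 * (2 - h n ^ 2 * (p / h n ^ 2)) := by
        rw [← hp', div_mul_eq_mul_div, eq_div_iff (by positivity), ← e1]; ring
    · rw [e4, ← hp']
      have : p / h n ^ 2 * (2 - p) ≤ p / h n ^ 2 * 2 := by gcongr; linarith
      linarith
    · have := two_mul_le_of_sq_eq hτ h7 (div_nonneg e2 (by positivity)) (by rw [← hp']; exact e3) e4
      linarith
  have hlt := B.eventually_lt_lastIdx hx
  have hpot : Tendsto (fun n => (1 - (1 - inner ℝ (u n ⌊x / l n⌋₊) (u n (⌊x / l n⌋₊ + 1))) / h n ^ 2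
      - (1 - inner ℝ (u n (⌊x / l n⌋₊ + 1)) (u n (⌊x / l n⌋₊ + 1 + 1))) / h n ^ 2) ^ 2) atTop
      (𝓝 ((1 - ‖z x‖ ^ 2 / 2 - ‖z x‖ ^ 2 / 2) ^ 2)) :=
    (((hP h2.norm (hlt.mono fun n hn => by omega)).const_sub 1).sub
      (hP hnext (hlt.mono fun n hn => by omega))).pow 2
  have hle : ENNReal.ofReal ((1 - ‖z x‖ ^ 2 / 2 - ‖z x‖ ^ 2 / 2) ^ 2) ≤ 0 := by
    rw [← h1', ← (ENNReal.tendsto_ofReal hpot).liminf_eq]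
    refine liminf_le_liminf ?_
    filter_upwards [hlt, B.eventually_isChain] with n h3 h4
    simp only [hF]
    rw [if_pos (by omega)]
    refine ENNReal.ofReal_le_ofReal ?_
    have hh := B.h_pos n
    rw [eterm_eq hh (h4.unit _ (by omega)), le_div_iff₀ hh]
    have : 0 ≤ ‖chi (h n) (u n) (⌊x / l n⌋₊ + 1) - chi (h n) (u n) ⌊x / l n⌋₊‖ ^ 2 / h n := by
      positivity
    refine le_trans (le_of_eq ?_) (le_add_of_nonneg_right this)
    field_simp
  have h0 : (1 - ‖z x‖ ^ 2 / 2 - ‖z x‖ ^ 2 / 2) ^ 2 ≤ 0 := ENNReal.ofReal_eq_zero.1 (le_zero_iff.1 hle)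
  have h3 : (1 - ‖z x‖) * (1 + ‖z x‖) = 0 := by
    have := pow_eq_zero_iff (two_ne_zero) |>.1 (le_antisymm h0 (sq_nonneg _))
    linarith
  rcases mul_eq_zero.1 h3 with h | h
  · linarith
  · linarith [norm_nonneg (z x)]

end BoundedSeq

/-! ### The lower bound -/

/-- A function which is locally a.e. constant on an interval is a.e. constant there. -/
theorem exists_ae_eq_const_of_locally {a b : ℝ} {z : ℝ → E3} (hab : a < b)
    (h : ∀ y ∈ Ioo a b, ∃ ρ > 0, ∃ c, ∀ᵐ x ∂volume.restrict (Ioo (y - ρ) (y + ρ)), z x = c) :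
    ∃ c, ∀ᵐ x ∂volume.restrict (Ioo a b), z x = c := by
  have h' : ∀ y : Ioo a b, ∃ ρ > 0, ∃ c,
      ∀ᵐ x ∂volume.restrict (Ioo ((y : ℝ) - ρ) (y + ρ)), z x = c := fun y => h y y.2
  choose ρ hρ c hc using h'
  have hov : ∀ y y' : Ioo a b, (y : ℝ) ∈ Ioo ((y' : ℝ) - ρ y') (y' + ρ y') → c y = c y' := by
    intro y y' hy
    -- the two neighbourhoods overlap in a set of positive measure
    set I := Ioo ((y : ℝ) - ρ y) (y + ρ y) ∩ Ioo ((y' : ℝ) - ρ y') (y' + ρ y') with hI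
    have hpos : volume I ≠ 0 := by
      have hopen : IsOpen I := isOpen_Ioo.inter isOpen_Ioo
      exact (hopen.measure_pos volume ⟨y, ⟨by linarith [hρ y], by linarith [hρ y]⟩, hy⟩).ne'
    have h1 := ae_restrict_of_ae_restrict_of_subset (inter_subset_left : I ⊆ _) (hc y)
    have h2 := ae_restrict_of_ae_restrict_of_subset (inter_subset_right : I ⊆ _) (hc y')
    have : (ae (volume.restrict I)).NeBot := by
      rw [ae_neBot]; rwa [Ne, Measure.restrict_eq_zero]
    obtain ⟨x, hx1, hx2⟩ := (h1.and h2).exists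
    exact hx1.symm.trans hx2
  have hloc : IsLocallyConstant c := by
    rw [IsLocallyConstant.iff_eventually_eq]
    intro y'
    have : Ioo ((y' : ℝ) - ρ y') (y' + ρ y') ∈ 𝓝 (y' : ℝ) :=
      Ioo_mem_nhds (by linarith [hρ y']) (by linarith [hρ y'])
    filter_upwards [continuous_subtype_val.continuousAt.preimage_mem_nhds this] with y hy
      using hov y y' hy
  have : PreconnectedSpace (Ioo a b) := Subtype.preconnectedSpace isPreconnected_Ioo
  have y₀ : Ioo a b := ⟨(a + b) / 2, by constructor <;> linarith⟩
  refine ⟨c y₀, ?_⟩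
  rw [ae_restrict_iff' measurableSet_Ioo, ae_iff]
  refine measure_null_of_locally_null _ fun x hx => ?_
  simp only [mem_ofPred_eq, Classical.not_imp] at hx
  refine ⟨_, inter_mem_nhdsWithin _ (Ioo_mem_nhds (show x - ρ ⟨x, hx.1⟩ < x by linarith [hρ ⟨x, hx.1⟩])
    (show x < x + ρ ⟨x, hx.1⟩ by linarith [hρ ⟨x, hx.1⟩])), ?_⟩
  have h1 := hc ⟨x, hx.1⟩
  rw [ae_restrict_iff' measurableSet_Ioo, ae_iff] at h1
  refine measure_mono_null ?_ h1
  rintro w ⟨hw, hw'⟩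
  simp only [mem_ofPred_eq, Classical.not_imp] at hw ⊢
  refine ⟨hw', fun he => hw.2 ?_⟩
  rw [he]; exact hloc.apply_eq_of_preconnectedSpace _ _

/-- If disjoint intervals whose end points carry different values are limited in number by `C`,
then the function is a step function with at most `C` jumps. -/
theorem exists_isStep_of_card_le {z : ℝ → E3} {G : Set ℝ} (hG : ∀ᵐ x, x ∈ Ioo (0 : ℝ) 1 → x ∈ G)
    {C : ℝ} (hC : ∀ (s : Finset ℝ) (x x' : ℝ → ℝ),
      (∀ i ∈ s, x i ∈ Ioo (0 : ℝ) 1 ∩ G) → (∀ i ∈ s, x' i ∈ Ioo (0 : ℝ) 1 ∩ G) →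
      (∀ i ∈ s, x i < x' i) → (∀ i ∈ s, ∀ j ∈ s, i ≠ j → x' i ≤ x j ∨ x' j ≤ x i) →
      (∀ i ∈ s, z (x i) ≠ z (x' i)) → (s.card : ℝ) ≤ C) :
    ∃ m t c, IsStep z m t c ∧ (∀ j < m, c j ≠ c (j + 1)) ∧ (m : ℝ) ≤ C := by
  -- the points near which `z` is not constant; every neighbourhood of such a point contains two
  -- points of `G` at which `z` differs, hence there are at most `C` of them
  set J : Set ℝ := {y | y ∈ Ioo (0 : ℝ) 1 ∧
    ¬ ∃ ρ > 0, ∃ c, ∀ᵐ x ∂volume.restrict (Ioo (y - ρ) (y + ρ)), z x = c} with hJ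
  have hpair : ∀ y ∈ J, ∀ ρ > 0, Ioo (y - ρ) (y + ρ) ⊆ Ioo 0 1 →
      ∃ x x', x ∈ Ioo (y - ρ) (y + ρ) ∩ G ∧ x' ∈ Ioo (y - ρ) (y + ρ) ∩ G ∧ x < x' ∧
        z x ≠ z x' := by
    intro y hy ρ hρ hsub
    by_contra hcon
    push Not at hcon
    refine hy.2 ⟨ρ, hρ, ?_⟩
    have hae : ∀ᵐ x ∂volume.restrict (Ioo (y - ρ) (y + ρ)), x ∈ Ioo (y - ρ) (y + ρ) ∩ G := by
      rw [ae_restrict_iff' measurableSet_Ioo]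
      filter_upwards [hG] with x hx hxm using ⟨hxm, hx (hsub hxm)⟩
    by_cases hne : (Ioo (y - ρ) (y + ρ) ∩ G).Nonempty
    · obtain ⟨x₀, hx₀⟩ := hne
      refine ⟨z x₀, ?_⟩
      filter_upwards [hae] with x hx
      rcases lt_trichotomy x x₀ with h | h | h
      · exact hcon x x₀ hx hx₀ h
      · rw [h]
      · exact (hcon x₀ x hx₀ hx h).symm
    · refine ⟨0, ?_⟩
      filter_upwards [hae] with x hx using absurd ⟨x, hx⟩ hne
  have hcard : ∀ s : Finset ℝ, (s : Set ℝ) ⊆ J → (s.card : ℝ) ≤ C := by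
    intro s hs
    obtain ⟨ρ, hρ1, hρ2, hρ3⟩ : ∃ ρ : ℝ, (∀ i ∈ s, ∀ j ∈ s, i ≠ j → 2 * ρ ≤ |i - j|) ∧
        (∀ i ∈ s, ρ ≤ i ∧ i + ρ ≤ 1) ∧ 0 < ρ := by
      have hlim : Tendsto (fun ρ : ℝ => ρ) (𝓝[>] 0) (𝓝 0) :=
        tendsto_id.mono_left nhdsWithin_le_nhds
      have e1 : ∀ᶠ ρ : ℝ in 𝓝[>] 0, ∀ i ∈ s, ∀ j ∈ s, i ≠ j → 2 * ρ ≤ |i - j| := by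
        refine (Filter.eventually_all_finset s).2 fun i _ =>
          (Filter.eventually_all_finset s).2 fun j _ => ?_
        by_cases hij : i = j
        · exact Eventually.of_forall fun _ h => absurd hij h
        · have h0 : (0 : ℝ) < |i - j| / 2 := by
            have := abs_pos.2 (sub_ne_zero.2 hij); linarith
          filter_upwards [hlim.eventually_le_const h0] with ρ hρ _
          linarith
      have e2 : ∀ᶠ ρ : ℝ in 𝓝[>] 0, ∀ i ∈ s, ρ ≤ i ∧ i + ρ ≤ 1 := by
        refine (Filter.eventually_all_finset s).2 fun i hi => ?_
        have h1 := (hs hi).1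
        filter_upwards [hlim.eventually_le_const h1.1,
          hlim.eventually_le_const (sub_pos.2 h1.2)] with ρ h2 h3
        exact ⟨h2, by linarith⟩
      exact (e1.and (e2.and self_mem_nhdsWithin)).exists
    have hsub : ∀ i ∈ s, Ioo (i - ρ) (i + ρ) ⊆ Ioo (0 : ℝ) 1 := fun i hi =>
      Ioo_subset_Ioo (by linarith [(hρ2 i hi).1]) (hρ2 i hi).2
    choose! x x' hx hx' hxx hne using fun i (hi : i ∈ s) =>
      hpair i (hs hi) ρ hρ3 (hsub i hi)
    refine hC s x x' (fun i hi => ⟨hsub i hi (hx i hi).1, (hx i hi).2⟩)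
      (fun i hi => ⟨hsub i hi (hx' i hi).1, (hx' i hi).2⟩) hxx ?_ hne
    intro i hi j hj hij
    have h1 := hρ1 i hi j hj hij
    have h2 := (hx i hi).1
    have h3 := (hx' i hi).1
    have h4 := (hx j hj).1
    have h5 := (hx' j hj).1
    rcases le_abs.1 h1 with h | h
    · right; linarith [h2.1, h5.2]
    · left; linarith [h4.1, h3.2]
  have hfin : J.Finite := by
    by_contra hinf
    obtain ⟨N, hN⟩ := exists_nat_gt C
    obtain ⟨s, hs, hsN⟩ := (show J.Infinite from hinf).exists_subset_card_eq N
    have := hcard s hs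
    rw [hsN] at this
    linarith
  obtain ⟨t, c, hS, htJ⟩ := exists_isStep hfin.toFinset
    (by rw [Set.Finite.coe_toFinset]; exact fun x hx => hx.1)
    (z := z) (fun a b hab hsub hdisj => exists_ae_eq_const_of_locally hab fun y hy => by
      by_contra hcon
      rw [Set.Finite.coe_toFinset] at hdisj
      exact Set.disjoint_left.1 hdisj hy ⟨hsub hy, hcon⟩)
  refine ⟨_, t, c, hS, fun j hj hcc => ?_, hcard _ (by rw [Set.Finite.coe_toFinset])⟩
  have hmem := htJ (j + 1) (by omega) hj
  rw [Set.Finite.mem_toFinset] at hmem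
  have hl := hS.lt_succ j (by omega)
  have hr := hS.lt_succ (j + 1) hj
  refine hmem.2 ⟨min (t (j + 1) - t j) (t (j + 1 + 1) - t (j + 1)), lt_min (by linarith)
    (by linarith), c j, ?_⟩
  have h1 := hS.ae_eq j (by omega)
  have h2 := hS.ae_eq (j + 1) hj
  rw [ae_restrict_iff' measurableSet_Ioo] at h1 h2 ⊢
  have h3 : ∀ᵐ x, x ≠ t (j + 1) := by simp [ae_iff, measure_singleton]
  filter_upwards [h1, h2, h3] with x hx1 hx2 hx3 hx
  have hm1 := min_le_left (t (j + 1) - t j) (t (j + 1 + 1) - t (j + 1))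
  have hm2 := min_le_right (t (j + 1) - t j) (t (j + 1 + 1) - t (j + 1))
  rcases lt_or_gt_of_ne hx3 with h | h
  · exact hx1 ⟨by linarith [hx.1], h⟩
  · rw [hcc]; exact hx2 ⟨h, by linarith [hx.2]⟩

/-- The limit of chains with bounded energy belongs to `BV_pc`, and its limit energy is bounded by
the same constant. -/
theorem BoundedSeq.limitEnergy_le {l h : ℕ → ℝ} {k : ℕ → ℕ} {C : ℝ} {q : (n : ℕ) → Fin (k n) → E3}
    {u : ℕ → ℕ → E3} (B : BoundedSeq l h k C q u) {K : Set E3}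
    (hK : ∀ y : ℕ → E3, (∀ n, ∃ j, y n = q n j ∨ y n = -q n j) → ∀ ζ, Tendsto y atTop (𝓝 ζ) → ζ ∈ K)
    (z : L1I)
    (hlim : ∀ᵐ x ∂volume.restrict (Ioo (0 : ℝ) 1),
      Tendsto (fun n => chi (h n) (u n) ⌊x / l n⌋₊) atTop (𝓝 (z x))) :
    limitEnergy K z ≤ ENNReal.ofReal C := by
  have h1 := B.ae_norm_eq_one hlim
  set G : Set ℝ := {x | ‖z x‖ = 1 ∧
    Tendsto (fun n => chi (h n) (u n) ⌊x / l n⌋₊) atTop (𝓝 (z x))} with hGdef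
  have hG : ∀ᵐ x, x ∈ Ioo (0 : ℝ) 1 → x ∈ G :=
    (ae_restrict_iff' measurableSet_Ioo).1 (h1.and hlim)
  obtain ⟨m, t, c, hS, hne, hm⟩ := exists_isStep_of_card_le (z := z) hG (C := C * (3 / 8))
    (fun s x x' hx hx' hxx hdisj hzz => by
      have := B.card_mul_le s x x' (fun i => z (x i)) (fun i => z (x' i))
        (fun i hi => (hx' i hi).1) hxx hdisj (fun i hi => (hx i hi).2.1)
        (fun i hi => (hx' i hi).2.1) hzz (fun i hi => (hx i hi).2.2) (fun i hi => (hx' i hi).2.2)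
      linarith)
  have hzint : IntegrableOn z (Ioo 0 1) := by
    have := (Lp.memLp z).integrable le_rfl
    exact IntegrableOn.mono_set (s := Ioo 0 1) (t := Icc 0 1) this Ioo_subset_Icc_self
  have hzK : ∀ᵐ x ∂volume.restrict (Ioo (0 : ℝ) 1), z x ∈ K := by
    filter_upwards [h1, hlim, ae_restrict_mem measurableSet_Ioo] with x hx1 hx2 hx3
    obtain ⟨y, hy1, hy2⟩ := B.exists_tendsto_axis hx3 hx1 hx2
    exact hK y hy1 _ hy2
  rw [limitEnergy, if_pos (hS.isBVpc hne hzint hzK), hS.encard_jumpSet hne]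
  have e : (((m : ℕ∞) : ℝ≥0∞)) = ENNReal.ofReal m := by simp
  rw [e, ← ENNReal.ofReal_mul (by norm_num)]
  exact ENNReal.ofReal_le_ofReal (by linarith)

theorem sliceEnergy_eq {l d : ℝ} (hl : 0 < l) (hd : 0 < d) (u : ℕ → E3) :
    sliceEnergy l d u = √2 * l * d ^ (3 / 2 : ℝ) *
      ∑ i ∈ Finset.range (lastIdx l - 1), eterm √(2 * d) u i := by
  have h1 : √(2 * d) ^ 2 = 2 * d := Real.sq_sqrt (by positivity)
  have h2 : √(2 * d) ^ 3 = 2 * (√2 * d ^ (3 / 2 : ℝ)) := by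
    have e1 : d ^ (3 / 2 : ℝ) = d * √d := by
      rw [Real.sqrt_eq_rpow, ← Real.rpow_one_add' hd.le (by norm_num)]; norm_num
    rw [pow_succ, h1, Real.sqrt_mul (by norm_num), e1]; ring
  rw [sliceEnergy, Finset.mul_sum, Finset.mul_sum]
  refine Finset.sum_congr rfl fun i _ => ?_
  have hp : 0 < √2 * d ^ (3 / 2 : ℝ) := by positivity
  rw [eterm, h1, h2, show 2 * (1 - d) = 2 - 2 * d by ring]
  field_simp

theorem exists_of_rescaledEnergy_lt {l d : ℝ} (hl : 0 < l) (hd : 0 < d) {Q : Set E3} {z : L1I}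
    {C : ℝ} (h : rescaledEnergy l d Q z < ENNReal.ofReal C) :
    ∃ u, IsConfig l (circleUnion Q) u ∧
      (z : ℝ → E3) =ᵐ[volume.restrict (Icc (0 : ℝ) 1)] chiralityFun l d u ∧
      ∑ i ∈ Finset.range (lastIdx l - 1), eterm √(2 * d) u i ≤ C := by
  have hp : 0 < √2 * l * d ^ (3 / 2 : ℝ) := by positivity
  have hC : 0 < C := by
    by_contra hC
    rw [ENNReal.ofReal_eq_zero.2 (not_lt.1 hC)] at h
    exact not_lt_zero h
  rw [rescaledEnergy, ENNReal.div_lt_iff (Or.inl (by simpa using hp))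
    (Or.inl ENNReal.ofReal_ne_top), constrainedEnergy] at h
  simp only [iInf_lt_iff] at h
  obtain ⟨u, h1, h2, h3⟩ := h
  refine ⟨u, h1, h2, ?_⟩
  rw [← ENNReal.ofReal_mul hC.le, ENNReal.ofReal_lt_ofReal_iff (by positivity),
    sliceEnergy_eq hl hd, mul_comm] at h3
  exact (lt_of_mul_lt_mul_right h3 hp.le).le

theorem rescaledEnergy_le {l d : ℝ} (hl : 0 < l) (hd : 0 < d) {Q : Set E3} {z : L1I}
    {u : ℕ → E3} (h1 : IsConfig l (circleUnion Q) u)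
    (h2 : (z : ℝ → E3) =ᵐ[volume.restrict (Icc (0 : ℝ) 1)] chiralityFun l d u) :
    rescaledEnergy l d Q z ≤
      ENNReal.ofReal (∑ i ∈ Finset.range (lastIdx l - 1), eterm √(2 * d) u i) := by
  have hp : 0 < √2 * l * d ^ (3 / 2 : ℝ) := by positivity
  refine ENNReal.div_le_of_le_mul ?_
  rw [← ENNReal.ofReal_mul (Finset.sum_nonneg fun i _ =>
    eterm_nonneg (Real.sqrt_pos.2 (by positivity)) u i), mul_comm, ← sliceEnergy_eq hl hd]
  exact iInf_le_of_le u (iInf_le_of_le h1 (iInf_le_of_le h2 le_rfl))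

theorem chiralityFun_eq_chi {l d : ℝ} {u : ℕ → E3} {x : ℝ} (h : ⌊x / l⌋₊ < lastIdx l) :
    chiralityFun l d u x = chi √(2 * d) u ⌊x / l⌋₊ := by
  rw [chiralityFun, chirality, chi, min_eq_left (by omega)]

/-- The part of Kuratowski convergence that survives the passage to a subsequence. -/
theorem mem_union_neg_of_tendsto {k : ℕ → ℕ} {q : (n : ℕ) → Fin (k n) → E3} {Qbar : Set E3}
    (hk : ∀ n, 1 ≤ k n) (hQ : KuratowskiTendsto (fun n => range (q n)) Qbar) {φ : ℕ → ℕ}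
    (hφ : StrictMono φ) (y : ℕ → E3) (hy : ∀ n, ∃ j, y n = q (φ n) j ∨ y n = -q (φ n) j) {ζ : E3}
    (hlim : Tendsto y atTop (𝓝 ζ)) : ζ ∈ Qbar ∪ {v | -v ∈ Qbar} := by
  -- a subsequence lying in `Q` extends to a full sequence
  have key : ∀ (w : ℕ → E3) (ξ : E3), Tendsto w atTop (𝓝 ξ) →
      (∃ᶠ n in atTop, w n ∈ range (q (φ n))) → ξ ∈ Qbar := by
    intro w ξ hw hfreq
    classical
    set X : ℕ → E3 := fun m => if hm : ∃ n, φ n = m ∧ w n ∈ range (q (φ n)) then w hm.choose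
      else q m ⟨0, hk m⟩ with hX
    have hXφ : ∀ n, w n ∈ range (q (φ n)) → X (φ n) = w n := by
      intro n hn
      have hm : ∃ n', φ n' = φ n ∧ w n' ∈ range (q (φ n')) := ⟨n, rfl, hn⟩
      simp only [hX]
      rw [dif_pos hm, hφ.injective hm.choose_spec.1]
    refine hQ.2.1 X (fun m => ?_) ξ ?_
    · simp only [hX]
      split_ifs with hm
      · have := hm.choose_spec
        rw [this.1] at this
        exact this.2
      · exact mem_range_self _
    · rw [mapClusterPt_iff_frequently]
      intro s hs
      have h1 : ∃ᶠ n in atTop, X (φ n) ∈ s :=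
        (hfreq.and_eventually (hw.eventually hs)).mono fun n hn => by
          rw [hXφ n hn.1]; exact hn.2
      exact hφ.tendsto_atTop.frequently h1
  by_cases hfreq : ∃ᶠ n in atTop, y n ∈ range (q (φ n))
  · exact Or.inl (key y ζ hlim hfreq)
  · refine Or.inr (key (fun n => -y n) (-ζ) hlim.neg (Eventually.frequently ?_))
    rw [not_frequently] at hfreq
    filter_upwards [hfreq] with n hn
    obtain ⟨j, hj | hj⟩ := hy n
    · exact absurd ⟨j, hj.symm⟩ hn
    · exact ⟨j, by simp [hj]⟩

theorem sqrt_sqrt_two_mul {d : ℝ} (hd : 0 ≤ d) :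
    √(√(2 * d)) = √(√2) * d ^ (1 / 4 : ℝ) := by
  rw [Real.sqrt_mul (by norm_num), Real.sqrt_mul (by positivity)]
  congr 1
  rw [Real.sqrt_eq_rpow, Real.sqrt_eq_rpow, ← Real.rpow_mul hd]
  norm_num

/-- The lower bound of the `Γ`-limit. -/
theorem limitEnergy_le_liminf
    (lam del : ℕ → ℝ) (k : ℕ → ℕ)
    (q : (n : ℕ) → Fin (k n) → E3) (Qbar : Set E3)
    (hlam : ∀ n, 0 < lam n) (hdel : ∀ n, 0 < del n) (hk : ∀ n, 1 ≤ k n)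
    (hlam0 : Tendsto lam atTop (𝓝 0)) (hdel0 : Tendsto del atTop (𝓝 0))
    (hq : ∀ n j, ‖q n j‖ = 1)
    (hQbar : KuratowskiTendsto (fun n => range (q n)) Qbar)
    (hscale : Tendsto (fun n => lam n / √(del n)) atTop (𝓝 0))
    (hcircles : Tendsto (fun n => (k n : ℝ) * del n ^ (1 / 4 : ℝ)) atTop (𝓝 0))
    (z : L1I) (w : ℕ → L1I) (hw : Tendsto w atTop (𝓝 z)) :
    limitEnergy (Qbar ∪ {v | -v ∈ Qbar}) z ≤
      liminf (fun n => rescaledEnergy (lam n) (del n) (range (q n)) (w n)) atTop := by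
  refine le_of_not_gt fun hlt => ?_
  obtain ⟨c, hc1, hc2⟩ := exists_between hlt
  lift c to NNReal using (hc2.trans_le le_top).ne
  rw [← ENNReal.ofReal_coe_nnreal] at hc1 hc2
  -- otherwise a subsequence of smaller energy converges almost everywhere
  obtain ⟨φ₁, hφ₁, hE⟩ :=
    extraction_of_frequently_atTop (frequently_lt_of_liminf_lt (by isBoundedDefault) hc1)
  have hmeas : TendstoInMeasure (volume.restrict (Icc (0 : ℝ) 1)) (fun n => (w (φ₁ n) : ℝ → E3))
      atTop z :=
    tendstoInMeasure_of_tendsto_Lp (hw.comp hφ₁.tendsto_atTop)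
  obtain ⟨φ₂, hφ₂, hae⟩ := hmeas.exists_seq_tendsto_ae
  set φ : ℕ → ℕ := fun n => φ₁ (φ₂ n) with hφdef
  have hφ : StrictMono φ := hφ₁.comp hφ₂
  have hφt := hφ.tendsto_atTop
  choose u hu1 hu2 hu3 using fun n => exists_of_rescaledEnergy_lt (hlam (φ n)) (hdel (φ n))
    (hE (φ₂ n))
  have B : BoundedSeq (fun n => lam (φ n)) (fun n => √(2 * del (φ n))) (fun n => k (φ n)) c
      (fun n => q (φ n)) u := by
    refine ⟨fun n => hlam _, fun n => Real.sqrt_pos.2 (mul_pos two_pos (hdel _)), fun n => hk _,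
      hlam0.comp hφt, ?_, ?_, ?_, fun n => hq _, fun n i hi => (hu1 n).1 i hi, hu3⟩
    · have hc : Continuous fun x : ℝ => √(2 * x) := by fun_prop
      have := (hc.tendsto 0).comp (hdel0.comp hφt)
      simpa [Function.comp_def] using this
    · have := (hscale.comp hφt).mul_const (1 / √2)
      rw [zero_mul] at this
      refine this.congr fun n => ?_
      rw [Function.comp_apply, Real.sqrt_mul (by norm_num)]
      have := Real.sqrt_pos.2 (hdel (φ n))
      field_simp
    · have := (hcircles.comp hφt).const_mul √(√2)
      rw [mul_zero] at this
      refine this.congr fun n => ?_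
      rw [Function.comp_apply, sqrt_sqrt_two_mul (hdel _).le]; ring
  refine absurd (B.limitEnergy_le (fun y hy ζ hζ => mem_union_neg_of_tendsto hk hQbar hφ y hy hζ)
    z ?_) (not_le.2 hc2)
  have h1 := ae_restrict_of_ae_restrict_of_subset (Ioo_subset_Icc_self (a := (0 : ℝ)) (b := 1)) hae
  have h2 : ∀ᵐ x ∂volume.restrict (Ioo (0 : ℝ) 1), ∀ n,
      w (φ n) x = chiralityFun (lam (φ n)) (del (φ n)) (u n) x :=
    ae_all_iff.2 fun n => ae_restrict_of_ae_restrict_of_subset Ioo_subset_Icc_self (hu2 n)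
  filter_upwards [h1, h2, ae_restrict_mem measurableSet_Ioo] with x hx1 hx2 hx3
  refine hx1.congr' ?_
  filter_upwards [B.eventually_lt_lastIdx hx3] with n hn
  rw [← chiralityFun_eq_chi (by omega), ← hx2 n]

/-! ### The optimal profile -/

/-- The explicit Euler scheme for the optimal profile equation `w' = 1 - w²`. -/
def eulerProfile (h : ℝ) : ℕ → ℝ
  | 0 => 0
  | r + 1 => eulerProfile h r + h * (1 - eulerProfile h r ^ 2)

theorem eulerProfile_mem {h : ℝ} (h0 : 0 < h) (h1 : h ≤ 1 / 2) (r : ℕ) :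
    0 ≤ eulerProfile h r ∧ eulerProfile h r ≤ 1 := by
  induction r with
  | zero => simp [eulerProfile]
  | succ r ih =>
    obtain ⟨a, b⟩ := ih
    rw [eulerProfile]
    constructor
    · have : 0 ≤ h * (1 - eulerProfile h r ^ 2) := mul_nonneg h0.le (by nlinarith)
      linarith
    · have e : 1 - (eulerProfile h r + h * (1 - eulerProfile h r ^ 2)) =
          (1 - eulerProfile h r) * (1 - h * (1 + eulerProfile h r)) := by ring
      have : 0 ≤ (1 - eulerProfile h r) * (1 - h * (1 + eulerProfile h r)) :=
        mul_nonneg (by linarith) (by nlinarith)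
      linarith

theorem eulerProfile_le_succ {h : ℝ} (h0 : 0 < h) (h1 : h ≤ 1 / 2) (r : ℕ) :
    eulerProfile h r ≤ eulerProfile h (r + 1) := by
  obtain ⟨a, b⟩ := eulerProfile_mem h0 h1 r
  rw [eulerProfile]
  have : 0 ≤ h * (1 - eulerProfile h r ^ 2) := mul_nonneg h0.le (by nlinarith)
  linarith

/-- The Euler scheme approaches one at the rate `1/(r h)`. -/
theorem one_sub_eulerProfile_mul_le {h : ℝ} (h0 : 0 < h) (h1 : h ≤ 1 / 2) (r : ℕ) :
    (1 - eulerProfile h r) * (1 + r * h) ≤ 1 := by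
  induction r with
  | zero => simp [eulerProfile]
  | succ r ih =>
    obtain ⟨a, b⟩ := eulerProfile_mem h0 h1 r
    rw [eulerProfile]
    have hr : (0 : ℝ) ≤ r * h := by positivity
    have e : (1 - (eulerProfile h r + h * (1 - eulerProfile h r ^ 2))) * (1 + (r + 1 : ℕ) * h) =
        (1 - eulerProfile h r) * (1 + r * h) +
        (1 - eulerProfile h r) * h * (1 - (1 + eulerProfile h r) * (1 + r * h + h)) := by
      push_cast; ring
    rw [e]
    have : (1 - eulerProfile h r) * h * (1 - (1 + eulerProfile h r) * (1 + r * h + h)) ≤ 0 :=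
      mul_nonpos_of_nonneg_of_nonpos (mul_nonneg (by linarith) h0.le) (by nlinarith)
    linarith

/-- The cost of the ascent from zero to one, `∫₀¹ (1 - r²) dr = 2/3`. -/
theorem sum_eulerProfile_le {h : ℝ} (h0 : 0 < h) (h1 : h ≤ 1 / 2) (M : ℕ) :
    ∑ r ∈ Finset.range M, h * (1 - eulerProfile h r ^ 2) ^ 2 ≤ 2 / 3 + 2 * h := by
  -- a Riemann sum of `1 - w²` over the partition `w 0 < w 1 < …`
  have step : ∀ r, h * (1 - eulerProfile h r ^ 2) ^ 2 ≤
      ((eulerProfile h (r + 1) - eulerProfile h (r + 1) ^ 3 / 3) -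
        (eulerProfile h r - eulerProfile h r ^ 3 / 3)) +
        2 * h * (eulerProfile h (r + 1) - eulerProfile h r) := by
    intro r
    obtain ⟨a, b⟩ := eulerProfile_mem h0 h1 r
    obtain ⟨a', b'⟩ := eulerProfile_mem h0 h1 (r + 1)
    have hle := eulerProfile_le_succ h0 h1 r
    have hd : eulerProfile h (r + 1) - eulerProfile h r = h * (1 - eulerProfile h r ^ 2) := by
      rw [eulerProfile]; ring
    have hdh : eulerProfile h (r + 1) - eulerProfile h r ≤ h := by rw [hd]; nlinarith
    have e : h * (1 - eulerProfile h r ^ 2) ^ 2 =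
        (eulerProfile h (r + 1) - eulerProfile h r) * (1 - eulerProfile h r ^ 2) := by
      rw [hd]; ring
    rw [e]
    generalize eulerProfile h (r + 1) = y at *
    generalize eulerProfile h r = x at *
    have e2 : (y - y ^ 3 / 3) - (x - x ^ 3 / 3) + 2 * h * (y - x) - (y - x) * (1 - x ^ 2) =
        (y - x) * (2 * h - (y - x) * (y + 2 * x) / 3) := by ring
    have : 0 ≤ (y - x) * (2 * h - (y - x) * (y + 2 * x) / 3) :=
      mul_nonneg (by linarith) (by nlinarith)
    linarith
  refine (Finset.sum_le_sum fun r _ => step r).trans ?_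
  rw [Finset.sum_add_distrib, ← Finset.mul_sum,
    Finset.sum_range_sub (fun r => eulerProfile h r - eulerProfile h r ^ 3 / 3),
    Finset.sum_range_sub (eulerProfile h)]
  obtain ⟨a, b⟩ := eulerProfile_mem h0 h1 M
  have e0 : eulerProfile h 0 = 0 := rfl
  have := sub_cube_mono a b le_rfl
  rw [e0]
  nlinarith

/-- The energy density of consecutive speeds `a`, `b` about a common axis. -/
def sterm (h a b : ℝ) : ℝ := h * (1 - (a ^ 2 + b ^ 2) / 2) ^ 2 + (b - a) ^ 2 / h

theorem sterm_nonneg {h : ℝ} (h0 : 0 < h) (a b : ℝ) : 0 ≤ sterm h a b := by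
  unfold sterm; positivity

theorem sterm_comm (h a b : ℝ) : sterm h a b = sterm h b a := by
  unfold sterm; ring

theorem sterm_one (h : ℝ) : sterm h 1 1 = 0 := by norm_num [sterm]

/-- The profile that reaches the speed one after finitely many steps. -/
def ramp (h ε : ℝ) (r : ℕ) : ℝ := min 1 ((1 + ε) * eulerProfile h r)

theorem ramp_zero (h ε : ℝ) : ramp h ε 0 = 0 := by simp [ramp, eulerProfile]

theorem ramp_mem {h ε : ℝ} (h0 : 0 < h) (h1 : h ≤ 1 / 2) (hε : 0 < ε) (r : ℕ) :
    0 ≤ ramp h ε r ∧ ramp h ε r ≤ 1 := by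
  obtain ⟨a, b⟩ := eulerProfile_mem h0 h1 r
  exact ⟨le_min zero_le_one (by positivity), min_le_left _ _⟩

theorem ramp_eq_one {h ε : ℝ} (h0 : 0 < h) (h1 : h ≤ 1 / 2) (hε : 0 < ε) {r : ℕ}
    (hr : 1 ≤ ε * (r * h)) : ramp h ε r = 1 := by
  refine min_eq_left ?_
  have k := one_sub_eulerProfile_mul_le h0 h1 r
  obtain ⟨a, b⟩ := eulerProfile_mem h0 h1 r
  have h2 : (1 - eulerProfile h r) * (ε * (1 + r * h)) ≤ ε := by
    calc _ = ε * ((1 - eulerProfile h r) * (1 + r * h)) := by ring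
      _ ≤ ε * 1 := by gcongr
      _ = ε := mul_one _
  have h3 : (1 - eulerProfile h r) * (ε + 1) ≤ (1 - eulerProfile h r) * (ε * (1 + r * h)) :=
    mul_le_mul_of_nonneg_left (by linarith) (by linarith)
  linarith

/-- The potential term is at most that of the Euler scheme, since the ramp lies above it; the
gradient term grows at most by the factor `(1 + ε)²`. -/
theorem sterm_ramp_le {h ε : ℝ} (h0 : 0 < h) (h1 : h ≤ 1 / 2) (hε : 0 < ε) (r : ℕ) :
    sterm h (ramp h ε r) (ramp h ε (r + 1)) ≤
      (1 + (1 + ε) ^ 2) * (h * (1 - eulerProfile h r ^ 2) ^ 2) := by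
  obtain ⟨a, b⟩ := eulerProfile_mem h0 h1 r
  obtain ⟨a', b'⟩ := eulerProfile_mem h0 h1 (r + 1)
  obtain ⟨c, d⟩ := ramp_mem h0 h1 hε r
  obtain ⟨c', d'⟩ := ramp_mem h0 h1 hε (r + 1)
  have hle := eulerProfile_le_succ h0 h1 r
  have hd : eulerProfile h (r + 1) - eulerProfile h r = h * (1 - eulerProfile h r ^ 2) := by
    rw [eulerProfile]; ring
  have hr : eulerProfile h r ≤ ramp h ε r := le_min b (by nlinarith)
  have hr' : eulerProfile h r ≤ ramp h ε (r + 1) := hle.trans (le_min b' (by nlinarith))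
  have hkin : |ramp h ε (r + 1) - ramp h ε r| ≤
      (1 + ε) * (eulerProfile h (r + 1) - eulerProfile h r) := by
    refine (abs_min_sub_min_le_max _ _ _ _).trans ?_
    rw [sub_self, abs_zero, ← mul_sub, abs_of_nonneg (mul_nonneg (by linarith) (by linarith))]
    exact max_le (mul_nonneg (by linarith) (by linarith)) le_rfl
  have p1 : (1 - (ramp h ε r ^ 2 + ramp h ε (r + 1) ^ 2) / 2) ^ 2 ≤
      (1 - eulerProfile h r ^ 2) ^ 2 := by
    have q1 : ramp h ε r ^ 2 ≤ 1 := by nlinarith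
    have q2 : ramp h ε (r + 1) ^ 2 ≤ 1 := by nlinarith
    have q3 : eulerProfile h r ^ 2 ≤ ramp h ε r ^ 2 := by gcongr
    have q4 : eulerProfile h r ^ 2 ≤ ramp h ε (r + 1) ^ 2 := by gcongr
    refine pow_le_pow_left₀ (by linarith) (by linarith) 2
  have p2 : (ramp h ε (r + 1) - ramp h ε r) ^ 2 / h ≤
      (1 + ε) ^ 2 * (h * (1 - eulerProfile h r ^ 2) ^ 2) := by
    rw [div_le_iff₀ h0, ← sq_abs]
    calc |ramp h ε (r + 1) - ramp h ε r| ^ 2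
        ≤ ((1 + ε) * (eulerProfile h (r + 1) - eulerProfile h r)) ^ 2 := by gcongr
      _ = _ := by rw [hd]; ring
  have p3 : h * (1 - (ramp h ε r ^ 2 + ramp h ε (r + 1) ^ 2) / 2) ^ 2 ≤
      h * (1 - eulerProfile h r ^ 2) ^ 2 := by gcongr
  rw [sterm]
  linarith

theorem sum_sterm_ramp_le {h ε : ℝ} (h0 : 0 < h) (h1 : h ≤ 1 / 2) (hε : 0 < ε) (M : ℕ) :
    ∑ r ∈ Finset.range M, sterm h (ramp h ε r) (ramp h ε (r + 1)) ≤
      (1 + (1 + ε) ^ 2) * (2 / 3 + 2 * h) := by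
  refine (Finset.sum_le_sum fun r _ => sterm_ramp_le h0 h1 hε r).trans ?_
  rw [← Finset.mul_sum]
  gcongr
  exact sum_eulerProfile_le h0 h1 M

/-- The speed of a single transition: it descends to zero at the sites `I - 1` and `I`, and ascends
again. -/
def valley (h ε : ℝ) (I i : ℕ) : ℝ := if I ≤ i then ramp h ε (i - I) else ramp h ε (I - 1 - i)

theorem valley_mem {h ε : ℝ} (h0 : 0 < h) (h1 : h ≤ 1 / 2) (hε : 0 < ε) (I i : ℕ) :
    0 ≤ valley h ε I i ∧ valley h ε I i ≤ 1 := by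
  unfold valley; split_ifs <;> exact ramp_mem h0 h1 hε _

theorem valley_eq_one {h ε : ℝ} (h0 : 0 < h) (h1 : h ≤ 1 / 2) (hε : 0 < ε) {R I i : ℕ}
    (hR : 1 ≤ ε * (R * h)) (hi : i + R < I ∨ I + R ≤ i) : valley h ε I i = 1 := by
  have key : ∀ r : ℕ, R ≤ r → ramp h ε r = 1 := fun r hr => ramp_eq_one h0 h1 hε (hR.trans (by
    have : (R : ℝ) ≤ r := by exact_mod_cast hr
    gcongr))
  unfold valley
  split_ifs with h
  · exact key _ (by omega)
  · exact key _ (by omega)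

/-- The energy of a single transition: two ramps, and the step of speed zero between them. -/
theorem sum_sterm_valley_le {h ε : ℝ} (h0 : 0 < h) (h1 : h ≤ 1 / 2) (hε : 0 < ε) {I : ℕ}
    (hI : 1 ≤ I) (M : ℕ) :
    ∑ i ∈ Finset.range M, sterm h (valley h ε I i) (valley h ε I (i + 1)) ≤
      2 * ((1 + (1 + ε) ^ 2) * (2 / 3 + 2 * h)) + h := by
  obtain ⟨I, rfl⟩ : ∃ I', I = I' + 1 := ⟨I - 1, by omega⟩
  have hsub : Finset.range M ⊆ Finset.range (I + 1 + M) := Finset.range_mono (by omega)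
  refine (Finset.sum_le_sum_of_subset_of_nonneg hsub fun i _ _ => sterm_nonneg h0 _ _).trans ?_
  rw [Finset.sum_range_add, Finset.sum_range_succ]
  have e1 : ∑ i ∈ Finset.range I, sterm h (valley h ε (I + 1) i) (valley h ε (I + 1) (i + 1)) =
      ∑ r ∈ Finset.range I, sterm h (ramp h ε r) (ramp h ε (r + 1)) := by
    rw [← Finset.sum_range_reflect]
    refine Finset.sum_congr rfl fun r hr => ?_
    rw [Finset.mem_range] at hr
    rw [sterm_comm, valley, valley, if_neg (by omega), if_neg (by omega)]
    congr 2 <;> omega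
  have e2 : ∑ i ∈ Finset.range M, sterm h (valley h ε (I + 1) (I + 1 + i))
      (valley h ε (I + 1) (I + 1 + i + 1)) =
      ∑ r ∈ Finset.range M, sterm h (ramp h ε r) (ramp h ε (r + 1)) := by
    refine Finset.sum_congr rfl fun r _ => ?_
    rw [valley, valley, if_pos (by omega), if_pos (by omega)]
    congr 2 <;> omega
  have e3 : sterm h (valley h ε (I + 1) I) (valley h ε (I + 1) (I + 1)) = h := by
    have a1 : valley h ε (I + 1) I = 0 := by
      rw [valley, if_neg (by omega)]; simp [ramp_zero]
    have a2 : valley h ε (I + 1) (I + 1) = 0 := by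
      rw [valley, if_pos le_rfl]; simp [ramp_zero]
    rw [a1, a2]; simp [sterm]
  rw [e1, e2, e3]
  have := sum_sterm_ramp_le h0 h1 hε I
  have := sum_sterm_ramp_le h0 h1 hε M
  linarith

/-- The speed with transitions at `I 1, …, I m`. The valleys will have disjoint supports, so that
the deviations from one may be added. -/
def valleys (h ε : ℝ) (m : ℕ) (I : ℕ → ℕ) (i : ℕ) : ℝ :=
  1 - ∑ j ∈ Finset.Icc 1 m, (1 - valley h ε (I j) i)

section Valleys

variable {h ε : ℝ} {m R : ℕ} {I : ℕ → ℕ}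

theorem valleys_eq_one (h0 : 0 < h) (h1 : h ≤ 1 / 2) (hε : 0 < ε) (hR : 1 ≤ ε * (R * h)) {i : ℕ}
    (hi : ∀ j ∈ Finset.Icc 1 m, i + R < I j ∨ I j + R ≤ i) : valleys h ε m I i = 1 := by
  rw [valleys, Finset.sum_eq_zero, sub_zero]
  intro j hj
  rw [valley_eq_one h0 h1 hε hR (hi j hj), sub_self]

/-- At each pair of neighbouring sites at most one valley is active. -/
theorem valleys_cases (h0 : 0 < h) (h1 : h ≤ 1 / 2) (hε : 0 < ε) (hR : 1 ≤ ε * (R * h))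
    (hsep : ∀ j ∈ Finset.Icc 1 m, ∀ j' ∈ Finset.Icc 1 m, j < j' → I j + 2 * R + 2 ≤ I j')
    (i : ℕ) :
    (valleys h ε m I i = 1 ∧ valleys h ε m I (i + 1) = 1) ∨
    ∃ j ∈ Finset.Icc 1 m, valleys h ε m I i = valley h ε (I j) i ∧
      valleys h ε m I (i + 1) = valley h ε (I j) (i + 1) := by
  by_cases hall : ∀ j ∈ Finset.Icc 1 m, i + 1 + R < I j ∨ I j + R ≤ i
  · left
    exact ⟨valleys_eq_one h0 h1 hε hR fun j hj => by have := hall j hj; omega,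
      valleys_eq_one h0 h1 hε hR fun j hj => by have := hall j hj; omega⟩
  · right
    push Not at hall
    obtain ⟨j, hj, hj1, hj2⟩ := hall
    have hoth : ∀ j' ∈ Finset.Icc 1 m, j' ≠ j → i + 1 + R < I j' ∨ I j' + R ≤ i := by
      intro j' hj' hne
      rcases lt_or_gt_of_ne hne with hlt | hlt
      · have := hsep j' hj' j hj hlt; omega
      · have := hsep j hj j' hj' hlt; omega
    refine ⟨j, hj, ?_, ?_⟩
    · rw [valleys, Finset.sum_eq_single_of_mem j hj, sub_sub_cancel]
      intro j' hj' hne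
      rw [valley_eq_one h0 h1 hε hR (by have := hoth j' hj' hne; omega), sub_self]
    · rw [valleys, Finset.sum_eq_single_of_mem j hj, sub_sub_cancel]
      intro j' hj' hne
      rw [valley_eq_one h0 h1 hε hR (by have := hoth j' hj' hne; omega), sub_self]

theorem valleys_mem (h0 : 0 < h) (h1 : h ≤ 1 / 2) (hε : 0 < ε) (hR : 1 ≤ ε * (R * h))
    (hsep : ∀ j ∈ Finset.Icc 1 m, ∀ j' ∈ Finset.Icc 1 m, j < j' → I j + 2 * R + 2 ≤ I j')
    (i : ℕ) : 0 ≤ valleys h ε m I i ∧ valleys h ε m I i ≤ 1 := by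
  rcases valleys_cases h0 h1 hε hR hsep i with ⟨h, -⟩ | ⟨j, -, h, -⟩
  · rw [h]; norm_num
  · rw [h]; exact valley_mem h0 h1 hε _ _

/-- The speed vanishes at both sites of the break `I j`. -/
theorem valleys_break (h0 : 0 < h) (h1 : h ≤ 1 / 2) (hε : 0 < ε) (hR : 1 ≤ ε * (R * h))
    (hsep : ∀ j ∈ Finset.Icc 1 m, ∀ j' ∈ Finset.Icc 1 m, j < j' → I j + 2 * R + 2 ≤ I j')
    {i j : ℕ} (hj : j ∈ Finset.Icc 1 m) (hij : I j = i + 1) :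
    valleys h ε m I i = 0 ∧ valleys h ε m I (i + 1) = 0 := by
  have hoth : ∀ j' ∈ Finset.Icc 1 m, j' ≠ j → i + 1 + R < I j' ∨ I j' + R ≤ i := by
    intro j' hj' hne
    rcases lt_or_gt_of_ne hne with hlt | hlt
    · have := hsep j' hj' j hj hlt; omega
    · have := hsep j hj j' hj' hlt; omega
  constructor
  · rw [valleys, Finset.sum_eq_single_of_mem j hj, sub_sub_cancel, valley, if_neg (by omega), hij]
    · simp [ramp_zero]
    · intro j' hj' hne
      rw [valley_eq_one h0 h1 hε hR (by have := hoth j' hj' hne; omega), sub_self]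
  · rw [valleys, Finset.sum_eq_single_of_mem j hj, sub_sub_cancel, valley, if_pos (by omega), hij]
    · simp [ramp_zero]
    · intro j' hj' hne
      rw [valley_eq_one h0 h1 hε hR (by have := hoth j' hj' hne; omega), sub_self]

theorem sum_sterm_valleys_le (h0 : 0 < h) (h1 : h ≤ 1 / 2) (hε : 0 < ε) (hR : 1 ≤ ε * (R * h))
    (hsep : ∀ j ∈ Finset.Icc 1 m, ∀ j' ∈ Finset.Icc 1 m, j < j' → I j + 2 * R + 2 ≤ I j')
    (hpos : ∀ j ∈ Finset.Icc 1 m, 1 ≤ I j) (M : ℕ) :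
    ∑ i ∈ Finset.range M, sterm h (valleys h ε m I i) (valleys h ε m I (i + 1)) ≤
      m * (2 * ((1 + (1 + ε) ^ 2) * (2 / 3 + 2 * h)) + h) := by
  have step : ∀ i, sterm h (valleys h ε m I i) (valleys h ε m I (i + 1)) ≤
      ∑ j ∈ Finset.Icc 1 m, sterm h (valley h ε (I j) i) (valley h ε (I j) (i + 1)) := by
    intro i
    rcases valleys_cases h0 h1 hε hR hsep i with ⟨e1, e2⟩ | ⟨j, hj, e1, e2⟩
    · rw [e1, e2, sterm_one]
      exact Finset.sum_nonneg fun j _ => sterm_nonneg h0 _ _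
    · rw [e1, e2]
      exact Finset.single_le_sum
        (f := fun j => sterm h (valley h ε (I j) i) (valley h ε (I j) (i + 1)))
        (fun j _ => sterm_nonneg h0 _ _) hj
  refine (Finset.sum_le_sum fun i _ => step i).trans ?_
  rw [Finset.sum_comm]
  refine (Finset.sum_le_card_nsmul _ _ _ fun j hj =>
    sum_sterm_valley_le h0 h1 hε (hpos j hj) M).trans ?_
  rw [nsmul_eq_mul, Nat.card_Icc, Nat.add_sub_cancel]

end Valleys

/-- The effect of amplitudes in `[1, A]` on the energy density. -/
theorem sterm_mul_le {h A α α' b b' : ℝ} (h0 : 0 < h) (hα : 1 ≤ α) (hαA : α ≤ A)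
    (hb : 0 ≤ b ∧ b ≤ 1) (hb' : 0 ≤ b' ∧ b' ≤ 1) (hcase : α = α' ∨ (b = 0 ∧ b' = 0)) :
    sterm h (α * b) (α' * b') ≤ A ^ 2 * sterm h b b' + h * (A ^ 2 - 1) ^ 2 := by
  have hA1 : 1 ≤ A ^ 2 := by nlinarith
  rcases hcase with rfl | ⟨rfl, rfl⟩
  · have hαA2 : α ^ 2 ≤ A ^ 2 := by gcongr
    have hα2 : 1 ≤ α ^ 2 := by nlinarith
    obtain ⟨x, hx⟩ : ∃ x, x = (b ^ 2 + b' ^ 2) / 2 := ⟨_, rfl⟩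
    have hx0 : 0 ≤ x := by rw [hx]; positivity
    have hx1 : x ≤ 1 := by rw [hx]; nlinarith
    have e1 : ((α * b) ^ 2 + (α * b') ^ 2) / 2 = α ^ 2 * x := by rw [hx]; ring
    have p1 : (1 - α ^ 2 * x) ^ 2 ≤ A ^ 2 * (1 - x) ^ 2 + (A ^ 2 - 1) ^ 2 := by
      have q0 : (1 - x) ^ 2 ≤ A ^ 2 * (1 - x) ^ 2 := le_mul_of_one_le_left (sq_nonneg _) hA1
      have q3 : x ≤ α ^ 2 * x := le_mul_of_one_le_left hx0 hα2
      rcases le_total (α ^ 2 * x) 1 with hle | hle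
      · have q1 : (1 - α ^ 2 * x) ^ 2 ≤ (1 - x) ^ 2 :=
          pow_le_pow_left₀ (by linarith) (by linarith) 2
        nlinarith [sq_nonneg (A ^ 2 - 1)]
      · have q2 : α ^ 2 * x ≤ A ^ 2 := by nlinarith
        have q1 : (α ^ 2 * x - 1) ^ 2 ≤ (A ^ 2 - 1) ^ 2 :=
          pow_le_pow_left₀ (by linarith) (by linarith) 2
        nlinarith [sq_nonneg (1 - x)]
    have p2 : (α * b' - α * b) ^ 2 / h ≤ A ^ 2 * ((b' - b) ^ 2 / h) := by
      rw [← mul_sub, mul_pow, mul_div_assoc]; gcongr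
    rw [sterm, sterm, e1, ← hx]
    have p3 := mul_le_mul_of_nonneg_left p1 h0.le
    linarith
  · simp only [mul_zero, sterm]
    have : 0 ≤ h * (A ^ 2 - 1) ^ 2 := by positivity
    norm_num
    nlinarith

/-! ### Spins rotating on great circles -/

/-- The rotation of `p ⊥ y` about the unit axis `y` by the angle `θ`. -/
def rot (y : E3) (θ : ℝ) (p : E3) : E3 := Real.cos θ • p + Real.sin θ • cross y p

theorem inner_rot_rot {y p : E3} (hy : ‖y‖ = 1) (hp : ‖p‖ = 1) (hyp : inner ℝ y p = 0) (α β : ℝ) :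
    inner ℝ (rot y α p) (rot y β p) = Real.cos (β - α) := by
  have h1 : inner ℝ (cross y p) (cross y p) = 1 := by
    rw [inner_cross_cross, real_inner_self_eq_norm_sq, real_inner_self_eq_norm_sq, hy, hp, hyp]
    ring
  have h2 : inner ℝ p (cross y p) = 0 := inner_right_cross _ _
  have h3 : inner ℝ (cross y p) p = 0 := by rw [real_inner_comm]; exact h2
  simp only [rot, inner_add_left, inner_add_right, real_inner_smul_left, real_inner_smul_right, h1,
    h2, h3, real_inner_self_eq_norm_sq, hp]
  rw [Real.cos_sub]; ring

theorem norm_rot {y p : E3} (hy : ‖y‖ = 1) (hp : ‖p‖ = 1) (hyp : inner ℝ y p = 0) (θ : ℝ) :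
    ‖rot y θ p‖ = 1 := by
  have h := inner_rot_rot hy hp hyp θ θ
  rw [sub_self, Real.cos_zero, real_inner_self_eq_norm_sq] at h
  exact (pow_eq_one_iff_of_nonneg (norm_nonneg _) two_ne_zero).1 h

theorem inner_axis_rot {y p : E3} (hyp : inner ℝ y p = 0) (θ : ℝ) : inner ℝ y (rot y θ p) = 0 := by
  rw [rot, inner_add_right, real_inner_smul_right, real_inner_smul_right, hyp, inner_left_cross]
  ring

theorem cross_axis_cross {y p : E3} (hy : ‖y‖ = 1) (hyp : inner ℝ y p = 0) :
    cross y (cross y p) = -p := by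
  rw [cross_cross, hyp, real_inner_self_eq_norm_sq, hy]; simp

theorem cross_rot_rot {y p : E3} (hp : ‖p‖ = 1) (hyp : inner ℝ y p = 0)
    (α β : ℝ) : cross (rot y α p) (rot y β p) = Real.sin (β - α) • y := by
  have h1 : cross p (cross y p) = y := by
    rw [cross_cross, real_inner_self_eq_norm_sq, hp, real_inner_comm, hyp]; simp
  have h2 : cross (cross y p) p = -y := by rw [cross_anticomm, h1]
  simp only [rot, cross_add, add_cross, cross_smul, smul_cross, cross_self, h1, h2]
  rw [Real.sin_sub]; module

theorem rot_rot {y p : E3} (hy : ‖y‖ = 1) (hyp : inner ℝ y p = 0) (α β : ℝ) :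
    rot y β (rot y α p) = rot y (α + β) p := by
  simp only [rot, cross_add, cross_smul, cross_axis_cross hy hyp]
  rw [Real.cos_add, Real.sin_add]; module

theorem rot_zero (y p : E3) : rot y 0 p = p := by simp [rot]

/-- Rotations about `y` act transitively on the great circle `y^⊥`. -/
theorem exists_rot_eq {y p p' : E3} (hy : ‖y‖ = 1) (hp : ‖p‖ = 1) (hp' : ‖p'‖ = 1)
    (hyp : inner ℝ y p = 0) (hyp' : inner ℝ y p' = 0) : ∃ θ, rot y θ p = p' := by
  -- `p × p'` is parallel to `y`
  have h1 : cross y (cross p p') = 0 := by rw [cross_cross, hyp, hyp']; simp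
  have h2 : cross y (cross y (cross p p')) = 0 := by
    rw [h1]; simpa using cross_smul 0 y 0
  rw [cross_cross, real_inner_self_eq_norm_sq, hy, one_pow, one_smul, sub_eq_zero] at h2
  set s := inner ℝ y (cross p p') with hs
  set c := inner ℝ p p' with hc
  have h3 : p' = c • p + s • cross y p := by
    have h4 : cross p (cross p p') = c • p - p' := by
      rw [cross_cross, real_inner_self_eq_norm_sq, hp]; simp [hc]
    rw [← h2, cross_smul, cross_anticomm] at h4
    have : p' = c • p - s • -cross y p := by rw [h4]; abel
    rw [this]; module
  have h5 : c ^ 2 + s ^ 2 = 1 := by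
    have h6 : ‖cross p p'‖ ^ 2 = s ^ 2 := by rw [← h2, norm_smul, hy, mul_one, Real.norm_eq_abs, sq_abs]
    have h7 := norm_cross_sq p p'
    rw [h6, hp, hp', ← hc] at h7
    linarith
  obtain ⟨θ, hθc, hθs⟩ : ∃ θ, Real.cos θ = c ∧ Real.sin θ = s := by
    have hn : ‖(⟨c, s⟩ : ℂ)‖ = 1 := by
      rw [Complex.norm_eq_sqrt_sq_add_sq, h5, Real.sqrt_one]
    have hz : (⟨c, s⟩ : ℂ) ≠ 0 := by rw [← norm_ne_zero_iff, hn]; exact one_ne_zero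
    refine ⟨Complex.arg ⟨c, s⟩, ?_, ?_⟩
    · rw [Complex.cos_arg hz, hn, div_one]
    · rw [Complex.sin_arg, hn, div_one]
  exact ⟨θ, by rw [rot, hθc, hθs, ← h3]⟩

/-- Any two great circles intersect. -/
theorem exists_unit_orthogonal (y y' : E3) :
    ∃ p : E3, ‖p‖ = 1 ∧ inner ℝ y p = 0 ∧ inner ℝ y' p = 0 := by
  let f : E3 →ₗ[ℝ] (Fin 2 → ℝ) := LinearMap.pi ![(innerₛₗ ℝ y), (innerₛₗ ℝ y')]
  have hker : LinearMap.ker f ≠ ⊥ := LinearMap.ker_ne_bot_of_finrank_lt (by simp)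
  obtain ⟨v, hv, hv0⟩ := Submodule.exists_mem_ne_zero_of_ne_bot hker
  have hf : f v = 0 := hv
  have h0 : inner ℝ y v = 0 := by simpa [f] using congrFun hf 0
  have h1 : inner ℝ y' v = 0 := by simpa [f] using congrFun hf 1
  refine ⟨(‖v‖⁻¹ : ℝ) • v, norm_smul_inv_norm hv0, ?_, ?_⟩
  · rw [real_inner_smul_right, h0, mul_zero]
  · rw [real_inner_smul_right, h1, mul_zero]

/-- The angle between unit vectors at distance `h s`. With this choice the potential term of the
energy is exactly that of `sterm`. -/
def ang (h s : ℝ) : ℝ := 2 * Real.arcsin (h * s / 2)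

theorem cos_ang {h s : ℝ} (h0 : 0 ≤ h * s) (h1 : h * s ≤ 2) :
    Real.cos (ang h s) = 1 - h ^ 2 * s ^ 2 / 2 := by
  rw [ang, Real.cos_two_mul, Real.cos_sq', Real.sin_arcsin (by linarith) (by linarith)]; ring

theorem sin_ang {h s : ℝ} (h0 : 0 ≤ h * s) (h1 : h * s ≤ 2) :
    Real.sin (ang h s) = h * (s * √(1 - (h * s / 2) ^ 2)) := by
  rw [ang, Real.sin_two_mul, Real.sin_arcsin (by linarith) (by linarith), Real.cos_arcsin]; ring

/-- The function `x ↦ x √(1 - x²)` is `1`-Lipschitz on `[0, 1/√2]`. -/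
theorem abs_mul_sqrt_sub_le {x y : ℝ} (hx : 0 ≤ x) (hy : 0 ≤ y) (hx2 : 2 * x ^ 2 ≤ 1)
    (hy2 : 2 * y ^ 2 ≤ 1) :
    |x * √(1 - x ^ 2) - y * √(1 - y ^ 2)| ≤ |x - y| := by
  wlog hxy : y ≤ x generalizing x y
  · rw [abs_sub_comm, abs_sub_comm x]; exact this hy hx hy2 hx2 (by linarith)
  have hs1 : √(1 - x ^ 2) ≤ √(1 - y ^ 2) := Real.sqrt_le_sqrt (by nlinarith)
  have hs2 : √(1 - y ^ 2) ≤ 1 := Real.sqrt_le_one.2 (by nlinarith)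
  have hs3 : 0 ≤ √(1 - x ^ 2) := Real.sqrt_nonneg _
  have hs4 : 0 ≤ √(1 - y ^ 2) := Real.sqrt_nonneg _
  have hmono : y * √(1 - y ^ 2) ≤ x * √(1 - x ^ 2) := by
    refine abs_le_of_sq_le_sq' ?_ (by positivity) |>.2
    rw [mul_pow, mul_pow, Real.sq_sqrt (by nlinarith), Real.sq_sqrt (by nlinarith)]
    have e : x ^ 2 * (1 - x ^ 2) - y ^ 2 * (1 - y ^ 2) = (x ^ 2 - y ^ 2) * (1 - x ^ 2 - y ^ 2) := by
      ring
    have : 0 ≤ (x ^ 2 - y ^ 2) * (1 - x ^ 2 - y ^ 2) := mul_nonneg (by nlinarith) (by nlinarith)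
    linarith
  rw [abs_of_nonneg (by linarith), abs_of_nonneg (by linarith)]
  have k1 : x * √(1 - x ^ 2) ≤ x * √(1 - y ^ 2) := by gcongr
  have k2 : (x - y) * √(1 - y ^ 2) ≤ x - y := mul_le_of_le_one_right (by linarith) hs2
  linarith

/-- The index of the piece, delimited by the break points `I 1 < … < I m`, that contains `i`. -/
def pieceIdx (I : ℕ → ℕ) (m i : ℕ) : ℕ := Nat.findGreatest (fun j => I j ≤ i) m

section Piece

variable {I : ℕ → ℕ} {m : ℕ}

theorem pieceIdx_le (I : ℕ → ℕ) (m i : ℕ) : pieceIdx I m i ≤ m := Nat.findGreatest_le _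

theorem le_of_pieceIdx (hI0 : I 0 = 0) (i : ℕ) : I (pieceIdx I m i) ≤ i :=
  Nat.findGreatest_spec (P := fun j => I j ≤ i) (Nat.zero_le m) (by simp [hI0])

theorem lt_of_pieceIdx {i j : ℕ} (h1 : pieceIdx I m i < j) (h2 : j ≤ m) : i < I j :=
  not_le.1 (Nat.findGreatest_is_greatest (P := fun j => I j ≤ i) h1 h2)

theorem pieceIdx_eq {i j : ℕ} (hI : ∀ a b, a < b → b ≤ m → I a < I b) (hj : j ≤ m) (h1 : I j ≤ i)
    (h2 : j < m → i < I (j + 1)) : pieceIdx I m i = j := by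
  rw [pieceIdx, Nat.findGreatest_eq_iff]
  refine ⟨hj, fun _ => h1, fun n hn hnm => ?_⟩
  have h3 := h2 (by omega)
  rcases (show j + 1 ≤ n from hn).eq_or_lt with rfl | h
  · omega
  · have := hI _ _ h hnm; omega

theorem pieceIdx_succ (hI0 : I 0 = 0) (hI : ∀ a b, a < b → b ≤ m → I a < I b) (i : ℕ) :
    pieceIdx I m (i + 1) = pieceIdx I m i ∨ (pieceIdx I m i < m ∧
      I (pieceIdx I m i + 1) = i + 1 ∧ pieceIdx I m (i + 1) = pieceIdx I m i + 1) := by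
  have h1 : pieceIdx I m i ≤ pieceIdx I m (i + 1) :=
    Nat.findGreatest_mono_left (fun j hj => Nat.le_succ_of_le hj) m
  rcases h1.eq_or_lt with h | h
  · exact Or.inl h.symm
  · right
    have h2 := pieceIdx_le I m (i + 1)
    have h3 := lt_of_pieceIdx (I := I) (m := m) (i := i) (Nat.lt_succ_self _) (by omega)
    have h4 := le_of_pieceIdx (m := m) hI0 (i + 1)
    rcases (show pieceIdx I m i + 1 ≤ pieceIdx I m (i + 1) from h).eq_or_lt with h5 | h5
    · rw [← h5] at h4
      exact ⟨by omega, by simp only [Nat.succ_eq_add_one] at h3; omega, h5.symm⟩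
    · have := hI _ _ h5 h2
      simp only [Nat.succ_eq_add_one] at h3
      omega

/-- Gluing: rotations about the axes `y 0, …, y m`, on the pieces delimited by `I`, form a chain if
the arc on each piece leads from `p j` to `p (j+1)`. -/
theorem exists_spins (hI0 : I 0 = 0) (hI : ∀ a b, a < b → b ≤ m → I a < I b)
    {y p : ℕ → E3} (hy : ∀ j ≤ m, ‖y j‖ = 1) (hp : ∀ j ≤ m, ‖p j‖ = 1 ∧ inner ℝ (y j) (p j) = 0)
    (θ : ℕ → ℝ)
    (hmatch : ∀ j < m, rot (y j) (∑ i ∈ Finset.Ico (I j) (I (j + 1)), θ i) (p j) = p (j + 1)) :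
    ∃ u : ℕ → E3, ∀ i, ‖u i‖ = 1 ∧ inner ℝ (y (pieceIdx I m i)) (u i) = 0 ∧
      inner ℝ (u i) (u (i + 1)) = Real.cos (θ i) ∧
      cross (u i) (u (i + 1)) = Real.sin (θ i) • y (pieceIdx I m i) := by
  set u : ℕ → E3 := fun i => rot (y (pieceIdx I m i))
    (∑ a ∈ Finset.Ico (I (pieceIdx I m i)) i, θ a) (p (pieceIdx I m i)) with hu
  refine ⟨u, fun i => ?_⟩
  have hle := pieceIdx_le I m i
  obtain ⟨hp1, hp2⟩ := hp _ hle
  have hnext : u (i + 1) = rot (y (pieceIdx I m i))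
      ((∑ a ∈ Finset.Ico (I (pieceIdx I m i)) i, θ a) + θ i) (p (pieceIdx I m i)) := by
    rw [← Finset.sum_Ico_succ_top (le_of_pieceIdx hI0 i)]
    rcases pieceIdx_succ hI0 hI i with h | ⟨h1, h2, h3⟩
    · simp only [hu, h]
    · simp only [hu, h3, h2, Finset.Ico_self, Finset.sum_empty, rot_zero]
      rw [← hmatch _ h1, h2]
  refine ⟨norm_rot (hy _ hle) hp1 hp2 _, inner_axis_rot hp2 _, ?_, ?_⟩
  · rw [hnext]; simp only [hu]
    rw [inner_rot_rot (hy _ hle) hp1 hp2, add_sub_cancel_left]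
  · rw [hnext]; simp only [hu]
    rw [cross_rot_rot hp1 hp2, add_sub_cancel_left]

end Piece

/-- By increasing the amplitude of the speed from `1` to at most `A`, which adds at least one full
turn, a chain can be made to reach
a prescribed point of its great circle. -/
theorem exists_amplitude {h A : ℝ} (h0 : 0 < h) (hA1 : 1 ≤ A) (hA : h * A ≤ 2) {b : ℕ → ℝ}
    (hb : ∀ i, 0 ≤ b i ∧ b i ≤ 1) {y p p' : E3} (hy : ‖y‖ = 1) (hp : ‖p‖ = 1) (hp' : ‖p'‖ = 1)
    (hyp : inner ℝ y p = 0) (hyp' : inner ℝ y p' = 0) (s : Finset ℕ)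
    (hs : 2 * Real.pi ≤ (A - 1) * h * ∑ i ∈ s, b i) :
    ∃ α ∈ Icc 1 A, rot y (∑ i ∈ s, ang h (α * b i)) p = p' := by
  obtain ⟨ϑ, hϑ⟩ := exists_rot_eq hy hp hp' hyp hyp'
  set F : ℝ → ℝ := fun α => ∑ i ∈ s, ang h (α * b i) with hF
  have hcont : Continuous F := by
    simp only [hF, ang]
    refine continuous_finsetSum _ fun i _ => ?_
    exact continuous_const.mul (Real.continuous_arcsin.comp (by fun_prop))
  have hinc : F 1 + 2 * Real.pi ≤ F A := by
    have hterm : ∀ i ∈ s, ang h (1 * b i) + (A - 1) * h * b i ≤ ang h (A * b i) := by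
      intro i _
      obtain ⟨b0, b1⟩ := hb i
      have r1 : h * (1 * b i) ≤ h * (A * b i) := by gcongr
      have r2 : h * (A * b i) ≤ 2 := by
        have : A * b i ≤ A := mul_le_of_le_one_right (by linarith) b1
        calc h * (A * b i) ≤ h * A := by gcongr
          _ ≤ 2 := hA
      have r0 : 0 ≤ h * (1 * b i) := by positivity
      have hlip : ∀ {x x' : ℝ}, x ≤ x' → x' - x ≥ Real.sin x' - Real.sin x := by
        intro x x' hx
        have := Real.abs_sin_sub_sin_le x' x
        rw [abs_of_nonneg (sub_nonneg.2 hx)] at this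
        exact (le_abs_self _).trans this
      have k := hlip (Real.monotone_arcsin (show h * (1 * b i) / 2 ≤ h * (A * b i) / 2 by linarith))
      rw [Real.sin_arcsin (by linarith) (by linarith), Real.sin_arcsin (by linarith) (by linarith)]
        at k
      simp only [ang]
      linarith
    have := Finset.sum_le_sum hterm
    rw [Finset.sum_add_distrib, ← Finset.mul_sum] at this
    simp only [hF]; linarith
  obtain ⟨n, hn, -⟩ := existsUnique_add_zsmul_mem_Ico Real.two_pi_pos ϑ (F 1)
  simp only [zsmul_eq_mul] at hn
  have hmem : ϑ + n * (2 * Real.pi) ∈ Icc (F 1) (F A) := ⟨hn.1, by linarith [hn.2]⟩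
  obtain ⟨α, hα, hFα⟩ := intermediate_value_Icc hA1 hcont.continuousOn hmem
  refine ⟨α, hα, ?_⟩
  have : rot y (F α) p = rot y ϑ p := by
    rw [hFα, rot, rot, Real.cos_add_int_mul_two_pi, Real.sin_add_int_mul_two_pi]
  exact this.trans hϑ

/-- The energy density of a chain that turns by the angles `ang h (s i)` about the axes `Y i`. -/
theorem eterm_le_sterm {h : ℝ} (h0 : 0 < h) {u : ℕ → E3} {s : ℕ → ℝ} {Y : ℕ → E3} {i : ℕ}
    (hu : ‖u (i + 1)‖ = 1) (hs : ∀ i, 0 ≤ s i ∧ (h * s i) ^ 2 ≤ 2) (hY : ‖Y i‖ = 1)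
    (hin : ∀ i, inner ℝ (u i) (u (i + 1)) = Real.cos (ang h (s i)))
    (hcr : ∀ i, cross (u i) (u (i + 1)) = Real.sin (ang h (s i)) • Y i)
    (hcase : Y (i + 1) = Y i ∨ (s i = 0 ∧ s (i + 1) = 0)) :
    eterm h u i ≤ sterm h (s i) (s (i + 1)) := by
  have hr : ∀ i, 0 ≤ h * s i ∧ h * s i ≤ 2 := fun i =>
    ⟨mul_nonneg h0.le (hs i).1, by
      have := (hs i).2
      nlinarith [mul_nonneg h0.le (hs i).1]⟩
  have hchi : ∀ i, chi h u i = (s i * √(1 - (h * s i / 2) ^ 2)) • Y i := by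
    intro i
    rw [chi, hcr, sin_ang (hr i).1 (hr i).2, smul_smul]
    congr 1; field_simp
  have hd : ‖chi h u (i + 1) - chi h u i‖ ^ 2 ≤ (s (i + 1) - s i) ^ 2 := by
    rw [hchi, hchi]
    rcases hcase with hc | ⟨hc1, hc2⟩
    · rw [hc, ← sub_smul, norm_smul, hY, mul_one, Real.norm_eq_abs, ← sq_abs (s (i + 1) - s i)]
      have k := abs_mul_sqrt_sub_le (x := h * s (i + 1) / 2) (y := h * s i / 2)
        (by linarith [(hr (i + 1)).1]) (by linarith [(hr i).1])
        (by nlinarith [(hs (i + 1)).2]) (by nlinarith [(hs i).2])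
      have e1 : h * s (i + 1) / 2 * √(1 - (h * s (i + 1) / 2) ^ 2) -
          h * s i / 2 * √(1 - (h * s i / 2) ^ 2) = h / 2 *
          (s (i + 1) * √(1 - (h * s (i + 1) / 2) ^ 2) - s i * √(1 - (h * s i / 2) ^ 2)) := by ring
      have e2 : h * s (i + 1) / 2 - h * s i / 2 = h / 2 * (s (i + 1) - s i) := by ring
      rw [e1, e2, abs_mul, abs_mul] at k
      have hh : 0 < |h / 2| := abs_pos.2 (by positivity)
      have := le_of_mul_le_mul_left k hh
      gcongr
    · rw [hc1, hc2]; simp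
  have e : eterm h u i = h * (1 - (s i ^ 2 + s (i + 1) ^ 2) / 2) ^ 2
      + ‖chi h u (i + 1) - chi h u i‖ ^ 2 / h := by
    rw [eterm_eq h0 hu, hin i, show u (i + 2) = u (i + 1 + 1) from rfl, hin (i + 1),
      cos_ang (hr i).1 (hr i).2, cos_ang (hr (i + 1)).1 (hr (i + 1)).2]
    congr 1; field_simp; ring
  rw [e, sterm]
  gcongr

/-- The chain with transitions at the sites `I 1, …, I m` between the axes `y 0, …, y m`. The pieces
between transitions have to be long enough (by `L` sites) to adjust the arc of each piece by less
than a full turn, at speeds between `1` and `A`. -/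
theorem exists_recovery_chain {h ε A : ℝ} {m R L N : ℕ} {I : ℕ → ℕ} {y : ℕ → E3}
    (h0 : 0 < h) (h1 : h ≤ 1 / 2) (hε : 0 < ε) (hR : 1 ≤ ε * (R * h)) (hA1 : 1 ≤ A)
    (hA : (h * A) ^ 2 ≤ 2) (hL : 2 * Real.pi ≤ (A - 1) * h * L) (hI0 : I 0 = 0)
    (hI : ∀ j < m, I j + 2 * R + 2 + L ≤ I (j + 1)) (hN : I m + R + 1 ≤ N)
    (hy : ∀ j ≤ m, ‖y j‖ = 1) :
    ∃ u : ℕ → E3, (∀ i, ∃ j ≤ m, ‖u i‖ = 1 ∧ inner ℝ (y j) (u i) = 0) ∧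
      inner ℝ (u 1) (u 0) = inner ℝ (u N) (u (N - 1)) ∧
      ∑ i ∈ Finset.range (N - 1), eterm h u i ≤
        A ^ 2 * (m * (2 * ((1 + (1 + ε) ^ 2) * (2 / 3 + 2 * h)) + h))
          + N * (h * (A ^ 2 - 1) ^ 2) ∧
      (∀ i, ‖chi h u i‖ ≤ A) ∧
      ∀ i, ∀ j ≤ m, I j + R ≤ i → (j < m → i + R < I (j + 1)) →
        ‖chi h u i - y j‖ ≤ (A - 1) + h ^ 2 * A ^ 2 / 4 := by
  have hImono : ∀ a b, a < b → b ≤ m → I a + 2 * R + 2 + L ≤ I b := by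
    intro a b hab
    induction b, hab using Nat.le_induction with
    | base => exact fun hb => hI a (by omega)
    | succ n hn ih => intro hb; have := ih (by omega); have := hI n (by omega); omega
  have hIlt : ∀ a b, a < b → b ≤ m → I a < I b := fun a b hab hb => by
    have := hImono a b hab hb; omega
  have hsep : ∀ j ∈ Finset.Icc 1 m, ∀ j' ∈ Finset.Icc 1 m, j < j' → I j + 2 * R + 2 ≤ I j' := by
    intro j _ j' hj' hjj
    have := hImono j j' hjj (Finset.mem_Icc.1 hj').2; omega
  have hIpos : ∀ j ∈ Finset.Icc 1 m, 1 ≤ I j := by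
    intro j hj
    rw [Finset.mem_Icc] at hj
    have := hImono 0 j (by omega) hj.2; omega
  set b := valleys h ε m I with hb
  have hb01 : ∀ i, 0 ≤ b i ∧ b i ≤ 1 := valleys_mem h0 h1 hε hR hsep
  have hhA : h * A ≤ 2 := by nlinarith [mul_nonneg h0.le (zero_le_one.trans hA1)]
  have hplateau : ∀ i, ∀ j ≤ m, (j = 0 ∨ I j + R ≤ i) → (j < m → i + R < I (j + 1)) → b i = 1 := by
    intro i j hj hi1 hi2
    refine valleys_eq_one h0 h1 hε hR fun j' hj' => ?_
    rw [Finset.mem_Icc] at hj'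
    rcases le_or_gt j' j with h | h
    · right
      have hj0 : I j + R ≤ i := hi1.resolve_left (by omega)
      rcases h.eq_or_lt with rfl | h
      · exact hj0
      · have := hIlt j' j h hj; omega
    · left
      have h3 := hi2 (by omega)
      rcases (show j + 1 ≤ j' from h).eq_or_lt with rfl | h'
      · exact h3
      · have := hIlt _ j' h' hj'.2; omega
  -- the points of intersection of the great circles
  choose p hp1 hp2 hp3 using fun j => exists_unit_orthogonal (y (j - 1)) (y j)
  have hamp : ∀ j, ∃ α ∈ Icc 1 A, (1 ≤ j → j < m →
      rot (y j) (∑ i ∈ Finset.Ico (I j) (I (j + 1)), ang h (α * b i)) (p j) = p (j + 1)) := by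
    intro j
    by_cases hj : 1 ≤ j ∧ j < m
    · have hcount : (L : ℝ) ≤ ∑ i ∈ Finset.Ico (I j) (I (j + 1)), b i := by
        have hlen := hI j hj.2
        have hsub : Finset.Ico (I j + R) (I j + R + L) ⊆ Finset.Ico (I j) (I (j + 1)) :=
          Finset.Ico_subset_Ico (by omega) (by omega)
        refine le_trans (le_of_eq ?_)
          (Finset.sum_le_sum_of_subset_of_nonneg hsub fun i _ _ => (hb01 i).1)
        rw [Finset.sum_congr rfl fun i hi => hplateau i j hj.2.le
          (Or.inr (Finset.mem_Ico.1 hi).1) fun _ => by have := Finset.mem_Ico.1 hi; omega]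
        simp
      obtain ⟨α, hα, hrot⟩ := exists_amplitude h0 hA1 hhA hb01 (hy j hj.2.le) (hp1 j)
        (hp1 (j + 1)) (hp3 j) (hp2 (j + 1)) (Finset.Ico (I j) (I (j + 1)))
        (hL.trans (mul_le_mul_of_nonneg_left hcount (mul_nonneg (by linarith) h0.le)))
      exact ⟨α, hα, fun _ _ => hrot⟩
    · exact ⟨1, ⟨le_rfl, hA1⟩, fun h h' => absurd ⟨h, h'⟩ hj⟩
  choose α hα hrot using hamp
  -- the first and the last piece keep the amplitude one, for the sake of the boundary condition
  set a : ℕ → ℝ := fun j => if 1 ≤ j ∧ j < m then α j else 1 with ha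
  have ha1A : ∀ j, 1 ≤ a j ∧ a j ≤ A := by
    intro j; simp only [ha]; split_ifs
    · exact hα j
    · exact ⟨le_rfl, hA1⟩
  set s : ℕ → ℝ := fun i => a (pieceIdx I m i) * b i with hs
  have hsum : ∀ j < m, ∑ i ∈ Finset.Ico (I j) (I (j + 1)), ang h (s i) =
      ∑ i ∈ Finset.Ico (I j) (I (j + 1)), ang h (a j * b i) := by
    intro j hj
    refine Finset.sum_congr rfl fun i hi => ?_
    rw [Finset.mem_Ico] at hi
    simp only [hs]
    rw [pieceIdx_eq hIlt hj.le hi.1 fun _ => hi.2]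
  -- the initial point is found by going back from the first intersection
  set p' : ℕ → E3 := fun j => if j = 0 then
    rot (y 0) (-∑ i ∈ Finset.Ico (I 0) (I 1), ang h (s i)) (p 1) else p j with hp'
  obtain ⟨u, hu⟩ := exists_spins (y := y) (p := p') hI0 hIlt hy (fun j hj => by
    simp only [hp']
    split_ifs with hj0
    · subst hj0
      exact ⟨norm_rot (hy 0 hj) (hp1 1) (hp2 1) _, inner_axis_rot (hp2 1) _⟩
    · exact ⟨hp1 j, hp3 j⟩) (fun i => ang h (s i)) (fun j hj => by
    simp only [hp', Nat.succ_ne_zero, if_false]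
    split_ifs with hj0
    · subst hj0
      rw [rot_rot (hy 0 (by omega)) (hp2 1), zero_add, neg_add_cancel, rot_zero]
    · have h1j : 1 ≤ j := by omega
      rw [hsum j hj]
      simp only [ha]; rw [if_pos ⟨h1j, hj⟩]
      exact hrot j h1j hj)
  have hsb : ∀ i, 0 ≤ s i ∧ s i ≤ A := by
    intro i
    obtain ⟨q1, q2⟩ := ha1A (pieceIdx I m i)
    obtain ⟨q3, q4⟩ := hb01 i
    exact ⟨mul_nonneg (by linarith) q3, (mul_le_of_le_one_right (by linarith) q4).trans q2⟩
  have hs2 : ∀ i, 0 ≤ s i ∧ (h * s i) ^ 2 ≤ 2 := by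
    intro i
    obtain ⟨q1, q2⟩ := hsb i
    refine ⟨q1, le_trans ?_ hA⟩
    gcongr
  have hr : ∀ i, 0 ≤ h * s i ∧ h * s i ≤ 2 := fun i =>
    ⟨mul_nonneg h0.le (hs2 i).1, by
      have := (hs2 i).2
      nlinarith [mul_nonneg h0.le (hs2 i).1]⟩
  have hchi : ∀ i, chi h u i = (s i * √(1 - (h * s i / 2) ^ 2)) • y (pieceIdx I m i) := by
    intro i
    rw [chi, (hu i).2.2.2, sin_ang (hr i).1 (hr i).2, smul_smul]
    congr 1; field_simp
  refine ⟨u, fun i => ⟨_, pieceIdx_le I m i, (hu i).1, (hu i).2.1⟩, ?_, ?_, ?_, ?_⟩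
  · have s0 : s 0 = 1 := by
      have e : pieceIdx I m 0 = 0 :=
        pieceIdx_eq hIlt (Nat.zero_le _) (by rw [hI0]) fun hm => by
          have := hI 0 hm; omega
      have e2 : b 0 = 1 := hplateau 0 0 (Nat.zero_le _) (Or.inl rfl) fun hm => by
        have := hI 0 hm; omega
      simp only [hs, e, e2, ha]; simp
    have sN : s (N - 1) = 1 := by
      have e : pieceIdx I m (N - 1) = m :=
        pieceIdx_eq hIlt le_rfl (by omega) fun hm => absurd hm (lt_irrefl _)
      have e2 : b (N - 1) = 1 := hplateau (N - 1) m le_rfl (Or.inr (by omega))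
        fun hm => absurd hm (lt_irrefl _)
      simp only [hs, e, e2, ha]; simp
    have q0 := (hu 0).2.2.1
    have qN := (hu (N - 1)).2.2.1
    rw [Nat.sub_add_cancel (by omega), sN] at qN
    rw [s0, zero_add] at q0
    rw [real_inner_comm, q0, real_inner_comm, qN]
  · have hterm : ∀ i, eterm h u i ≤ A ^ 2 * sterm h (b i) (b (i + 1)) + h * (A ^ 2 - 1) ^ 2 := by
      intro i
      have hcase := pieceIdx_succ hI0 hIlt i
      have hbreak : pieceIdx I m (i + 1) = pieceIdx I m i ∨ (b i = 0 ∧ b (i + 1) = 0) := by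
        rcases hcase with h | ⟨g1, g2, g3⟩
        · exact Or.inl h
        · exact Or.inr (valleys_break h0 h1 hε hR hsep (by simp; omega) g2)
      refine (eterm_le_sterm h0 (s := s) (Y := fun i => y (pieceIdx I m i)) (hu _).1 hs2
        (hy _ (pieceIdx_le I m i)) (fun i => (hu i).2.2.1) (fun i => (hu i).2.2.2) ?_).trans ?_
      · rcases hbreak with h | ⟨g1, g2⟩
        · left; simp only [h]
        · right; simp only [hs, g1, g2, mul_zero, and_self]
      · refine sterm_mul_le h0 (ha1A _).1 (ha1A _).2 (hb01 _) (hb01 _) ?_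
        rcases hbreak with h | h
        · left; rw [h]
        · exact Or.inr h
    refine (Finset.sum_le_sum fun i _ => hterm i).trans ?_
    rw [Finset.sum_add_distrib, ← Finset.mul_sum, Finset.sum_const, Finset.card_range, nsmul_eq_mul]
    have k1 := sum_sterm_valleys_le h0 h1 hε hR hsep hIpos (N - 1)
    have k2 : ((N - 1 : ℕ) : ℝ) ≤ N := by exact_mod_cast Nat.sub_le _ _
    gcongr
  · intro i
    have hsq : √(1 - (h * s i / 2) ^ 2) ≤ 1 := Real.sqrt_le_one.2 (by nlinarith)
    rw [hchi, norm_smul, hy _ (pieceIdx_le I m i), mul_one, Real.norm_of_nonneg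
      (mul_nonneg (hsb i).1 (Real.sqrt_nonneg _))]
    exact (mul_le_of_le_one_right (hsb i).1 hsq).trans (hsb i).2
  · intro i j hj hi1 hi2
    have e : pieceIdx I m i = j := pieceIdx_eq hIlt hj (by omega) fun hm => by
      have := hi2 hm; omega
    have e2 : b i = 1 := hplateau i j hj (Or.inr hi1) hi2
    have e3 : s i = a j := by simp only [hs, e, e2, mul_one]
    obtain ⟨q1, q2⟩ := ha1A j
    rw [hchi, e, e3]
    have e4 : (a j * √(1 - (h * a j / 2) ^ 2)) • y j - y j =
        (a j * √(1 - (h * a j / 2) ^ 2) - 1) • y j := by rw [sub_smul, one_smul]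
    rw [e4, norm_smul, hy j hj, mul_one, Real.norm_eq_abs]
    have hx : (h * a j / 2) ^ 2 ≤ h ^ 2 * A ^ 2 / 4 := by
      have : (h * a j) ^ 2 ≤ (h * A) ^ 2 := by gcongr
      nlinarith
    have hsq : √(1 - (h * a j / 2) ^ 2) ≤ 1 := Real.sqrt_le_one.2 (by nlinarith)
    have hsq2 : 1 - (h * a j / 2) ^ 2 ≤ √(1 - (h * a j / 2) ^ 2) := by
      refine Real.le_sqrt_of_sq_le ?_
      have : 0 ≤ 1 - (h * a j / 2) ^ 2 := by nlinarith
      nlinarith [sq_nonneg (h * a j / 2)]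
    have hsq0 := Real.sqrt_nonneg (1 - (h * a j / 2) ^ 2)
    have up : a j * √(1 - (h * a j / 2) ^ 2) ≤ a j := mul_le_of_le_one_right (by linarith) hsq
    have lo : √(1 - (h * a j / 2) ^ 2) ≤ a j * √(1 - (h * a j / 2) ^ 2) :=
      le_mul_of_one_le_left hsq0 q1
    have : 0 ≤ h ^ 2 * A ^ 2 / 4 := by positivity
    rw [abs_le]; constructor <;> linarith

/-! ### The upper bound -/

theorem measurable_chiralityFun (l d : ℝ) (u : ℕ → E3) : Measurable (chiralityFun l d u) :=
  measurable_from_nat.comp (Nat.measurable_floor.comp (measurable_id.div_const l))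

/-- The recovery configuration for a step function with jump points `t j`, at a fixed scale: its
chirality stays within the amplitude bound and follows the axes `y j` away from the jumps. -/
theorem exists_recovery_chirality {l d c₀ ε A : ℝ} {m R : ℕ} {t : ℕ → ℝ} {y : ℕ → E3} {Q : Set E3}
    (hl : 0 < l) (hd : 0 < d) (hh : √(2 * d) ≤ 1 / 2) (hε : 0 < ε) (hc₀ : 0 < c₀)
    (hR : 1 ≤ ε * (R * √(2 * d))) (hRc : l * (2 * R + 3) ≤ c₀)
    (hA : A = 1 + 4 * Real.pi / c₀ * (l / √(2 * d))) (hA2 : (√(2 * d) * A) ^ 2 ≤ 2)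
    (ht0 : t 0 = 0) (ht1 : t (m + 1) = 1) (ht : ∀ j ≤ m, t j + 2 * c₀ ≤ t (j + 1))
    (hy : ∀ j ≤ m, ‖y j‖ = 1 ∧ (y j ∈ Q ∨ -y j ∈ Q)) :
    ∃ w : L1I, rescaledEnergy l d Q w ≤ ENNReal.ofReal
        (A ^ 2 * (m * (2 * ((1 + (1 + ε) ^ 2) * (2 / 3 + 2 * √(2 * d))) + √(2 * d)))
          + (4 * Real.pi / c₀) ^ 2 * (l / √(2 * d)) * (A + 1) ^ 2) ∧
      (∀ᵐ x ∂volume.restrict (Icc (0 : ℝ) 1), ‖w x‖ ≤ A) ∧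
      ∀ᵐ x ∂volume.restrict (Icc (0 : ℝ) 1), ∀ j ≤ m, t j + l * (R + 1) ≤ x →
        x + l * (R + 1) ≤ t (j + 1) → ‖w x - y j‖ ≤ (A - 1) + √(2 * d) ^ 2 * A ^ 2 / 4 := by
  have hh0 : 0 < √(2 * d) := Real.sqrt_pos.2 (by positivity)
  set h := √(2 * d) with hdef
  have hpi := Real.pi_pos
  have hA1 : 1 ≤ A := by
    rw [hA]; have : 0 < 4 * Real.pi / c₀ * (l / h) := by positivity
    linarith
  have htmono : ∀ i, i ≤ m + 1 → ∀ j ≤ i, t j ≤ t i := by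
    intro i
    induction i with
    | zero => intro _ j hj; rw [Nat.le_zero.1 hj]
    | succ i ih =>
      intro hi j hj
      rcases Nat.lt_or_ge j (i + 1) with hji | hji
      · have := ih (by omega) j (by omega)
        have := ht i (by omega)
        linarith
      · rw [le_antisymm hj hji]
  have ht_nonneg : ∀ j ≤ m + 1, 0 ≤ t j := fun j hj => ht0 ▸ htmono j hj 0 (Nat.zero_le _)
  have ht_le : ∀ j ≤ m + 1, t j ≤ 1 := fun j hj => ht1 ▸ htmono (m + 1) le_rfl j hj
  have hfl : ∀ j ≤ m + 1, (⌊t j / l⌋₊ : ℝ) * l ≤ t j := fun j hj => by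
    have := Nat.floor_le (div_nonneg (ht_nonneg j hj) hl.le)
    rwa [le_div_iff₀ hl] at this
  have hfu : ∀ x : ℝ, x < ((⌊x / l⌋₊ : ℝ) + 1) * l := fun x => by
    have := Nat.lt_floor_add_one (x / l)
    rwa [div_lt_iff₀ hl] at this
  have hLl : (⌊c₀ / l⌋₊ : ℝ) * l ≤ c₀ := by
    have := Nat.floor_le (div_nonneg hc₀.le hl.le)
    rwa [le_div_iff₀ hl] at this
  have hR0 : (0 : ℝ) ≤ R := Nat.cast_nonneg R
  have hlR : 0 ≤ l * R := by positivity
  have cancel : ∀ a b : ℕ, (a : ℝ) * l < (b + 1) * l → a ≤ b := fun a b hab => by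
    have := lt_of_mul_lt_mul_right hab hl.le
    exact Nat.lt_succ_iff.1 (by exact_mod_cast this)
  obtain ⟨u, hu1, hu2, hu3, hu4, hu5⟩ := exists_recovery_chain (h := h) (ε := ε) (A := A) (m := m)
    (R := R) (L := ⌊c₀ / l⌋₊) (N := lastIdx l) (I := fun j => ⌊t j / l⌋₊) (y := y)
    hh0 hh hε hR hA1 hA2
    (by
      have h1 : c₀ ≤ 2 * ((⌊c₀ / l⌋₊ : ℝ) * l) := by
        have := hfu c₀
        nlinarith
      -- each piece contains `⌊c₀/l⌋ ≥ c₀/(2l)` sites of full speed; hence the choice of `A`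
      have h2 : (A - 1) * h * ⌊c₀ / l⌋₊ = 2 * Real.pi * (2 * ((⌊c₀ / l⌋₊ : ℝ) * l) / c₀) := by
        rw [hA]; field_simp; ring
      have h3 : 1 ≤ 2 * ((⌊c₀ / l⌋₊ : ℝ) * l) / c₀ := by rwa [le_div_iff₀ hc₀, one_mul]
      rw [h2]
      nlinarith)
    (by simp [ht0])
    (fun j hj => by
      refine cancel _ _ ?_
      push_cast
      have h1 := hfl j (by omega)
      have h2 := hfu (t (j + 1))
      have h3 := ht j hj.le
      nlinarith)
    (by
      refine cancel _ _ ?_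
      push_cast
      have h1 := hfl m (by omega)
      have h2 := hfu 1
      have h3 := ht m le_rfl
      rw [lastIdx]
      nlinarith)
    (fun j hj => (hy j hj).1)
  have hcfg : IsConfig l (circleUnion Q) u := by
    refine ⟨fun i _ => ?_, hu2⟩
    obtain ⟨j, hj, h1, h2⟩ := hu1 i
    simp only [circleUnion, greatCircle, mem_iUnion]
    rcases (hy j hj).2 with h3 | h3
    · exact ⟨_, h3, h1, h2⟩
    · exact ⟨_, h3, h1, by rw [inner_neg_left, h2, neg_zero]⟩
  have hbd : ∀ x, ‖chiralityFun l d u x‖ ≤ A := fun x => hu4 _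
  have hmem : MemLp (chiralityFun l d u) 1 (volume.restrict (Icc (0 : ℝ) 1)) :=
    MemLp.of_bound (measurable_chiralityFun l d u).aestronglyMeasurable A (ae_of_all _ hbd)
  have hw := hmem.coeFn_toLp
  refine ⟨hmem.toLp _, (rescaledEnergy_le hl hd hcfg hw).trans (ENNReal.ofReal_le_ofReal ?_), ?_, ?_⟩
  · refine hu3.trans (add_le_add le_rfl ?_)
    have hN : (lastIdx l : ℝ) ≤ 1 / l := Nat.floor_le (by positivity)
    calc (lastIdx l : ℝ) * (h * (A ^ 2 - 1) ^ 2) ≤ 1 / l * (h * (A ^ 2 - 1) ^ 2) := by gcongr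
      _ = 1 / l * (h * ((A - 1) ^ 2 * (A + 1) ^ 2)) := by ring
      _ = _ := by rw [show A - 1 = 4 * Real.pi / c₀ * (l / h) by rw [hA]; ring]; field_simp
  · filter_upwards [hw] with x hx
    rw [hx]; exact hbd x
  · filter_upwards [hw, ae_restrict_mem measurableSet_Icc] with x hx hx01 j hj h1 h2
    have hxl : (⌊x / l⌋₊ : ℝ) * l ≤ x := by
      have := Nat.floor_le (div_nonneg hx01.1 hl.le)
      rwa [le_div_iff₀ hl] at this
    have hxu := hfu x
    have hlt : ⌊x / l⌋₊ + R < lastIdx l := by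
      refine cancel (⌊x / l⌋₊ + R + 1) _ ?_
      have := hfu 1
      have := ht_le (j + 1) (by omega)
      push_cast [lastIdx]
      nlinarith
    rw [hx, chiralityFun_eq_chi (by omega)]
    refine hu5 _ j hj ?_ fun hjm => ?_
    · refine cancel _ _ ?_
      have := hfl j (by omega)
      push_cast
      nlinarith
    · refine cancel (⌊x / l⌋₊ + R + 1) _ ?_
      have := hfu (t (j + 1))
      push_cast
      nlinarith

theorem IsStep.mem_values {z : ℝ → E3} {m : ℕ} {t : ℕ → ℝ} {c : ℕ → E3} (S : IsStep z m t c)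
    {K : Set E3} (hz : ∀ᵐ x ∂volume.restrict (Ioo (0 : ℝ) 1), z x ∈ K) {j : ℕ} (hj : j ≤ m) :
    c j ∈ K := by
  have h1 := S.ae_eq j hj
  have h2 := ae_mono (Measure.restrict_mono (S.Ioo_subset hj) le_rfl) hz
  have : (ae (volume.restrict (Ioo (t j) (t (j + 1))))).NeBot := by
    rw [ae_neBot, Ne, Measure.restrict_eq_zero, Real.volume_Ioo, ENNReal.ofReal_eq_zero, not_le]
    exact sub_pos.2 (S.lt_succ j hj)
  obtain ⟨x, hx1, hx2⟩ := (h1.and h2).exists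
  exact hx1 ▸ hx2

/-- Points of the limit set are limits of axes, up to the sign. -/
theorem exists_tendsto_axes {k : ℕ → ℕ} {q : (n : ℕ) → Fin (k n) → E3} {Qbar : Set E3}
    (hQ : KuratowskiTendsto (fun n => range (q n)) Qbar) {v : E3}
    (hv : v ∈ Qbar ∪ {v | -v ∈ Qbar}) :
    ∃ y : ℕ → E3, (∀ n, y n ∈ range (q n) ∨ -y n ∈ range (q n)) ∧ Tendsto y atTop (𝓝 v) := by
  rcases hv with hv | hv
  · obtain ⟨x, h1, h2⟩ := hQ.2.2 v hv
    exact ⟨x, fun n => Or.inl (h1 n), h2⟩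
  · obtain ⟨x, h1, h2⟩ := hQ.2.2 (-v) hv
    exact ⟨fun n => -x n, fun n => Or.inr (by rw [neg_neg]; exact h1 n), by simpa using h2.neg⟩

/-- Dominated convergence. -/
theorem tendsto_L1I_of_ae {w : ℕ → L1I} {z : L1I} {C : ℝ}
    (hb : ∀ᶠ n in atTop, ∀ᵐ x ∂volume.restrict (Icc (0 : ℝ) 1), ‖w n x‖ ≤ C)
    (hlim : ∀ᵐ x ∂volume.restrict (Icc (0 : ℝ) 1), Tendsto (fun n => w n x) atTop (𝓝 (z x))) :
    Tendsto w atTop (𝓝 z) := by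
  rw [Lp.tendsto_Lp_iff_tendsto_eLpNorm']
  simp only [eLpNorm_one_eq_lintegral_enorm]
  have hz : Integrable (z : ℝ → E3) (volume.restrict (Icc (0 : ℝ) 1)) := L1.integrable_coeFn z
  have hg : Integrable (fun x => C + ‖z x‖) (volume.restrict (Icc (0 : ℝ) 1)) :=
    (integrable_const C).add hz.norm
  have key := tendsto_lintegral_filter_of_dominated_convergence (l := atTop)
    (μ := volume.restrict (Icc (0 : ℝ) 1)) (F := fun n x => ‖(w n - z : ℝ → E3) x‖ₑ)
    (f := fun _ => 0) (fun x => ‖C + ‖z x‖‖ₑ) ?_ ?_ hg.2.ne ?_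
  · simpa using key
  · exact Eventually.of_forall fun n => ((Lp.stronglyMeasurable (w n)).sub
      (Lp.stronglyMeasurable z)).enorm
  · filter_upwards [hb] with n hn
    filter_upwards [hn] with x hx
    rw [← ofReal_norm, ← ofReal_norm]
    refine ENNReal.ofReal_le_ofReal ((norm_sub_le _ _).trans ?_)
    exact (add_le_add hx le_rfl).trans (le_abs_self _)
  · filter_upwards [hlim] with x hx
    have := (hx.sub_const (z x)).enorm
    simpa using this

/-- The upper bound of the `Γ`-limit at step functions. -/
theorem IsStep.exists_recovery {lam del : ℕ → ℝ} {k : ℕ → ℕ}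
    {q : (n : ℕ) → Fin (k n) → E3} {Qbar : Set E3}
    (hlam : ∀ n, 0 < lam n) (hdel : ∀ n, 0 < del n)
    (hlam0 : Tendsto lam atTop (𝓝 0)) (hdel0 : Tendsto del atTop (𝓝 0))
    (hq : ∀ n j, ‖q n j‖ = 1) (hQbar : KuratowskiTendsto (fun n => range (q n)) Qbar)
    (hscale : Tendsto (fun n => lam n / √(del n)) atTop (𝓝 0)) {z : L1I} {m : ℕ} {t : ℕ → ℝ}
    {c : ℕ → E3} (S : IsStep z m t c) (hc : ∀ j ≤ m, c j ∈ Qbar ∪ {v | -v ∈ Qbar}) :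
    ∃ w : ℕ → L1I, Tendsto w atTop (𝓝 z) ∧
      limsup (fun n => rescaledEnergy (lam n) (del n) (range (q n)) (w n)) atTop ≤
        ENNReal.ofReal (8 / 3 * m) := by
  choose! Y hY1 hY2 using fun j (hj : j ≤ m) => exists_tendsto_axes hQbar (hc j hj)
  have hYnorm : ∀ j ≤ m, ∀ n, ‖Y j n‖ = 1 := by
    intro j hj n
    rcases hY1 j hj n with ⟨i, hi⟩ | ⟨i, hi⟩
    · rw [← hi, hq]
    · rw [← norm_neg, ← hi, hq]
  -- half of the smallest distance between consecutive jumps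
  obtain ⟨c₀, hc₀, ht⟩ : ∃ c₀ : ℝ, 0 < c₀ ∧ ∀ j ≤ m, t j + 2 * c₀ ≤ t (j + 1) := by
    obtain ⟨j₀, hj₀, hmin⟩ := Finset.exists_min_image (Finset.range (m + 1))
      (fun j => t (j + 1) - t j) ⟨0, by simp⟩
    refine ⟨(t (j₀ + 1) - t j₀) / 2, ?_, fun j hj => ?_⟩
    · have := S.lt_succ j₀ (by simpa [Nat.lt_succ_iff] using hj₀)
      linarith
    · have := hmin j (by simpa [Nat.lt_succ_iff] using hj)
      linarith
  -- the transition layers have the length `λ R ≤ ε + λ`, which tends to zero because `λ / (ε h) = ε`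
  set h : ℕ → ℝ := fun n => √(2 * del n) with hdef
  set ρ : ℕ → ℝ := fun n => lam n / h n with ρdef
  set ε : ℕ → ℝ := fun n => √(ρ n) with εdef
  set A : ℕ → ℝ := fun n => 1 + 4 * Real.pi / c₀ * ρ n with Adef
  set R : ℕ → ℕ := fun n => ⌈1 / (ε n * h n)⌉₊ with Rdef
  have hh0 : ∀ n, 0 < h n := fun n => Real.sqrt_pos.2 (by have := hdel n; positivity)
  have hρ0 : ∀ n, 0 < ρ n := fun n => div_pos (hlam n) (hh0 n)
  have hε0 : ∀ n, 0 < ε n := fun n => Real.sqrt_pos.2 (hρ0 n)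
  have hh : Tendsto h atTop (𝓝 0) := by
    have := (hdel0.const_mul 2).sqrt
    rwa [mul_zero, Real.sqrt_zero] at this
  have hρ : Tendsto ρ atTop (𝓝 0) := by
    have := hscale.div_const (√2)
    rw [zero_div] at this
    refine this.congr fun n => ?_
    simp only [ρdef, hdef]
    rw [Real.sqrt_mul zero_le_two, div_div, mul_comm]
  have hε : Tendsto ε atTop (𝓝 0) := by simpa using hρ.sqrt
  have hA : Tendsto A atTop (𝓝 1) := by simpa using (hρ.const_mul (4 * Real.pi / c₀)).const_add 1
  have hRl : ∀ n, lam n * (R n : ℝ) ≤ ε n + lam n := by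
    intro n
    have h1 : (R n : ℝ) ≤ 1 / (ε n * h n) + 1 :=
      (Nat.ceil_lt_add_one (by have := hε0 n; have := hh0 n; positivity)).le
    have h2 : lam n / (ε n * h n) = ε n := by
      rw [div_eq_iff (mul_pos (hε0 n) (hh0 n)).ne', ← mul_assoc, Real.mul_self_sqrt (hρ0 n).le]
      exact (div_mul_cancel₀ _ (hh0 n).ne').symm
    calc lam n * (R n : ℝ) ≤ lam n * (1 / (ε n * h n) + 1) := by have := hlam n; gcongr
      _ = lam n / (ε n * h n) + lam n := by ring
      _ = _ := by rw [h2]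
  have hR0 : Tendsto (fun n => lam n * (R n : ℝ)) atTop (𝓝 0) :=
    squeeze_zero (fun n => mul_nonneg (hlam n).le (Nat.cast_nonneg _)) hRl
      (by simpa using hε.add hlam0)
  have hgap : Tendsto (fun n => lam n * ((R n : ℝ) + 1)) atTop (𝓝 0) := by
    have := hR0.add hlam0
    rw [add_zero] at this
    exact this.congr fun n => by ring
  have hex : ∀ᶠ n in atTop, ∃ w : L1I,
      rescaledEnergy (lam n) (del n) (range (q n)) w ≤ ENNReal.ofReal
        (A n ^ 2 * (m * (2 * ((1 + (1 + ε n) ^ 2) * (2 / 3 + 2 * h n)) + h n))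
          + (4 * Real.pi / c₀) ^ 2 * ρ n * (A n + 1) ^ 2) ∧
      (∀ᵐ x ∂volume.restrict (Icc (0 : ℝ) 1), ‖w x‖ ≤ A n) ∧
      ∀ᵐ x ∂volume.restrict (Icc (0 : ℝ) 1), ∀ j ≤ m, t j + lam n * (R n + 1) ≤ x →
        x + lam n * (R n + 1) ≤ t (j + 1) → ‖w x - Y j n‖ ≤ (A n - 1) + h n ^ 2 * A n ^ 2 / 4 := by
    have e1 : ∀ᶠ n in atTop, h n ≤ 1 / 2 := hh.eventually_le_const (by norm_num)
    have e2 : ∀ᶠ n in atTop, lam n * (2 * R n + 3) ≤ c₀ := by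
      have : Tendsto (fun n => 2 * (lam n * (R n : ℝ)) + 3 * lam n) atTop (𝓝 0) := by
        simpa using (hR0.const_mul 2).add (hlam0.const_mul 3)
      filter_upwards [this.eventually_le_const hc₀] with n hn
      linarith
    have e3 : ∀ᶠ n in atTop, (h n * A n) ^ 2 ≤ 2 := by
      have : Tendsto (fun n => (h n * A n) ^ 2) atTop (𝓝 0) := by simpa using (hh.mul hA).pow 2
      exact this.eventually_le_const (by norm_num)
    filter_upwards [e1, e2, e3] with n h1 h2 h3
    refine exists_recovery_chirality (hlam n) (hdel n) h1 (hε0 n) hc₀ ?_ h2 rfl h3 S.zero S.last ht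
      fun j hj => ⟨hYnorm j hj n, hY1 j hj n⟩
    have := Nat.le_ceil (1 / (ε n * h n))
    rw [div_le_iff₀ (mul_pos (hε0 n) (hh0 n))] at this
    calc 1 ≤ _ := this
      _ = _ := by simp only [Rdef, hdef]; ring
  obtain ⟨w, hw⟩ := hex.choice
  refine ⟨w, ?_, ?_⟩
  · refine tendsto_L1I_of_ae (C := 2) ?_ ?_
    · filter_upwards [hw, hA.eventually_le_const one_lt_two] with n hn hn2
      filter_upwards [hn.2.1] with x hx using hx.trans hn2
    · have hwae : ∀ᵐ x ∂volume.restrict (Icc (0 : ℝ) 1), ∀ᶠ n in atTop, ∀ j ≤ m,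
          t j + lam n * (R n + 1) ≤ x → x + lam n * (R n + 1) ≤ t (j + 1) →
            ‖w n x - Y j n‖ ≤ (A n - 1) + h n ^ 2 * A n ^ 2 / 4 := by
        obtain ⟨n₀, hn₀⟩ := eventually_atTop.1 hw
        have : ∀ n, ∀ᵐ x ∂volume.restrict (Icc (0 : ℝ) 1), n₀ ≤ n → ∀ j ≤ m,
            t j + lam n * (R n + 1) ≤ x → x + lam n * (R n + 1) ≤ t (j + 1) →
            ‖w n x - Y j n‖ ≤ (A n - 1) + h n ^ 2 * A n ^ 2 / 4 := by
          intro n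
          by_cases hn : n₀ ≤ n
          · filter_upwards [(hn₀ n hn).2.2] with x hx _ using hx
          · exact ae_of_all _ fun x h => absurd h hn
        filter_upwards [ae_all_iff.2 this] with x hx
        exact eventually_atTop.2 ⟨n₀, fun n hn => hx n hn⟩
      have hzae : ∀ᵐ x ∂volume.restrict (Icc (0 : ℝ) 1),
          ∃ j ≤ m, x ∈ Ioo (t j) (t (j + 1)) ∧ z x = c j := by
        have h0 : ∀ᵐ x ∂volume.restrict (Icc (0 : ℝ) 1), x ∈ Ioo (0 : ℝ) 1 := by
          rw [← restrict_Ioo_eq_restrict_Icc]; exact ae_restrict_mem measurableSet_Ioo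
        have h1 : ∀ᵐ x : ℝ, x ∉ (t '' (Finset.range (m + 1) : Set ℕ)) :=
          measure_eq_zero_iff_ae_notMem.1
            (((Finset.finite_toSet _).image t).measure_zero volume)
        have h2 : ∀ᵐ x : ℝ, ∀ j ≤ m, x ∈ Ioo (t j) (t (j + 1)) → z x = c j := by
          rw [ae_all_iff]; intro j
          by_cases hj : j ≤ m
          · filter_upwards [(ae_restrict_iff' measurableSet_Ioo).1 (S.ae_eq j hj)] with x hx _ using hx
          · exact ae_of_all _ fun x h => absurd h hj
        filter_upwards [ae_restrict_of_ae h1, ae_restrict_of_ae h2, h0] with x hx1 hx2 hx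
        rcases S.exists_mem hx with ⟨j, _, hj, rfl⟩ | ⟨j, hj, hxj⟩
        · exact absurd ⟨j, by simpa [Nat.lt_succ_iff] using hj, rfl⟩ hx1
        · exact ⟨j, hj, hxj, hx2 j hj hxj⟩
      have herr : Tendsto (fun n => (A n - 1) + h n ^ 2 * A n ^ 2 / 4) atTop (𝓝 0) := by
        simpa using (hA.sub_const 1).add (((hh.pow 2).mul (hA.pow 2)).div_const 4)
      filter_upwards [hwae, hzae] with x hx hxz
      obtain ⟨j, hj, hxj, hzx⟩ := hxz
      rw [hzx]
      have h1 : ∀ᶠ n in atTop, lam n * ((R n : ℝ) + 1) ≤ x - t j :=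
        hgap.eventually_le_const (by linarith [hxj.1])
      have h2 : ∀ᶠ n in atTop, lam n * ((R n : ℝ) + 1) ≤ t (j + 1) - x :=
        hgap.eventually_le_const (by linarith [hxj.2])
      have h3 : Tendsto (fun n => w n x - Y j n) atTop (𝓝 0) := by
        refine squeeze_zero_norm' ?_ herr
        filter_upwards [hx, h1, h2] with n hn h1 h2
        exact hn j hj (by linarith) (by linarith)
      simpa using h3.add (hY2 j hj)
  · have hlim : Tendsto (fun n =>
        A n ^ 2 * (m * (2 * ((1 + (1 + ε n) ^ 2) * (2 / 3 + 2 * h n)) + h n))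
          + (4 * Real.pi / c₀) ^ 2 * ρ n * (A n + 1) ^ 2) atTop (𝓝 (8 / 3 * (m : ℝ))) := by
      have h1 := ((((hε.const_add 1).pow 2).const_add 1).mul
        ((hh.const_mul 2).const_add (2 / 3))).const_mul 2
      have h2 := (hA.pow 2).mul ((h1.add hh).const_mul (m : ℝ))
      have h3 := (hρ.const_mul ((4 * Real.pi / c₀) ^ 2)).mul ((hA.add_const 1).pow 2)
      have h4 := h2.add h3
      convert h4 using 2
      ring
    calc limsup (fun n => rescaledEnergy (lam n) (del n) (range (q n)) (w n)) atTop
        ≤ limsup (fun n => ENNReal.ofReal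
            (A n ^ 2 * (m * (2 * ((1 + (1 + ε n) ^ 2) * (2 / 3 + 2 * h n)) + h n))
          + (4 * Real.pi / c₀) ^ 2 * ρ n * (A n + 1) ^ 2)) atTop :=
          limsup_le_limsup (hw.mono fun n hn => hn.1)
      _ = _ := (ENNReal.tendsto_ofReal hlim).limsup_eq

end HelicalXY

end

theorem mainTheorem1
    (lam del : ℕ → ℝ) (k : ℕ → ℕ)
    (q : (n : ℕ) → Fin (k n) → HelicalXY.E3) (Qbar : Set HelicalXY.E3)
    (hlam : ∀ n, 0 < lam n) (hdel : ∀ n, 0 < del n) (hk : ∀ n, 1 ≤ k n)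
    (hlam0 : Tendsto lam atTop (𝓝 0)) (hdel0 : Tendsto del atTop (𝓝 0))
    (hq : ∀ n j, ‖q n j‖ = 1) (hqinj : ∀ n, Function.Injective (q n))
    (hQbar : HelicalXY.KuratowskiTendsto (fun n => range (q n)) Qbar)
    (hscale : Tendsto (fun n => lam n / √(del n)) atTop (𝓝 0))
    (hcircles : Tendsto (fun n => (k n : ℝ) * del n ^ (1 / 4 : ℝ)) atTop (𝓝 0)) :
    HelicalXY.GammaTendsto
      (fun n => HelicalXY.rescaledEnergy (lam n) (del n) (range (q n)))
      (HelicalXY.limitEnergy (Qbar ∪ {v | -v ∈ Qbar})) := by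
  intro z
  refine ⟨fun w hw => HelicalXY.limitEnergy_le_liminf lam del k q Qbar hlam hdel hk hlam0 hdel0 hq
    hQbar hscale hcircles z w hw, ?_⟩
  by_cases hz : HelicalXY.IsBVpc (Qbar ∪ {v | -v ∈ Qbar}) z ∧ (HelicalXY.jumpSet z).Finite
  · obtain ⟨m, t, c, S, hm⟩ := hz.1.exists_isStep hz.2
    obtain ⟨w, hw1, hw2⟩ := S.exists_recovery hlam hdel hlam0 hdel0 hq hQbar hscale
      fun j hj => S.mem_values hz.1.2.2 hj
    refine ⟨w, hw1, hw2.trans (le_of_eq ?_)⟩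
    rw [HelicalXY.limitEnergy, if_pos hz.1, hm, ENNReal.ofReal_mul (by norm_num)]
    simp
  · -- the limit functional is infinite, so every sequence will do
    have htop : HelicalXY.limitEnergy (Qbar ∪ {v | -v ∈ Qbar}) z = ∞ := by
      rw [HelicalXY.limitEnergy]
      split_ifs with h
      · have hinf : ¬ (HelicalXY.jumpSet z).Finite := fun hf => hz ⟨h, hf⟩
        rw [Set.encard_eq_top_iff.2 hinf, ENat.toENNReal_top, ENNReal.mul_top (by norm_num)]
      · rfl
    exact ⟨fun _ => z, tendsto_const_nhds, htop ▸ le_top⟩
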